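/- Let $d\ge 1$, let $\gamma$ be the standard Gaussian probability measure on $\mathbb{R}^d$, $d\gamma(y)=(2\pi)^{-d/2}e^{-|y|^2/2}\,dy$, let $Lf(x)=\Delta f(x)-x\cdot\nabla f(x)$ and, for $s\ge 0$, let $$e^{sL}f(x)=\int_{\mathbb{R}^d} f\big(e^{-s}x+(1-e^{-2s})^{1/2}y\big)\,d\gamma(y)$$ be the Ornstein--Uhlenbeck semigroup. Let $f:\mathbb{R}^d\to[0,\infty)$ be a bounded, compactly supported measurable function, and let $u:(0,\infty)\times\mathbb{R}^d\to[0,\infty)$ be a nonnegative classical solution of $\partial_t u=Lu$ (that is, $u$ is $C^1$ in $t$ and $C^2$ in $x$ with $u,\partial_t u,\nabla u,D^2u$ jointly continuous) with initial data $f$, in the sense that $\lim_{t\downarrow0}\int u(t,x)\varphi(x)\,dx=\int f(x)\varphi(x)\,dx$ for every continuous compactly supported $\varphi:\mathbb{R}^d\to\mathbb{R}$. Let $1<p<q<\infty$ and let $s$ be given by $e^{2s}=\frac{q-1}{p-1}$. Then for all $t>0$ the integrals defining $$Q(t)=\int_{\mathbb{R}^d}\Big(e^{sL}\big(u(t,\cdot)^{1/p}\big)(x)\Big)^q\,d\gamma(x)$$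 converge absolutely, $Q(t)>0$ unless $f=0$ almost everywhere, and $Q$ is nondecreasing on $(0,\infty)$. -/

import Mathlib

open MeasureTheory Set Filter Topology

noncomputable section

/-- The standard Gaussian probability measure on `ℝ^d`, with density
`(2π)^(-d/2) exp(-|y|²/2)` with respect to Lebesgue measure. -/
abbrev gaussMeasure (d : ℕ) : Measure (EuclideanSpace ℝ (Fin d)) :=
  ProbabilityTheory.stdGaussian (EuclideanSpace ℝ (Fin d))

/-- The Ornstein-Uhlenbeck semigroup
`e^{sL} f (x) = ∫ f (e^{-s} x + (1 - e^{-2s})^{1/2} y) dγ(y)`. -/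
def ouSemigroup {d : ℕ} (s : ℝ) (f : EuclideanSpace ℝ (Fin d) → ℝ)
    (x : EuclideanSpace ℝ (Fin d)) : ℝ :=
  ∫ y, f (Real.exp (-s) • x + Real.sqrt (1 - Real.exp (-2 * s)) • y) ∂(gaussMeasure d)

/-- The Ornstein-Uhlenbeck generator `L f (x) = Δ f (x) - x · ∇ f (x)`. -/
def ouGenerator {d : ℕ} (f : EuclideanSpace ℝ (Fin d) → ℝ)
    (x : EuclideanSpace ℝ (Fin d)) : ℝ :=
  Laplacian.laplacian f x - inner ℝ x (gradient f x)

/-- `u` is a nonnegative classical (`C^{1,2}`) solution of `∂_t u = L u` on `(0,∞) × ℝ^d`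
with initial data `f`. The values `u t` for `t ≤ 0` play no role; the initial data are attained
in the weak sense, `∫ u(t,x) φ(x) dx → ∫ f(x) φ(x) dx` as `t ↓ 0` for all `φ ∈ C_c(ℝ^d)`.
Joint continuity of `∂_t u` follows from the equation and the other fields. -/
structure IsOUSolution {d : ℕ} (u : ℝ → EuclideanSpace ℝ (Fin d) → ℝ)
    (f : EuclideanSpace ℝ (Fin d) → ℝ) : Prop where
  nonneg : ∀ t, 0 < t → ∀ x, 0 ≤ u t x
  contDiff : ∀ t, 0 < t → ContDiff ℝ 2 (u t)
  continuousOn : ContinuousOn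
    (fun z : ℝ × EuclideanSpace ℝ (Fin d) => u z.1 z.2) (Ioi 0 ×ˢ univ)
  continuousOn_fderiv : ContinuousOn
    (fun z : ℝ × EuclideanSpace ℝ (Fin d) => fderiv ℝ (u z.1) z.2) (Ioi 0 ×ˢ univ)
  continuousOn_fderiv_fderiv : ContinuousOn
    (fun z : ℝ × EuclideanSpace ℝ (Fin d) => fderiv ℝ (fderiv ℝ (u z.1)) z.2) (Ioi 0 ×ˢ univ)
  equation : ∀ t, 0 < t → ∀ x, HasDerivAt (fun r => u r x) (ouGenerator (u t) x) t
  initial : ∀ φ : EuclideanSpace ℝ (Fin d) → ℝ, Continuous φ → HasCompactSupport φ →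
    Tendsto (fun t => ∫ x, u t x * φ x) (𝓝[>] 0) (𝓝 (∫ x, f x * φ x))

/-- The functional `Q(t) = ∫ (e^{sL} (u(t,·)^{1/p}))^q dγ`. -/
def ouQ {d : ℕ} (p q s : ℝ) (u : ℝ → EuclideanSpace ℝ (Fin d) → ℝ) (t : ℝ) : ℝ :=
  ∫ x, (ouSemigroup s (fun z => u t z ^ (1 / p)) x) ^ q ∂(gaussMeasure d)

end

/-! ### Stability of Gaussian laws and the heat kernel density -/

section GaussianBasics

open ProbabilityTheory

/-! Monotonicity of `Q` rests on two facts: the solution is `u t = e^{tL} f`, and the semigroup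
obeys the pointwise inequality `e^{rL}[(e^{sL} g^{1/p})^q] ≤ (e^{sL}(e^{rL} g)^{1/p})^q` for
continuous bounded `g ≥ 0`. With `g = u t₁` and `r = t₂ - t₁`, the right side is the integrand of
`Q(t₂)`, while the integral of the left side is `Q(t₁)`, because the Gaussian measure is invariant
under `e^{rL}`.

The pointwise inequality (`integral_gaussAvg_rpow_le`) follows by duality from bilinear
hypercontractivity: for a standard Gaussian pair with correlation `ρ = e^{-s}`, `E[F(ξ)^α G(η)^β] ≤
(E F)^α (E G)^β` whenever `(1-α)(1-β) = ρ²αβ`. For `α = 1/p` and `β = 1 - 1/q` this condition is the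
relation between `p`, `q` and `s`.

The bilinear inequality (`integral_rpow_mul_rpow_correlated_le`) is local. Over a Gaussian step of
size `c`, the linear terms in the expansion of `F^α G^β` average to zero, and the second-order term
averages to a quadratic form that the exponent condition makes nonpositive; the error is `O(c³)`.
Taking `n` steps of size `n^{-1/2}` leaves a total error `O(n^{-1/2})`. The constants are uniform
because averaging preserves the bounds of the class `IsC11Between`; general continuous bounded
functions are reached by approximation.

The representation `u t = e^{tL} f` (`IsOUSolution.eq_ouSemigroup`) is a uniqueness theorem of
Widder type, with positivity in place of a growth condition. Self-similar variables centred at `(T,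
x)` turn `u` into a nonnegative solution `h` of the backward heat equation on `-1 < ρ < e^{2T} - 1`,
where `ρ = 0` is time `T` and the right end is time `0`. Formally the pairing of `h(ρ)` with the
heat kernel at time `ρ` is constant. To prove this, a convex truncation of the kernel, which is a
compactly supported subsolution, first gives a bound for Gaussian integrals of `h`
(`IsBackwardHeat.integral_convexTrunc_le`); that bound then controls the error of a spatial cutoff
at `|y|² ~ A` by `K / A`, uniformly in `ρ` (`IsBackwardHeat.exists_abs_pairing_sub_le`). Letting `ρ`
reach the right end and then `A → ∞` gives the formula. -/

theorem exists_cos_sin_eq {x y : ℝ} (h : x ^ 2 + y ^ 2 = 1) :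
    ∃ θ : ℝ, Real.cos θ = x ∧ Real.sin θ = y := by
  have hz : ‖(⟨x, y⟩ : ℂ)‖ = 1 := by
    rw [← sq_eq_sq₀ (norm_nonneg _) zero_le_one, Complex.sq_norm, Complex.normSq_mk]
    nlinarith
  have hz0 : (⟨x, y⟩ : ℂ) ≠ 0 := by
    intro h0; rw [h0] at hz; simp at hz
  refine ⟨Complex.arg ⟨x, y⟩, ?_, ?_⟩
  · rw [Complex.cos_arg hz0, hz]; simp
  · rw [Complex.sin_arg, hz]; simp

/-- Stability of centred Gaussian measures: if `X, Y` are independent with law `μ`, then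
`a X + b Y` has the law of `c X` as soon as `a² + b² = c²`. -/
theorem map_smul_add_smul_prod_of_isGaussian {W : Type*} [NormedAddCommGroup W] [NormedSpace ℝ W]
    [MeasurableSpace W] [BorelSpace W] [SecondCountableTopology W] [CompleteSpace W]
    {μ : Measure W} [IsGaussian μ] (hμ : ∀ L : StrongDual ℝ W, μ[L] = 0) {a b c : ℝ}
    (h : a ^ 2 + b ^ 2 = c ^ 2) :
    (μ.prod μ).map (fun p => a • p.1 + b • p.2) = μ.map (fun x => c • x) := by
  rcases eq_or_ne c 0 with rfl | hc
  · have ha : a = 0 := by nlinarith [sq_nonneg a, sq_nonneg b]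
    have hb : b = 0 := by nlinarith [sq_nonneg a, sq_nonneg b]
    subst ha; subst hb
    simp [Measure.map_const]
  -- The law of an independent centred Gaussian pair is rotation invariant, and `a X + b Y` is `c`
  -- times the first coordinate of the pair rotated by the angle with cosine `a / c` and sine `b /
  -- c`.
  · obtain ⟨θ, h1, h2⟩ := exists_cos_sin_eq (x := a / c) (y := b / c) (by
      field_simp; exact h)
    have key : (fun p : W × W => a • p.1 + b • p.2)
        = (fun x => c • x) ∘ Prod.fst ∘ (ContinuousLinearMap.rotation (E := W) θ) := by
      ext p
      simp only [Function.comp, ContinuousLinearMap.rotation_apply, h1, h2, smul_add, smul_smul]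
      rw [mul_div_cancel₀ _ hc, mul_div_cancel₀ _ hc]
    rw [key, ← Measure.map_map (by fun_prop) (by fun_prop),
      ← Measure.map_map (by fun_prop) (by fun_prop),
      IsGaussian.map_rotation_eq_self_of_forall_strongDual_eq_zero hμ θ, Measure.map_fst_prod]
    simp

theorem integral_integral_smul_add_smul_of_isGaussian {W : Type*} [NormedAddCommGroup W]
    [NormedSpace ℝ W]
    [MeasurableSpace W] [BorelSpace W] [SecondCountableTopology W] [CompleteSpace W]
    {μ : Measure W} [IsGaussian μ] (hμ : ∀ L : StrongDual ℝ W, μ[L] = 0) {a b c : ℝ}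
    (h : a ^ 2 + b ^ 2 = c ^ 2) {F : W → ℝ} (hF : Integrable F (μ.map (fun x => c • x))) :
    ∫ x, ∫ y, F (a • x + b • y) ∂μ ∂μ = ∫ x, F (c • x) ∂μ := by
  have hm : Measurable (fun p : W × W => a • p.1 + b • p.2) := by fun_prop
  have hc : Measurable (fun x : W => c • x) := by fun_prop
  rw [← integral_map hc.aemeasurable hF.1]
  rw [← map_smul_add_smul_prod_of_isGaussian hμ h] at hF ⊢
  rw [integral_map hm.aemeasurable hF.1, integral_prod]
  exact (integrable_map_measure hF.1 hm.aemeasurable).1 hF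

variable {E : Type*} [NormedAddCommGroup E] [InnerProductSpace ℝ E] [FiniteDimensional ℝ E]
  [MeasurableSpace E] [BorelSpace E]

theorem integral_integral_smul_add_smul_stdGaussian {a b c : ℝ}
    (h : a ^ 2 + b ^ 2 = c ^ 2) {F : E → ℝ}
    (hF : Integrable F ((stdGaussian E).map (fun x => c • x))) :
    ∫ x, ∫ y, F (a • x + b • y) ∂(stdGaussian E) ∂(stdGaussian E)
      = ∫ x, F (c • x) ∂(stdGaussian E) :=
  integral_integral_smul_add_smul_of_isGaussian integral_strongDual_stdGaussian h hF

/-- The heat kernel for `½ Δ` at time `ρ`, as a function of the squared distance `v`. -/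
noncomputable def heatKer (n : ℕ) (ρ v : ℝ) : ℝ :=
  (2 * Real.pi * ρ) ^ (-(n / 2 : ℝ)) * Real.exp (-v / (2 * ρ))

theorem heatKer_pos {n : ℕ} {ρ : ℝ} (hρ : 0 < ρ) (v : ℝ) : 0 < heatKer n ρ v := by
  unfold heatKer; positivity

/-- Finite measures are determined by their characteristic functions; on the density side this is an
explicit Gaussian Fourier integral. -/
theorem stdGaussian_eq_withDensity :
    stdGaussian E = (volume : Measure E).withDensity
      (fun y => ENNReal.ofReal (heatKer (Module.finrank ℝ E) 1 (‖y‖ ^ 2))) := by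
  set n := Module.finrank ℝ E
  have hexp : ∀ y : E, heatKer n 1 (‖y‖ ^ 2)
      = (2 * Real.pi) ^ (-(n / 2 : ℝ)) * Real.exp (-(1 / 2) * ‖y‖ ^ 2) := by
    intro y; unfold heatKer; congr 2 <;> ring
  have hI : ∫ v : E, Real.exp (-(1 / 2) * ‖v‖ ^ 2) = (2 * Real.pi) ^ (n / 2 : ℝ) := by
    have := GaussianFourier.integral_rexp_neg_mul_sq_norm (V := E) (b := 1 / 2) (by norm_num)
    rw [this]; congr 1; ring
  -- A nonintegrable function would have integral `0`, against the positive value in `hI`.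
  have hint : Integrable (fun v : E => Real.exp (-(1 / 2) * ‖v‖ ^ 2)) := by
    by_contra hcon
    rw [integral_undef hcon] at hI
    have : (0 : ℝ) < (2 * Real.pi) ^ (n / 2 : ℝ) := by positivity
    linarith
  have hint2 : Integrable (fun v : E => heatKer n 1 (‖v‖ ^ 2)) := by
    simp_rw [hexp]; exact hint.const_mul _
  have : IsFiniteMeasure ((volume : Measure E).withDensity
      (fun y => ENNReal.ofReal (heatKer n 1 (‖y‖ ^ 2)))) :=
    isFiniteMeasure_withDensity_ofReal hint2.2
  apply Measure.ext_of_charFun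
  ext t
  rw [charFun_stdGaussian, charFun_apply, integral_withDensity_eq_integral_toReal_smul₀
    hint2.1.aemeasurable.ennreal_ofReal (by simp)]
  have h1 : ∀ y : E, (ENNReal.ofReal (heatKer n 1 (‖y‖ ^ 2))).toReal •
      Complex.exp (inner ℝ y t * Complex.I) = ((2 * Real.pi : ℝ) ^ (-(n / 2 : ℝ)) : ℝ) *
        Complex.exp (-(1 / 2 : ℂ) * ‖y‖ ^ 2 + Complex.I * inner ℝ t y) := by
    intro y
    rw [ENNReal.toReal_ofReal (heatKer_pos one_pos _).le, hexp, Complex.real_smul, Complex.exp_add,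
      real_inner_comm]
    push_cast
    ring_nf
  simp_rw [h1]
  rw [integral_const_mul, GaussianFourier.integral_cexp_neg_mul_sq_norm_add (by norm_num)]
  rw [← mul_assoc]
  have h2 : (((2 * Real.pi : ℝ) ^ (-(n / 2 : ℝ)) : ℝ) : ℂ) *
      ((Real.pi : ℂ) / (1 / 2)) ^ ((n : ℂ) / 2) = 1 := by
    have : ((Real.pi : ℂ) / (1 / 2)) = ((2 * Real.pi : ℝ) : ℂ) := by push_cast; ring
    rw [this]
    have h3 : ((n : ℂ) / 2) = ((n / 2 : ℝ) : ℂ) := by push_cast; ring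
    rw [h3, ← Complex.ofReal_cpow (by positivity), ← Complex.ofReal_mul, ← Real.rpow_add (by positivity)]
    simp
  rw [h2, one_mul]
  congr 1
  simp; ring

theorem integral_stdGaussian_eq_integral_heatKer (F : E → ℝ) :
    ∫ y, F y ∂(stdGaussian E) = ∫ y, heatKer (Module.finrank ℝ E) 1 (‖y‖ ^ 2) * F y := by
  rw [stdGaussian_eq_withDensity, integral_withDensity_eq_integral_toReal_smul₀ _ (by simp)]
  · refine integral_congr_ae (Eventually.of_forall fun y => ?_)
    simp only [smul_eq_mul]
    rw [ENNReal.toReal_ofReal (heatKer_pos one_pos _).le]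
  · unfold heatKer; fun_prop

theorem volume_absolutelyContinuous_stdGaussian :
    (volume : Measure E) ≪ stdGaussian E := by
  rw [stdGaussian_eq_withDensity]
  refine withDensity_absolutelyContinuous' (by unfold heatKer; fun_prop) ?_
  exact Eventually.of_forall fun y => by simp [heatKer_pos]

theorem stdGaussian_absolutelyContinuous_volume :
    stdGaussian E ≪ (volume : Measure E) := by
  rw [stdGaussian_eq_withDensity]
  exact withDensity_absolutelyContinuous _ _

theorem heatKer_scale {n : ℕ} {ρ : ℝ} (hρ : 0 < ρ) (v : ℝ) :
    heatKer n ρ (ρ * v) = (Real.sqrt ρ ^ n)⁻¹ * heatKer n 1 v := by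
  unfold heatKer
  rw [Real.mul_rpow (by positivity) hρ.le]
  have : ρ ^ (-(n / 2 : ℝ)) = (Real.sqrt ρ ^ n)⁻¹ := by
    rw [Real.rpow_neg hρ.le, Real.sqrt_eq_rpow, ← Real.rpow_natCast, ← Real.rpow_mul hρ.le]
    congr 2; ring
  rw [this]
  have h2 : -(ρ * v) / (2 * ρ) = -v / (2 * 1) := by field_simp
  rw [h2]; simp; ring

/-- Gaussian averages at scale `√ρ` are integrals against the heat kernel. -/
theorem integral_stdGaussian_sqrt_smul {ρ : ℝ} (hρ : 0 < ρ) (F : E → ℝ) :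
    ∫ y, F (Real.sqrt ρ • y) ∂(stdGaussian E)
      = ∫ y, heatKer (Module.finrank ℝ E) ρ (‖y‖ ^ 2) * F y := by
  rw [integral_stdGaussian_eq_integral_heatKer]
  have hs : 0 < Real.sqrt ρ := Real.sqrt_pos.2 hρ
  have := Measure.integral_comp_smul (volume : Measure E)
    (fun y => heatKer (Module.finrank ℝ E) ρ (‖y‖ ^ 2) * F y) (Real.sqrt ρ)
  have h2 : ∀ y : E, heatKer (Module.finrank ℝ E) 1 (‖y‖ ^ 2) * F (Real.sqrt ρ • y)
      = Real.sqrt ρ ^ (Module.finrank ℝ E) *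
        (heatKer (Module.finrank ℝ E) ρ (‖Real.sqrt ρ • y‖ ^ 2) * F (Real.sqrt ρ • y)) := by
    intro y
    rw [norm_smul, mul_pow, Real.norm_eq_abs, sq_abs, Real.sq_sqrt hρ.le, heatKer_scale hρ]
    field_simp
  simp_rw [h2]
  rw [integral_const_mul, this, abs_of_pos (by positivity), smul_eq_mul, ← mul_assoc,
    mul_inv_cancel₀ (by positivity), one_mul]

end GaussianBasics

/-! ### Third-order Taylor bounds for concave powers -/

section PowerExpansion

theorem one_sub_mul_le_one_add_rpow_neg {κ x : ℝ} (hκ : 0 ≤ κ) (hx : -1 < x) :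
    1 - κ * x ≤ (1 + x) ^ (-κ) := by
  have h1 : 0 < 1 + x := by linarith
  rw [Real.rpow_def_of_pos h1]
  have h2 := Real.log_le_sub_one_of_pos h1
  have h3 := Real.add_one_le_exp (Real.log (1 + x) * -κ)
  nlinarith

theorem hasDerivAt_one_add_rpow {κ x : ℝ} (hx : -1 < x) :
    HasDerivAt (fun x : ℝ => (1 + x) ^ κ) (κ * (1 + x) ^ (κ - 1)) x := by
  have h := ((hasDerivAt_id x).const_add 1).rpow_const (p := κ) (Or.inl (by simp; linarith))
  simpa using h

theorem one_add_rpow_neg_le {κ x : ℝ} (hκ : 0 ≤ κ) (hx : 0 ≤ x) :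
    (1 + x) ^ (-κ) ≤ 1 - κ * x + κ * (κ + 1) / 2 * x ^ 2 := by
  have hd : ∀ y ∈ Ici (0 : ℝ), HasDerivAt
      (fun y : ℝ => 1 - κ * y + κ * (κ + 1) / 2 * y ^ 2 - (1 + y) ^ (-κ))
      (-κ + κ * (κ + 1) * y - -κ * (1 + y) ^ (-κ - 1)) y := by
    intro y hy
    have h1 := hasDerivAt_one_add_rpow (κ := -κ) (x := y) (by linarith [mem_Ici.1 hy])
    have h2 := (((hasDerivAt_id y).const_mul κ).const_sub 1).add
      ((hasDerivAt_pow 2 y).const_mul (κ * (κ + 1) / 2))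
    convert! h2.sub h1 using 1
    simp; ring
  have hmono : MonotoneOn (fun y : ℝ => 1 - κ * y + κ * (κ + 1) / 2 * y ^ 2 - (1 + y) ^ (-κ))
      (Ici 0) := by
    refine monotoneOn_of_deriv_nonneg (convex_Ici 0)
      (fun y hy => (hd y hy).continuousAt.continuousWithinAt)
      (fun y hy => (hd y (interior_subset hy)).differentiableAt.differentiableWithinAt) ?_
    intro y hy
    have hy0 := mem_Ici.1 (interior_subset hy)
    rw [(hd y (interior_subset hy)).deriv]
    have := one_sub_mul_le_one_add_rpow_neg (κ := κ + 1) (x := y) (by linarith) (by linarith)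
    rw [show -(κ + 1) = -κ - 1 by ring] at this
    nlinarith
  have := hmono (mem_Ici.2 le_rfl) (mem_Ici.2 hx) hx
  simp at this
  linarith

/-- Third-order upper Taylor bound for a concave power. -/
theorem one_add_rpow_le {α x : ℝ} (h0 : 0 < α) (h1 : α < 1) (hx : -1 < x) :
    (1 + x) ^ α ≤ 1 + α * x - α * (1 - α) / 2 * x ^ 2 + |x| ^ 3 := by
  rcases le_total 0 x with h | h
  · have hd : ∀ y ∈ Ici (0 : ℝ), HasDerivAt
        (fun y : ℝ => 1 + α * y - α * (1 - α) / 2 * y ^ 2 + y ^ 3 - (1 + y) ^ α)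
        (α - α * (1 - α) * y + 3 * y ^ 2 - α * (1 + y) ^ (α - 1)) y := by
      intro y hy
      have h1 := hasDerivAt_one_add_rpow (κ := α) (x := y) (by linarith [mem_Ici.1 hy])
      have h2 := ((((hasDerivAt_id y).const_mul α).const_add 1).sub
        ((hasDerivAt_pow 2 y).const_mul (α * (1 - α) / 2))).add (hasDerivAt_pow 3 y)
      convert! h2.sub h1 using 1
      simp; ring
    have hmono : MonotoneOn
        (fun y : ℝ => 1 + α * y - α * (1 - α) / 2 * y ^ 2 + y ^ 3 - (1 + y) ^ α) (Ici 0) := by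
      refine monotoneOn_of_deriv_nonneg (convex_Ici 0)
        (fun y hy => (hd y hy).continuousAt.continuousWithinAt)
        (fun y hy => (hd y (interior_subset hy)).differentiableAt.differentiableWithinAt) ?_
      intro y hy
      have hy0 := mem_Ici.1 (interior_subset hy)
      rw [(hd y (interior_subset hy)).deriv]
      have := one_add_rpow_neg_le (κ := 1 - α) (x := y) (by linarith) hy0
      rw [show -(1 - α) = α - 1 by ring] at this
      have h3 := mul_le_mul_of_nonneg_left this h0.le
      have h5 : (1 - α) * (1 - α + 1) / 2 ≤ 1 := by nlinarith
      have h4 : α * ((1 - α) * (1 - α + 1) / 2) ≤ 3 := by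
        have := mul_le_mul_of_nonneg_left h5 h0.le
        linarith
      nlinarith [mul_le_mul_of_nonneg_right h4 (sq_nonneg y)]
    have := hmono (mem_Ici.2 le_rfl) (mem_Ici.2 h) h
    simp at this
    rw [abs_of_nonneg h]
    linarith
  -- The third derivative of `(1 + x)^α` is positive, so for `x ≤ 0` the quadratic Taylor polynomial
  -- is already an upper bound; the cube is needed only for `x ≥ 0`.
  · have hd : ∀ y ∈ Ioc (-1 : ℝ) 0, HasDerivAt
        (fun y : ℝ => 1 + α * y - α * (1 - α) / 2 * y ^ 2 - (1 + y) ^ α)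
        (α - α * (1 - α) * y - α * (1 + y) ^ (α - 1)) y := by
      intro y hy
      have h1 := hasDerivAt_one_add_rpow (κ := α) (x := y) hy.1
      have h2 := (((hasDerivAt_id y).const_mul α).const_add 1).sub
        ((hasDerivAt_pow 2 y).const_mul (α * (1 - α) / 2))
      convert! h2.sub h1 using 1
      simp; ring
    have hanti : AntitoneOn
        (fun y : ℝ => 1 + α * y - α * (1 - α) / 2 * y ^ 2 - (1 + y) ^ α) (Ioc (-1) 0) := by
      refine antitoneOn_of_deriv_nonpos (convex_Ioc _ _)
        (fun y hy => (hd y hy).continuousAt.continuousWithinAt)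
        (fun y hy => (hd y (interior_subset hy)).differentiableAt.differentiableWithinAt) ?_
      intro y hy
      have hy0 := interior_subset hy
      rw [(hd y (interior_subset hy)).deriv]
      have := one_sub_mul_le_one_add_rpow_neg (κ := 1 - α) (x := y) (by linarith) hy0.1
      rw [show -(1 - α) = α - 1 by ring] at this
      nlinarith
    have := hanti ⟨hx, h⟩ ⟨by norm_num, le_rfl⟩ h
    simp at this
    have h3 : 0 ≤ |x| ^ 3 := by positivity
    linarith

theorem mul_sq_le_cube_add_cube {s t : ℝ} (hs0 : 0 ≤ s) (ht0 : 0 ≤ t) :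
    s * t ^ 2 ≤ s ^ 3 + t ^ 3 := by
  rcases le_total s t with h | h
  · have := mul_le_mul_of_nonneg_right h (sq_nonneg t)
    have h3 := pow_nonneg hs0 3
    linarith [show t * t ^ 2 = t ^ 3 by ring]
  · have := mul_le_mul_of_nonneg_left (pow_le_pow_left₀ ht0 h 2) hs0
    have h3 := pow_nonneg ht0 3
    linarith [show s * s ^ 2 = s ^ 3 by ring]

theorem mixed_monomials_le_cubes {s t K : ℝ} (hK : 1 ≤ K) (hs0 : 0 ≤ s) (ht0 : 0 ≤ t)
    (hs : s ≤ K) (ht : t ≤ K) :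
    s * t ^ 2 ≤ s ^ 3 + t ^ 3 ∧ t * s ^ 2 ≤ s ^ 3 + t ^ 3 ∧ s * t ^ 3 ≤ K * (s ^ 3 + t ^ 3) ∧
    t * s ^ 3 ≤ K * (s ^ 3 + t ^ 3) ∧ s ^ 2 * t ^ 2 ≤ K * (s ^ 3 + t ^ 3) ∧
    s ^ 3 * t ^ 3 ≤ K ^ 3 * (s ^ 3 + t ^ 3) ∧ s ^ 3 + t ^ 3 ≤ K ^ 3 * (s ^ 3 + t ^ 3) ∧
    K * (s ^ 3 + t ^ 3) ≤ K ^ 3 * (s ^ 3 + t ^ 3) := by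
  have hK0 : 0 ≤ K := zero_le_one.trans hK
  have S0 : 0 ≤ s ^ 3 + t ^ 3 := by positivity
  have c1 := mul_sq_le_cube_add_cube hs0 ht0
  have p3 : 0 ≤ s ^ 3 := by positivity
  have q3 : 0 ≤ t ^ 3 := by positivity
  refine ⟨c1, by linarith [mul_sq_le_cube_add_cube ht0 hs0], ?_, ?_, ?_, ?_,
    le_mul_of_one_le_left S0 (one_le_pow₀ hK),
    mul_le_mul_of_nonneg_right (le_self_pow₀ hK (by norm_num)) S0⟩
  · calc s * t ^ 3 ≤ K * t ^ 3 := by gcongr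
      _ ≤ _ := by gcongr; linarith
  · calc t * s ^ 3 ≤ K * s ^ 3 := by gcongr
      _ ≤ _ := by gcongr; linarith
  · calc s ^ 2 * t ^ 2 = s * (s * t ^ 2) := by ring
      _ ≤ K * (s ^ 3 + t ^ 3) := by gcongr
  · calc s ^ 3 * t ^ 3 ≤ K ^ 3 * t ^ 3 := by gcongr
      _ ≤ _ := by gcongr; linarith

/-- Multiply the two one-variable bounds. Of the ten terms of degree at least three, two are
nonpositive and the others fit under `K³ (|X|³ + |Y|³)` by `mixed_monomials_le_cubes`, seven times
in all; the factor `12` is slack. -/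
theorem one_add_rpow_mul_one_add_rpow_le {α β X Y K : ℝ} (hα0 : 0 < α) (hα1 : α < 1) (hβ0 : 0 < β)
    (hβ1 : β < 1) (hK : 1 ≤ K) (hX : -1 < X) (hY : -1 < Y) (hXK : |X| ≤ K) (hYK : |Y| ≤ K) :
    (1 + X) ^ α * (1 + Y) ^ β ≤ 1 + α * X + β * Y
      + (α * β * X * Y - α * (1 - α) / 2 * X ^ 2 - β * (1 - β) / 2 * Y ^ 2)
      + 12 * K ^ 3 * (|X| ^ 3 + |Y| ^ 3) := by
  have hU := one_add_rpow_le hα0 hα1 hX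
  have hV := one_add_rpow_le hβ0 hβ1 hY
  have hU0 : 0 ≤ (1 + X) ^ α := Real.rpow_nonneg (by linarith) _
  have hV0 : 0 ≤ (1 + Y) ^ β := Real.rpow_nonneg (by linarith) _
  refine (mul_le_mul hU hV hV0 (hU0.trans hU)).trans ?_
  set a := α * (1 - α) / 2 with ha
  set b := β * (1 - β) / 2 with hb
  have ha0 : 0 ≤ a := by have : 0 < 1 - α := by linarith
                         positivity
  have hb0 : 0 ≤ b := by have : 0 < 1 - β := by linarith
                         positivity
  have ha1 : a ≤ 1 := by nlinarith
  have hb1 : b ≤ 1 := by nlinarith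
  set s := |X| with hs
  set t := |Y| with ht
  have hs0 : 0 ≤ s := abs_nonneg _
  have ht0 : 0 ≤ t := abs_nonneg _
  have hXs : X ≤ s := le_abs_self _
  have hXs' : -X ≤ s := neg_le_abs _
  have hYt : Y ≤ t := le_abs_self _
  have hYt' : -Y ≤ t := neg_le_abs _
  have hX2 : X ^ 2 = s ^ 2 := (sq_abs X).symm
  have hY2 : Y ^ 2 = t ^ 2 := (sq_abs Y).symm
  rw [hX2, hY2]
  have e1 : -(α * b) * X * t ^ 2 ≤ s * t ^ 2 := by
    have h1 : α * b ≤ 1 := by nlinarith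
    have h2 : (α * b) * (-X) ≤ s :=
      (mul_le_mul_of_nonneg_left hXs' (by positivity)).trans (mul_le_of_le_one_left hs0 h1)
    nlinarith [mul_le_mul_of_nonneg_right h2 (sq_nonneg t)]
  have e2 : -(a * β) * Y * s ^ 2 ≤ t * s ^ 2 := by
    have h1 : a * β ≤ 1 := by nlinarith
    have h2 : (a * β) * (-Y) ≤ t :=
      (mul_le_mul_of_nonneg_left hYt' (by positivity)).trans (mul_le_of_le_one_left ht0 h1)
    nlinarith [mul_le_mul_of_nonneg_right h2 (sq_nonneg s)]
  have e3 : α * X * t ^ 3 ≤ s * t ^ 3 := by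
    have h2 : α * X ≤ s :=
      (mul_le_mul_of_nonneg_left hXs (by positivity)).trans (mul_le_of_le_one_left hs0 hα1.le)
    exact mul_le_mul_of_nonneg_right h2 (by positivity)
  have e4 : β * Y * s ^ 3 ≤ t * s ^ 3 := by
    have h2 : β * Y ≤ t :=
      (mul_le_mul_of_nonneg_left hYt (by positivity)).trans (mul_le_of_le_one_left ht0 hβ1.le)
    exact mul_le_mul_of_nonneg_right h2 (by positivity)
  have e5 : a * b * (s ^ 2 * t ^ 2) ≤ s ^ 2 * t ^ 2 :=
    mul_le_of_le_one_left (by positivity) (by nlinarith)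
  have e6 : 0 ≤ a * s ^ 2 * t ^ 3 := by positivity
  have e7 : 0 ≤ b * t ^ 2 * s ^ 3 := by positivity
  obtain ⟨c1, c2, c3, c4, c5, c6, k1, k2⟩ := mixed_monomials_le_cubes hK hs0 ht0 hXK hYK
  have expand : (1 + α * X - a * s ^ 2 + s ^ 3) * (1 + β * Y - b * t ^ 2 + t ^ 3)
      = 1 + α * X + β * Y + (α * β * X * Y - a * s ^ 2 - b * t ^ 2)
        + (-(α * b) * X * t ^ 2 + -(a * β) * Y * s ^ 2 + α * X * t ^ 3 + β * Y * s ^ 3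
          + a * b * (s ^ 2 * t ^ 2) - a * s ^ 2 * t ^ 3 - b * t ^ 2 * s ^ 3 + s ^ 3 * t ^ 3
          + s ^ 3 + t ^ 3) := by ring
  have r : 12 * K ^ 3 * (s ^ 3 + t ^ 3) = 12 * (K ^ 3 * (s ^ 3 + t ^ 3)) := by ring
  have S0 : 0 ≤ s ^ 3 + t ^ 3 := by positivity
  rw [expand, r]
  linarith

end PowerExpansion

/-! ### Gaussian averages, correlated pairs and the class `C^{1,1}` -/

section GaussianAverages

set_option linter.unusedSectionVars false

open ProbabilityTheory

variable {E : Type*} [NormedAddCommGroup E] [InnerProductSpace ℝ E] [FiniteDimensional ℝ E]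
  [MeasurableSpace E] [BorelSpace E]

/-- The Gaussian average `x ↦ E f (x + c Z)`. -/
noncomputable def gaussAvg (c : ℝ) (f : E → ℝ) (x : E) : ℝ :=
  ∫ z, f (x + c • z) ∂(stdGaussian E)

/-- The average `(x, y) ↦ E H (x + c ξ, y + c η)` for a `ρ`-correlated Gaussian pair
`(ξ, η) = (ρ η + σ ζ, η)`. -/
noncomputable def pairAvg (ρ σ c : ℝ) (H : E → E → ℝ) (x y : E) : ℝ :=
  ∫ p, H (x + c • (ρ • p.1 + σ • p.2)) (y + c • p.1) ∂((stdGaussian E).prod (stdGaussian E))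

theorem Continuous.integrable_of_bounded {X : Type*} [TopologicalSpace X] [MeasurableSpace X]
    [OpensMeasurableSpace X] {μ : Measure X} [IsFiniteMeasure μ]
    {f : X → ℝ} {M : ℝ} (hf : Continuous f)
    (hM : ∀ x, |f x| ≤ M) : Integrable f μ :=
  Integrable.of_bound hf.measurable.aestronglyMeasurable M (Eventually.of_forall fun x => by simpa using hM x)

theorem continuous_gaussAvg {c : ℝ} {f : E → ℝ} {M : ℝ} (hf : Continuous f)
    (hM : ∀ x, |f x| ≤ M) : Continuous (gaussAvg c f) := by
  refine continuous_of_dominated (bound := fun _ => M) (fun x => ?_) (fun x => ?_)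
    (integrable_const _) ?_
  · exact (by fun_prop : Continuous fun z => f (x + c • z)).aestronglyMeasurable
  · exact Eventually.of_forall fun z => by simpa using hM _
  · exact Eventually.of_forall fun z => by fun_prop

theorem abs_gaussAvg_le {c : ℝ} {f : E → ℝ} {M : ℝ} (hM : ∀ x, |f x| ≤ M) (x : E) :
    |gaussAvg c f x| ≤ M := by
  have := norm_integral_le_of_norm_le_const (μ := stdGaussian E) (f := fun z => f (x + c • z))
    (C := M) (Eventually.of_forall fun z => by simpa using hM _)
  simpa [gaussAvg] using this

theorem gaussAvg_gaussAvg {a b c : ℝ} (h : a ^ 2 + b ^ 2 = c ^ 2) {f : E → ℝ} {M : ℝ}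
    (hf : Continuous f) (hM : ∀ x, |f x| ≤ M) (x : E) :
    gaussAvg a (gaussAvg b f) x = gaussAvg c f x := by
  unfold gaussAvg
  have := integral_integral_smul_add_smul_stdGaussian (E := E) h (F := fun z => f (x + z)) (by
    have : IsFiniteMeasure ((stdGaussian E).map (fun x => c • x)) := by infer_instance
    exact Continuous.integrable_of_bounded (by fun_prop) (fun z => hM _))
  simpa [add_assoc] using this

theorem gaussAvg_zero (f : E → ℝ) (x : E) : gaussAvg 0 f x = f x := by simp [gaussAvg]

theorem pairAvg_zero (ρ σ : ℝ) (H : E → E → ℝ) (x y : E) : pairAvg ρ σ 0 H x y = H x y := by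
  simp [pairAvg]

/-- Centring is what the stability lemma requires in order to apply on `E × E`; it makes correlated
averages compose in `pairAvg_pairAvg`. -/
theorem integral_strongDual_stdGaussian_prod
    (L : StrongDual ℝ (E × E)) : ((stdGaussian E).prod (stdGaussian E))[L] = 0 := by
  have hL : Integrable (fun p : E × E => L p) ((stdGaussian E).prod (stdGaussian E)) :=
    L.integrable_comp IsGaussian.integrable_id
  rw [integral_prod _ hL]
  have h1 : ∀ x : E, ∫ y, L (x, y) ∂(stdGaussian E) = L.comp (.inl ℝ E E) x := by
    intro x
    have : (fun y : E => L (x, y)) = fun y => L (x, 0) + L.comp (.inr ℝ E E) y := by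
      ext y; simp [← map_add]
    have hR : Integrable (fun y : E => L.comp (.inr ℝ E E) y) (stdGaussian E) :=
      ContinuousLinearMap.integrable_comp _ IsGaussian.integrable_id
    rw [this, integral_add (integrable_const _) hR, integral_strongDual_stdGaussian]
    simp
  simp_rw [h1]
  rw [integral_strongDual_stdGaussian]

theorem pairAvg_pairAvg {ρ σ a b c : ℝ} (h : a ^ 2 + b ^ 2 = c ^ 2) {H : E → E → ℝ} {M : ℝ}
    (hH : Continuous (fun p : E × E => H p.1 p.2)) (hM : ∀ x y, |H x y| ≤ M) (x y : E) :
    pairAvg ρ σ a (pairAvg ρ σ b H) x y = pairAvg ρ σ c H x y := by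
  unfold pairAvg
  have := integral_integral_smul_add_smul_of_isGaussian
    (μ := (stdGaussian E).prod (stdGaussian E)) integral_strongDual_stdGaussian_prod h
    (F := fun p : E × E => H (x + (ρ • p.1 + σ • p.2)) (y + p.1)) (by
    have : IsFiniteMeasure (((stdGaussian E).prod (stdGaussian E)).map (fun x => c • x)) := by
      infer_instance
    refine Continuous.integrable_of_bounded (M := M) ?_ (fun z => hM _ _)
    exact hH.comp (by fun_prop : Continuous fun p : E × E => (x + (ρ • p.1 + σ • p.2), y + p.1)))
  refine Eq.trans ?_ (this.trans ?_)
  · congr 1; ext p; congr 1; ext q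
    simp only [Prod.fst_add, Prod.snd_add, Prod.smul_fst, Prod.smul_snd]
    congr 1
    · module
    · module
  · congr 1; ext p
    simp only [Prod.smul_fst, Prod.smul_snd]
    congr 1
    module

theorem continuous_pairAvg {ρ σ c : ℝ} {H : E → E → ℝ} {M : ℝ}
    (hH : Continuous (fun p : E × E => H p.1 p.2)) (hM : ∀ x y, |H x y| ≤ M) :
    Continuous (fun p : E × E => pairAvg ρ σ c H p.1 p.2) := by
  refine continuous_of_dominated (bound := fun _ => M) (fun x => ?_) (fun x => ?_)
    (integrable_const _) ?_
  · exact (hH.comp (by fun_prop : Continuous fun p : E × E =>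
      (x.1 + c • (ρ • p.1 + σ • p.2), x.2 + c • p.1))).measurable.aestronglyMeasurable
  · exact Eventually.of_forall fun z => by simpa using hM _ _
  · exact Eventually.of_forall fun z => hH.comp (by fun_prop : Continuous fun x : E × E =>
      (x.1 + c • (ρ • z.1 + σ • z.2), x.2 + c • z.1))

theorem pairAvg_mono {ρ σ c : ℝ} {H G : E → E → ℝ} {M : ℝ}
    (hH : Continuous (fun p : E × E => H p.1 p.2)) (hHM : ∀ x y, |H x y| ≤ M)
    (hG : Continuous (fun p : E × E => G p.1 p.2)) (hGM : ∀ x y, |G x y| ≤ M)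
    (hle : ∀ x y, H x y ≤ G x y) (x y : E) : pairAvg ρ σ c H x y ≤ pairAvg ρ σ c G x y := by
  refine integral_mono ?_ ?_ (fun p => hle _ _)
  · exact Continuous.integrable_of_bounded (M := M) (hH.comp (by fun_prop : Continuous fun p : E × E =>
      (x + c • (ρ • p.1 + σ • p.2), y + c • p.1))) (fun p => hHM _ _)
  · exact Continuous.integrable_of_bounded (M := M) (hG.comp (by fun_prop : Continuous fun p : E × E =>
      (x + c • (ρ • p.1 + σ • p.2), y + c • p.1))) (fun p => hGM _ _)

/-- Functions of the first member of the pair: `ρ η + σ ζ` is standard Gaussian. -/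
theorem integral_prod_correlated {ρ σ : ℝ} (h : ρ ^ 2 + σ ^ 2 = 1) {F : E → ℝ}
    (hF : Integrable F (stdGaussian E)) :
    Integrable (fun p : E × E => F (ρ • p.1 + σ • p.2)) ((stdGaussian E).prod (stdGaussian E)) ∧
    ∫ p, F (ρ • p.1 + σ • p.2) ∂((stdGaussian E).prod (stdGaussian E))
      = ∫ z, F z ∂(stdGaussian E) := by
  have hm := map_smul_add_smul_prod_of_isGaussian (μ := stdGaussian E)
    integral_strongDual_stdGaussian (a := ρ) (b := σ) (c := 1) (by simpa using h)
  have hm2 : Measurable (fun p : E × E => ρ • p.1 + σ • p.2) := by fun_prop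
  simp only [one_smul, Measure.map_id'] at hm
  rw [← hm] at hF
  refine ⟨(integrable_map_measure hF.1 hm2.aemeasurable).1 hF, ?_⟩
  rw [← integral_map hm2.aemeasurable hF.1, hm]

theorem integral_prod_fst_eq {F : E → ℝ} (hF : Integrable F (stdGaussian E)) :
    Integrable (fun p : E × E => F p.1) ((stdGaussian E).prod (stdGaussian E)) ∧
    ∫ p, F p.1 ∂((stdGaussian E).prod (stdGaussian E)) = ∫ z, F z ∂(stdGaussian E) :=
  ⟨hF.comp_fst _, by rw [integral_fun_fst]; simp⟩

theorem integral_inner_mul_inner_stdGaussian (x y : E) :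
    Integrable (fun z => inner ℝ x z * inner ℝ y z) (stdGaussian E) ∧
    ∫ z, inner ℝ x z * inner ℝ y z ∂(stdGaussian E) = inner ℝ x y := by
  constructor
  · exact MemLp.integrable_mul (p := 2) (q := 2) (IsGaussian.memLp_two_id.const_inner x)
      (IsGaussian.memLp_two_id.const_inner y)
  · have h := covarianceBilin_apply (μ := stdGaussian E) IsGaussian.memLp_two_id x y
    rw [covarianceBilin_stdGaussian] at h
    simpa [innerSL_apply_apply ℝ] using h.symm

theorem integral_inner_stdGaussian (x : E) :
    Integrable (fun z => inner ℝ x z) (stdGaussian E) ∧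
    ∫ z, inner ℝ x z ∂(stdGaussian E) = 0 :=
  ⟨(innerSL ℝ x).integrable_comp IsGaussian.integrable_id,
    integral_strongDual_stdGaussian (innerSL ℝ x)⟩

theorem integral_inner_correlated {ρ σ : ℝ} (x y : E) :
    Integrable (fun p : E × E => inner ℝ x (ρ • p.1 + σ • p.2) * inner ℝ y p.1)
      ((stdGaussian E).prod (stdGaussian E)) ∧
    ∫ p, inner ℝ x (ρ • p.1 + σ • p.2) * inner ℝ y p.1 ∂((stdGaussian E).prod (stdGaussian E))
      = ρ * inner ℝ x y := by
  have h1 := integral_prod_fst_eq (integral_inner_mul_inner_stdGaussian x y).1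
  have h2 : Integrable (fun p : E × E => inner ℝ y p.1 * inner ℝ x p.2)
      ((stdGaussian E).prod (stdGaussian E)) :=
    (integral_inner_stdGaussian y).1.mul_prod (integral_inner_stdGaussian x).1
  have h3 : ∫ p, inner ℝ y p.1 * inner ℝ x p.2 ∂((stdGaussian E).prod (stdGaussian E)) = 0 := by
    rw [integral_prod_mul (fun p => inner ℝ y p) (fun p => inner ℝ x p),
      (integral_inner_stdGaussian x).2, mul_zero]
  have h4 : (fun p : E × E => inner ℝ x (ρ • p.1 + σ • p.2) * inner ℝ y p.1)
      = fun p => ρ * (inner ℝ x p.1 * inner ℝ y p.1) + σ * (inner ℝ y p.1 * inner ℝ x p.2) := by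
    ext p
    rw [inner_add_right, inner_smul_right, inner_smul_right]; ring
  rw [h4]
  refine ⟨(h1.1.const_mul _).add (h2.const_mul _), ?_⟩
  rw [integral_add (h1.1.const_mul _) (h2.const_mul _), integral_const_mul, integral_const_mul, h1.2,
    h3, (integral_inner_mul_inner_stdGaussian x y).2]
  ring

/-- `f` takes values in `[m, M]` and is `C^{1,1}`, with gradient `D` and constant `L`. -/
structure IsC11Between (m M L : ℝ) (f : E → ℝ) (D : E → E) : Prop where
  lower : ∀ x, m ≤ f x
  upper : ∀ x, f x ≤ M
  cont : Continuous f
  contD : Continuous D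
  normD : ∀ x, ‖D x‖ ≤ L
  quad : ∀ x h, |f (x + h) - f x - inner ℝ (D x) h| ≤ L * ‖h‖ ^ 2

theorem IsC11Between.mono {m M L m' M' L' : ℝ} {f : E → ℝ} {D : E → E}
    (h : IsC11Between m M L f D) (hm : m' ≤ m) (hM : M ≤ M') (hL : L ≤ L') :
    IsC11Between m' M' L' f D where
  lower x := hm.trans (h.lower x)
  upper x := (h.upper x).trans hM
  cont := h.cont
  contD := h.contD
  normD x := (h.normD x).trans hL
  quad x y := (h.quad x y).trans (by gcongr)

theorem IsC11Between.abs_le {m M L : ℝ} {f : E → ℝ} {D : E → E}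
    (h : IsC11Between m M L f D) (hm : 0 ≤ m) (x : E) : |f x| ≤ M := by
  rw [abs_of_nonneg (hm.trans (h.lower x))]; exact h.upper x

/-- Every bound in the class is translation invariant and survives averaging, so `m`, `M`, `L` do
not deteriorate. This lets the small-step estimate be iterated any number of times with one
constant. -/
theorem IsC11Between.gaussAvg {m M L : ℝ} {f : E → ℝ} {D : E → E} (hm : 0 ≤ m)
    (hf : IsC11Between m M L f D) (c : ℝ) :
    IsC11Between m M L (gaussAvg c f) (fun x => ∫ z, D (x + c • z) ∂(stdGaussian E)) := by
  have hfi : ∀ x, Integrable (fun z => f (x + c • z)) (stdGaussian E) := fun x =>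
    Continuous.integrable_of_bounded (hf.cont.comp (by fun_prop)) (fun z => hf.abs_le hm _)
  have hDi : ∀ x, Integrable (fun z => D (x + c • z)) (stdGaussian E) := fun x =>
    Integrable.of_bound (hf.contD.comp (by fun_prop)).aestronglyMeasurable L
      (Eventually.of_forall fun z => hf.normD _)
  refine ⟨fun x => ?_, fun x => ?_, continuous_gaussAvg hf.cont (hf.abs_le hm), ?_, fun x => ?_,
    fun x h => ?_⟩
  · have := integral_mono (integrable_const m) (hfi x) (fun z => hf.lower _)
    simpa [_root_.gaussAvg] using this
  · have := integral_mono (hfi x) (integrable_const M) (fun z => hf.upper _)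
    simpa [_root_.gaussAvg] using this
  · refine continuous_of_dominated (bound := fun _ => L) (fun x => ?_) (fun x => ?_)
      (integrable_const _) ?_
    · exact (hDi x).1
    · exact Eventually.of_forall fun z => hf.normD _
    · exact Eventually.of_forall fun z => hf.contD.comp (by fun_prop)
  · have := norm_integral_le_of_norm_le_const (μ := stdGaussian E) (f := fun z => D (x + c • z))
      (C := L) (Eventually.of_forall fun z => hf.normD _)
    simpa using this
  · have e1 : inner ℝ (∫ z, D (x + c • z) ∂(stdGaussian E)) h
        = ∫ z, inner ℝ (D (x + c • z)) h ∂(stdGaussian E) := by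
      rw [real_inner_comm]
      have := (innerSL ℝ h).integral_comp_comm (hDi x)
      simp only [innerSL_apply_apply] at this
      rw [← this]
      simp_rw [real_inner_comm]
    have hi : Integrable (fun z => inner ℝ (D (x + c • z)) h) (stdGaussian E) := by
      have := (innerSL ℝ h).integrable_comp (hDi x)
      exact this.congr (Eventually.of_forall fun z => real_inner_comm _ _)
    have e2 : _root_.gaussAvg c f (x + h) - _root_.gaussAvg c f x
        - inner ℝ (∫ z, D (x + c • z) ∂(stdGaussian E)) h
        = ∫ z, (f ((x + c • z) + h) - f (x + c • z) - inner ℝ (D (x + c • z)) h)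
          ∂(stdGaussian E) := by
      rw [integral_sub _ hi, integral_sub _ (hfi x), e1]
      · unfold _root_.gaussAvg
        congr 3; ext z; congr 1; abel
      · convert! hfi (x + h) using 3; abel
      · refine Integrable.sub ?_ (hfi x)
        convert! hfi (x + h) using 3; abel
    rw [e2]
    have := norm_integral_le_of_norm_le_const (μ := stdGaussian E)
      (f := fun z => (f ((x + c • z) + h) - f (x + c • z) - inner ℝ (D (x + c • z)) h))
      (C := L * ‖h‖ ^ 2) (Eventually.of_forall fun z => hf.quad _ _)
    simpa using this

theorem integrable_pow_norm_prod (k A : ℝ) :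
    Integrable (fun p : E × E => (k + A * ‖p‖ ^ 2) ^ 3) ((stdGaussian E).prod (stdGaussian E)) := by
  have h : ∀ n : ℕ, Integrable (fun p : E × E => ‖p‖ ^ n)
      ((stdGaussian E).prod (stdGaussian E)) := fun n => by
    have := (IsGaussian.memLp_id ((stdGaussian E).prod (stdGaussian E)) n
      (by simp)).integrable_norm_pow' 
    simpa using this
  have e : (fun p : E × E => (k + A * ‖p‖ ^ 2) ^ 3) = fun p =>
      k ^ 3 + 3 * k ^ 2 * A * ‖p‖ ^ 2 + 3 * k * A ^ 2 * ‖p‖ ^ 4 + A ^ 3 * ‖p‖ ^ 6 := by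
    ext p; ring
  rw [e]
  exact (((integrable_const _).add ((h 2).const_mul _)).add ((h 4).const_mul _)).add
    ((h 6).const_mul _)

end GaussianAverages

/-! ### Expansion of `u^α v^β` over one small step -/

section OneStep

open ProbabilityTheory

set_option linter.unusedSectionVars false

variable {E : Type*} [NormedAddCommGroup E] [InnerProductSpace ℝ E] [FiniteDimensional ℝ E]
  [MeasurableSpace E] [BorelSpace E]

/-- Second-order term of `(1 + X)^α (1 + Y)^β`. -/
noncomputable def rpowQuad (α β X Y : ℝ) : ℝ :=
  α * β * X * Y - α * (1 - α) / 2 * X ^ 2 - β * (1 - β) / 2 * Y ^ 2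

theorem rpowQuad_le {α β X Y X₀ Y₀ e : ℝ} (hα0 : 0 < α) (hα1 : α < 1) (hβ0 : 0 < β)
    (hβ1 : β < 1) (h1 : |X * Y - X₀ * Y₀| ≤ e) (h2 : |X ^ 2 - X₀ ^ 2| ≤ e)
    (h3 : |Y ^ 2 - Y₀ ^ 2| ≤ e) : rpowQuad α β X Y ≤ rpowQuad α β X₀ Y₀ + 2 * e := by
  have he : 0 ≤ e := (abs_nonneg _).trans h1
  have k1 : α * β * (X * Y - X₀ * Y₀) ≤ 1 * e :=
    (mul_le_mul_of_nonneg_left ((le_abs_self _).trans h1) (by positivity)).trans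
      (mul_le_mul_of_nonneg_right (by nlinarith) he)
  have k2 : α * (1 - α) / 2 * (-(X ^ 2 - X₀ ^ 2)) ≤ 1 / 2 * e :=
    (mul_le_mul_of_nonneg_left ((neg_le_abs _).trans h2)
      (by have : 0 < 1 - α := by linarith
          positivity)).trans
      (mul_le_mul_of_nonneg_right (by nlinarith) he)
  have k3 : β * (1 - β) / 2 * (-(Y ^ 2 - Y₀ ^ 2)) ≤ 1 / 2 * e :=
    (mul_le_mul_of_nonneg_left ((neg_le_abs _).trans h3)
      (by have : 0 < 1 - β := by linarith
          positivity)).trans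
      (mul_le_mul_of_nonneg_right (by nlinarith) he)
  unfold rpowQuad
  linarith

/-- The reference values `a`, `b` will be averages, and `X₀`, `Y₀` the Gaussian linear parts of the
relative displacements. The linear terms keep the full displacements, which average to zero; in the
quadratic term they are replaced by `X₀`, `Y₀`, at a cost of order `c · c²`. In the constant, `192 =
12 · 2 · 2³` comes from the cubes, `6` from this replacement, and `1 + M / m` bounds the
displacements. -/
theorem rpow_mul_rpow_le_expansion {α β m M B : ℝ} (hα0 : 0 < α) (hα1 : α < 1) (hβ0 : 0 < β)
    (hβ1 : β < 1) (hm : 0 < m) (hB : 0 ≤ B) {a b u v X₀ Y₀ W c : ℝ}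
    (ha : a ∈ Icc m M) (hb : b ∈ Icc m M) (hu : u ∈ Icc m M) (hv : v ∈ Icc m M)
    (hW : 1 ≤ W) (hc0 : 0 ≤ c) (hc1 : c ≤ 1)
    (hX : |u / a - 1 - X₀| ≤ B * c ^ 2 * W) (hX₀ : |X₀| ≤ B * c * W)
    (hY : |v / b - 1 - Y₀| ≤ B * c ^ 2 * W) (hY₀ : |Y₀| ≤ B * c * W) :
    u ^ α * v ^ β ≤ a ^ α * b ^ β *
        (1 + α * (u / a - 1) + β * (v / b - 1) + rpowQuad α β X₀ Y₀)
      + (1 + M) ^ 2 * (192 * (1 + M / m) ^ 3 * B ^ 3 + 6 * B ^ 2) * c ^ 3 * W ^ 3 := by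
  have ha0 : 0 < a := hm.trans_le ha.1
  have hb0 : 0 < b := hm.trans_le hb.1
  have hu0 : 0 < u := hm.trans_le hu.1
  have hv0 : 0 < v := hm.trans_le hv.1
  have hM0 : 0 < M := ha0.trans_le ha.2
  have hW0 : 0 ≤ W := zero_le_one.trans hW
  set X := u / a - 1 with hXdef
  set Y := v / b - 1 with hYdef
  have hK : ∀ {w t : ℝ}, w ∈ Icc m M → t ∈ Icc m M → |w / t - 1| ≤ 1 + M / m := by
    intro w t hw ht
    have ht0 : 0 < t := hm.trans_le ht.1
    have hw0 : 0 < w := hm.trans_le hw.1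
    have h1 : w / t ≤ M / m := div_le_div₀ hM0.le hw.2 hm ht.1
    have h2 : 0 < w / t := by positivity
    rw [abs_le]; constructor <;> linarith
  have hexp := one_add_rpow_mul_one_add_rpow_le (α := α) (β := β) (X := X) (Y := Y)
    (K := 1 + M / m) hα0 hα1 hβ0 hβ1 (by have : 0 < M / m := by positivity
                                         linarith)
    (by have : 0 < u / a := by positivity
        rw [hXdef]; linarith) (by have : 0 < v / b := by positivity
                                  rw [hYdef]; linarith) (hK hu ha) (hK hv hb)
  have hX2 : |X| ≤ 2 * (B * c * W) := by
    have : B * c ^ 2 * W ≤ B * c * W := by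
      have : c ^ 2 ≤ c := by nlinarith
      gcongr
    calc |X| = |(X - X₀) + X₀| := by ring_nf
      _ ≤ |X - X₀| + |X₀| := abs_add_le _ _
      _ ≤ _ := by linarith
  have hY2 : |Y| ≤ 2 * (B * c * W) := by
    have : B * c ^ 2 * W ≤ B * c * W := by
      have : c ^ 2 ≤ c := by nlinarith
      gcongr
    calc |Y| = |(Y - Y₀) + Y₀| := by ring_nf
      _ ≤ |Y - Y₀| + |Y₀| := abs_add_le _ _
      _ ≤ _ := by linarith
  have hT0 : 0 ≤ B * c * W := by positivity
  have hS0 : 0 ≤ B * c ^ 2 * W := by positivity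
  have hquad : rpowQuad α β X Y ≤ rpowQuad α β X₀ Y₀ + 2 * (3 * (B * c * W) * (B * c ^ 2 * W)) := by
    refine rpowQuad_le hα0 hα1 hβ0 hβ1 ?_ ?_ ?_
    · calc |X * Y - X₀ * Y₀| = |X * (Y - Y₀) + (X - X₀) * Y₀| := by ring_nf
        _ ≤ |X| * |Y - Y₀| + |X - X₀| * |Y₀| := by
            refine (abs_add_le _ _).trans ?_
            rw [abs_mul, abs_mul]
        _ ≤ 2 * (B * c * W) * (B * c ^ 2 * W) + (B * c ^ 2 * W) * (B * c * W) := by gcongr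
        _ = _ := by ring
    · calc |X ^ 2 - X₀ ^ 2| = |(X + X₀) * (X - X₀)| := by ring_nf
        _ ≤ (|X| + |X₀|) * |X - X₀| := by
            rw [abs_mul]; gcongr; exact abs_add_le _ _
        _ ≤ (2 * (B * c * W) + B * c * W) * (B * c ^ 2 * W) := by gcongr
        _ = _ := by ring
    · calc |Y ^ 2 - Y₀ ^ 2| = |(Y + Y₀) * (Y - Y₀)| := by ring_nf
        _ ≤ (|Y| + |Y₀|) * |Y - Y₀| := by
            rw [abs_mul]; gcongr; exact abs_add_le _ _
        _ ≤ (2 * (B * c * W) + B * c * W) * (B * c ^ 2 * W) := by gcongr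
        _ = _ := by ring
  have hcub : |X| ^ 3 + |Y| ^ 3 ≤ 16 * (B ^ 3 * c ^ 3 * W ^ 3) := by
    have h1 := pow_le_pow_left₀ (abs_nonneg X) hX2 3
    have h2 := pow_le_pow_left₀ (abs_nonneg Y) hY2 3
    have : (2 * (B * c * W)) ^ 3 = 8 * (B ^ 3 * c ^ 3 * W ^ 3) := by ring
    linarith
  have hK3 : 0 ≤ 12 * (1 + M / m) ^ 3 := by positivity
  have hW23 : 2 * (3 * (B * c * W) * (B * c ^ 2 * W)) ≤ 6 * B ^ 2 * c ^ 3 * W ^ 3 := by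
    have h1 : W ^ 2 ≤ W ^ 3 := pow_le_pow_right₀ hW (by norm_num)
    have h2 : 0 ≤ 6 * B ^ 2 * c ^ 3 := by positivity
    calc 2 * (3 * (B * c * W) * (B * c ^ 2 * W)) = 6 * B ^ 2 * c ^ 3 * W ^ 2 := by ring
      _ ≤ _ := by gcongr
  have hmain : (1 + X) ^ α * (1 + Y) ^ β ≤ 1 + α * X + β * Y + rpowQuad α β X₀ Y₀
      + (192 * (1 + M / m) ^ 3 * B ^ 3 + 6 * B ^ 2) * c ^ 3 * W ^ 3 := by
    have h1 := mul_le_mul_of_nonneg_left hcub hK3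
    have h2 : (192 * (1 + M / m) ^ 3 * B ^ 3 + 6 * B ^ 2) * c ^ 3 * W ^ 3
      = 12 * (1 + M / m) ^ 3 * (16 * (B ^ 3 * c ^ 3 * W ^ 3)) + 6 * B ^ 2 * c ^ 3 * W ^ 3 := by ring
    rw [h2]
    unfold rpowQuad at hquad ⊢
    linarith
  have huX : u = a * (1 + X) := by rw [hXdef]; field_simp; ring
  have hvY : v = b * (1 + Y) := by rw [hYdef]; field_simp; ring
  have h1X : 0 ≤ 1 + X := by rw [hXdef]; have : 0 < u / a := by positivity
                             linarith
  have h1Y : 0 ≤ 1 + Y := by rw [hYdef]; have : 0 < v / b := by positivity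
                             linarith
  have hab : a ^ α * b ^ β ≤ (1 + M) ^ 2 := by
    have : ∀ {t κ : ℝ}, t ∈ Icc m M → 0 < κ → κ < 1 → t ^ κ ≤ 1 + M := by
      intro t κ ht hκ0 hκ1
      calc t ^ κ ≤ (1 + M) ^ κ :=
            Real.rpow_le_rpow (hm.le.trans ht.1) (by linarith [ht.2]) hκ0.le
        _ ≤ (1 + M) ^ (1 : ℝ) := Real.rpow_le_rpow_of_exponent_le (by linarith) hκ1.le
        _ = 1 + M := Real.rpow_one _
    calc a ^ α * b ^ β ≤ (1 + M) * (1 + M) := by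
          gcongr
          · exact this ha hα0 hα1
          · exact this hb hβ0 hβ1
      _ = _ := by ring
  have hab0 : 0 ≤ a ^ α * b ^ β := by positivity
  calc u ^ α * v ^ β = a ^ α * b ^ β * ((1 + X) ^ α * (1 + Y) ^ β) := by
        conv_lhs => rw [huX, hvY]
        rw [Real.mul_rpow ha0.le h1X, Real.mul_rpow hb0.le h1Y]; ring
    _ ≤ a ^ α * b ^ β * (1 + α * X + β * Y + rpowQuad α β X₀ Y₀
      + (192 * (1 + M / m) ^ 3 * B ^ 3 + 6 * B ^ 2) * c ^ 3 * W ^ 3) := by gcongr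
    _ = a ^ α * b ^ β * (1 + α * X + β * Y + rpowQuad α β X₀ Y₀)
      + a ^ α * b ^ β * ((192 * (1 + M / m) ^ 3 * B ^ 3 + 6 * B ^ 2) * c ^ 3 * W ^ 3) := by ring
    _ ≤ a ^ α * b ^ β * (1 + α * X + β * Y + rpowQuad α β X₀ Y₀)
      + (1 + M) ^ 2 * ((192 * (1 + M / m) ^ 3 * B ^ 3 + 6 * B ^ 2) * c ^ 3 * W ^ 3) := by
        gcongr
    _ = _ := by ring

theorem integrable_sq_norm_stdGaussian : Integrable (fun z : E => ‖z‖ ^ 2) (stdGaussian E) := by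
  have := (IsGaussian.memLp_id (stdGaussian E) 2 (by simp)).integrable_norm_pow (by norm_num)
  simpa using this

/-- The first-order term is odd in the Gaussian variable, so only the quadratic remainder
contributes. -/
theorem IsC11Between.abs_gaussAvg_sub_le {m M L : ℝ} {f : E → ℝ} {D : E → E} (hm : 0 ≤ m)
    (hf : IsC11Between m M L f D) (c : ℝ) (x : E) :
    |_root_.gaussAvg c f x - f x| ≤ L * c ^ 2 * ∫ z : E, ‖z‖ ^ 2 ∂(stdGaussian E) := by
  have hfi : Integrable (fun z => f (x + c • z)) (stdGaussian E) :=
    Continuous.integrable_of_bounded (hf.cont.comp (by fun_prop)) (fun z => hf.abs_le hm _)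
  have hD := integral_inner_stdGaussian (D x)
  have e : _root_.gaussAvg c f x - f x
      = ∫ z, (f (x + c • z) - f x - inner ℝ (D x) (c • z)) ∂(stdGaussian E) := by
    simp_rw [inner_smul_right]
    have h1 : Integrable (fun z => f (x + c • z) - f x) (stdGaussian E) :=
      hfi.sub (integrable_const _)
    rw [integral_sub h1 (hD.1.const_mul c), integral_sub hfi (integrable_const _), integral_const_mul, hD.2]
    simp [_root_.gaussAvg]
  rw [e, ← integral_const_mul, ← Real.norm_eq_abs]
  refine norm_integral_le_of_norm_le (integrable_sq_norm_stdGaussian.const_mul _)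
    (Eventually.of_forall fun z => ?_)
  refine (hf.quad x (c • z)).trans (le_of_eq ?_)
  rw [norm_smul, mul_pow, Real.norm_eq_abs, sq_abs]; ring

/-- The hypothesis `h` says exactly that the form has zero discriminant in `(P, R)` when `|T| = P
R`; nonpositivity is then the inequality of arithmetic and geometric means. This is where the
relation between exponents and correlation is used. -/
theorem quadratic_form_nonpos {α β ρ P R T : ℝ} (hα0 : 0 < α) (hα1 : α < 1) (hβ0 : 0 < β)
    (hβ1 : β < 1) (h : (1 - α) * (1 - β) = ρ ^ 2 * (α * β))
    (hT : |T| ≤ P * R) :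
    α * β * (ρ * T) - α * (1 - α) / 2 * P ^ 2 - β * (1 - β) / 2 * R ^ 2 ≤ 0 := by
  have h1 : 0 < 1 - α := by linarith
  have h2 : 0 < 1 - β := by linarith
  have hsum : 0 ≤ α * (1 - α) / 2 * P ^ 2 + β * (1 - β) / 2 * R ^ 2 := by positivity
  have hsq : (α * β * (ρ * T)) ^ 2 ≤ (α * (1 - α) / 2 * P ^ 2 + β * (1 - β) / 2 * R ^ 2) ^ 2 := by
    have hT2 : T ^ 2 ≤ (P * R) ^ 2 := by
      rw [← sq_abs]; exact pow_le_pow_left₀ (abs_nonneg _) hT 2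
    have e1 : (α * β * (ρ * T)) ^ 2 = α * β * ((1 - α) * (1 - β)) * T ^ 2 := by rw [h]; ring
    rw [e1]
    have e2 : α * β * ((1 - α) * (1 - β)) * T ^ 2 ≤ α * β * ((1 - α) * (1 - β)) * (P * R) ^ 2 := by
      gcongr
    nlinarith [sq_nonneg (α * (1 - α) / 2 * P ^ 2 - β * (1 - β) / 2 * R ^ 2)]
  have := abs_le_of_sq_le_sq hsq hsum
  have h3 := (le_abs_self _).trans this
  linarith

end OneStep

/-! ### From one small step to unit variance -/

section Telescoping

open ProbabilityTheory

set_option linter.unusedSectionVars false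

variable {E : Type*} [NormedAddCommGroup E] [InnerProductSpace ℝ E] [FiniteDimensional ℝ E]
  [MeasurableSpace E] [BorelSpace E]

theorem continuous_rpow_mul_rpow {α β : ℝ} {f g : E → ℝ} (hα0 : 0 ≤ α) (hβ0 : 0 ≤ β)
    (hf : Continuous f) (hg : Continuous g) :
    Continuous (fun p : E × E => f p.1 ^ α * g p.2 ^ β) :=
  ((hf.comp continuous_fst).rpow_const fun _ => Or.inr hα0).mul
    ((hg.comp continuous_snd).rpow_const fun _ => Or.inr hβ0)

theorem abs_rpow_mul_rpow_le {α β M u v : ℝ} (hα0 : 0 ≤ α) (hβ0 : 0 ≤ β)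
    (hu : 0 ≤ u) (huM : u ≤ M) (hv : 0 ≤ v) (hvM : v ≤ M) :
    |u ^ α * v ^ β| ≤ M ^ α * M ^ β := by
  have hM : 0 ≤ M := hu.trans huM
  rw [abs_of_nonneg (by positivity)]
  gcongr

/-- Beyond its linear part, the displacement from the average is the Taylor remainder at `x` minus
the drift of the average, both `O(c²)`. The weight `W` absorbs `‖z‖²`, the second moment, and `‖z‖`
itself. -/
theorem IsC11Between.displacement_le {m M L : ℝ} {f : E → ℝ} {D : E → E} (hm : 0 < m)
    (hf : IsC11Between m M L f D) {c : ℝ} (hc0 : 0 ≤ c) (x z : E) {W : ℝ}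
    (hW : 1 + ‖z‖ ^ 2 + ∫ z : E, ‖z‖ ^ 2 ∂(stdGaussian E) ≤ W) :
    |f (x + c • z) / _root_.gaussAvg c f x - 1 - c / _root_.gaussAvg c f x * inner ℝ (D x) z|
      ≤ L / m * c ^ 2 * W ∧
    |c / _root_.gaussAvg c f x * inner ℝ (D x) z| ≤ L / m * c * W := by
  have ha := (hf.gaussAvg hm.le c).lower x
  have h1 := hf.abs_gaussAvg_sub_le hm.le c x
  have h2 := hf.quad x (c • z)
  set m2 := ∫ z : E, ‖z‖ ^ 2 ∂(stdGaussian E)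
  have hm2 : 0 ≤ m2 := integral_nonneg fun z => by positivity
  set a := _root_.gaussAvg c f x
  have ha0 : 0 < a := hm.trans_le ha
  have hL : 0 ≤ L := (norm_nonneg _).trans (hf.normD x)
  constructor
  · have e : f (x + c • z) / a - 1 - c / a * inner ℝ (D x) z
        = ((f (x + c • z) - f x - inner ℝ (D x) (c • z)) - (a - f x)) / a := by
      rw [inner_smul_right]; field_simp; ring
    rw [e, abs_div, abs_of_pos ha0]
    have h3 : |(f (x + c • z) - f x - inner ℝ (D x) (c • z)) - (a - f x)| ≤ L * c ^ 2 * W := by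
      refine (abs_sub _ _).trans ((add_le_add h2 h1).trans ?_)
      rw [norm_smul, mul_pow, Real.norm_eq_abs, sq_abs]
      calc L * (c ^ 2 * ‖z‖ ^ 2) + L * c ^ 2 * m2 = L * c ^ 2 * (‖z‖ ^ 2 + m2) := by ring
        _ ≤ L * c ^ 2 * W := by gcongr; linarith
    calc _ ≤ L * c ^ 2 * W / m := div_le_div₀ ((abs_nonneg _).trans h3) h3 hm ha
      _ = _ := by ring
  · have h3 : |inner ℝ (D x) z| ≤ L * W := by
      refine (abs_real_inner_le_norm _ _).trans ?_
      have : ‖z‖ ≤ W := by nlinarith [sq_nonneg (‖z‖ - 1), norm_nonneg z]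
      exact mul_le_mul (hf.normD x) this (norm_nonneg _) hL
    rw [abs_mul, abs_div, abs_of_nonneg hc0, abs_of_pos ha0]
    calc c / a * |inner ℝ (D x) z| ≤ c / m * (L * W) := by gcongr
      _ = _ := by ring

/-- The covariances `E⟪x, ξ⟫⟪y, η⟫ = ρ⟪x, y⟫`, `E⟪x, ξ⟫² = ‖x‖²` and `E⟪y, η⟫² = ‖y‖²` reduce the
average to `quadratic_form_nonpos`, with Cauchy–Schwarz for the mixed term. -/
theorem integral_rpowQuad_nonpos {α β ρ σ : ℝ} (hα0 : 0 < α) (hα1 : α < 1) (hβ0 : 0 < β)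
    (hβ1 : β < 1) (hρσ : ρ ^ 2 + σ ^ 2 = 1) (hαβ : (1 - α) * (1 - β) = ρ ^ 2 * (α * β))
    (s t : ℝ) (x y : E) :
    Integrable (fun p : E × E => rpowQuad α β (s * inner ℝ x (ρ • p.1 + σ • p.2))
      (t * inner ℝ y p.1)) ((stdGaussian E).prod (stdGaussian E)) ∧
    ∫ p : E × E, rpowQuad α β (s * inner ℝ x (ρ • p.1 + σ • p.2)) (t * inner ℝ y p.1)
      ∂((stdGaussian E).prod (stdGaussian E)) ≤ 0 := by
  have i1 := integral_inner_correlated (ρ := ρ) (σ := σ) x y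
  have i2 := integral_prod_correlated hρσ (integral_inner_mul_inner_stdGaussian x x).1
  have i3 := integral_prod_fst_eq (integral_inner_mul_inner_stdGaussian y y).1
  rw [(integral_inner_mul_inner_stdGaussian x x).2] at i2
  rw [(integral_inner_mul_inner_stdGaussian y y).2] at i3
  have e : (fun p : E × E => rpowQuad α β (s * inner ℝ x (ρ • p.1 + σ • p.2))
      (t * inner ℝ y p.1)) = fun p : E × E =>
        α * β * s * t * (inner ℝ x (ρ • p.1 + σ • p.2) * inner ℝ y p.1)
        - α * (1 - α) / 2 * s ^ 2 * (inner ℝ x (ρ • p.1 + σ • p.2) * inner ℝ x (ρ • p.1 + σ • p.2))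
        - β * (1 - β) / 2 * t ^ 2 * (inner ℝ y p.1 * inner ℝ y p.1) := by
    ext p; unfold rpowQuad; ring
  have j12 : Integrable (fun p : E × E =>
        α * β * s * t * (inner ℝ x (ρ • p.1 + σ • p.2) * inner ℝ y p.1)
        - α * (1 - α) / 2 * s ^ 2 * (inner ℝ x (ρ • p.1 + σ • p.2) * inner ℝ x (ρ • p.1 + σ • p.2)))
      ((stdGaussian E).prod (stdGaussian E)) := (i1.1.const_mul (α * β * s * t)).sub (i2.1.const_mul (α * (1 - α) / 2 * s ^ 2))
  have j3 := i3.1.const_mul (β * (1 - β) / 2 * t ^ 2)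
  rw [e]
  refine ⟨j12.sub j3, ?_⟩
  rw [integral_sub j12 j3, integral_sub (i1.1.const_mul _) (i2.1.const_mul _), integral_const_mul,
    integral_const_mul, integral_const_mul, i1.2, i2.2, i3.2]
  have := quadratic_form_nonpos hα0 hα1 hβ0 hβ1 hαβ
    (abs_real_inner_le_norm (s • x) (t • y))
  rw [← real_inner_self_eq_norm_sq, ← real_inner_self_eq_norm_sq] at this
  simp only [inner_smul_left, inner_smul_right] at this
  simp at this ⊢
  linarith

/-- One small step: the concavity defect of `u^α v^β` beats the correlation up to `O(c³)`. -/
theorem exists_pairAvg_rpow_mul_rpow_le {α β ρ σ m : ℝ} (M L : ℝ) (hα0 : 0 < α) (hα1 : α < 1)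
    (hβ0 : 0 < β) (hβ1 : β < 1) (hρσ : ρ ^ 2 + σ ^ 2 = 1)
    (hαβ : (1 - α) * (1 - β) = ρ ^ 2 * (α * β)) (hm : 0 < m) :
    ∃ C : ℝ, ∀ (f g : E → ℝ) (D D' : E → E), IsC11Between m M L f D → IsC11Between m M L g D' →
      ∀ c, 0 ≤ c → c ≤ 1 → ∀ x y,
      pairAvg ρ σ c (fun x y => f x ^ α * g y ^ β) x y
        ≤ gaussAvg c f x ^ α * gaussAvg c g y ^ β + C * c ^ 3 := by
  set m2 := ∫ z : E, ‖z‖ ^ 2 ∂(stdGaussian E)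
  set A := (1 + M) ^ 2 * (192 * (1 + M / m) ^ 3 * (L / m) ^ 3 + 6 * (L / m) ^ 2)
  refine ⟨A * ∫ p : E × E, ((1 + m2) + 4 * ‖p‖ ^ 2) ^ 3 ∂((stdGaussian E).prod (stdGaussian E)),
    fun f g D D' hf hg c hc0 hc1 x y => ?_⟩
  have hm2 : 0 ≤ m2 := integral_nonneg fun z => by positivity
  have hL : 0 ≤ L := (norm_nonneg _).trans (hf.normD x)
  set a := gaussAvg c f x
  set b := gaussAvg c g y
  have hfa := hf.gaussAvg hm.le c
  have hgb := hg.gaussAvg hm.le c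
  have ha : a ∈ Icc m M := ⟨hfa.lower x, hfa.upper x⟩
  have hb : b ∈ Icc m M := ⟨hgb.lower y, hgb.upper y⟩
  have ha0 : 0 < a := hm.trans_le ha.1
  have hb0 : 0 < b := hm.trans_le hb.1
  have hpt : ∀ p : E × E, f (x + c • (ρ • p.1 + σ • p.2)) ^ α * g (y + c • p.1) ^ β
      ≤ a ^ α * b ^ β * (1 + α * (f (x + c • (ρ • p.1 + σ • p.2)) / a - 1)
          + β * (g (y + c • p.1) / b - 1)
          + rpowQuad α β (c / a * inner ℝ (D x) (ρ • p.1 + σ • p.2)) (c / b * inner ℝ (D' y) p.1))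
        + A * c ^ 3 * ((1 + m2) + 4 * ‖p‖ ^ 2) ^ 3 := by
    intro p
    have hξ : ‖ρ • p.1 + σ • p.2‖ ^ 2 ≤ 4 * ‖p‖ ^ 2 := by
      have h1 : |ρ| ≤ 1 := abs_le_one_iff_mul_self_le_one.2 (by nlinarith [sq_nonneg σ])
      have h2 : |σ| ≤ 1 := abs_le_one_iff_mul_self_le_one.2 (by nlinarith [sq_nonneg ρ])
      have h3 : ‖ρ • p.1 + σ • p.2‖ ≤ 2 * ‖p‖ := by
        refine (norm_add_le _ _).trans ?_
        rw [norm_smul, norm_smul, Real.norm_eq_abs, Real.norm_eq_abs]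
        have h4 := mul_le_mul h1 (norm_fst_le p) (norm_nonneg _) zero_le_one
        have h5 := mul_le_mul h2 (norm_snd_le p) (norm_nonneg _) zero_le_one
        linarith
      calc _ ≤ (2 * ‖p‖) ^ 2 := pow_le_pow_left₀ (norm_nonneg _) h3 2
        _ = _ := by ring
    have hη : ‖p.1‖ ^ 2 ≤ 4 * ‖p‖ ^ 2 := by
      have := pow_le_pow_left₀ (norm_nonneg _) (norm_fst_le p) 2
      nlinarith [sq_nonneg ‖p‖]
    have d1 := hf.displacement_le hm hc0 x (ρ • p.1 + σ • p.2) (W := (1 + m2) + 4 * ‖p‖ ^ 2)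
      (by linarith)
    have d2 := hg.displacement_le hm hc0 y p.1 (W := (1 + m2) + 4 * ‖p‖ ^ 2)
      (by linarith)
    exact rpow_mul_rpow_le_expansion hα0 hα1 hβ0 hβ1 hm (by positivity) ha hb
      ⟨hf.lower _, hf.upper _⟩ ⟨hg.lower _, hg.upper _⟩
      (by nlinarith [sq_nonneg ‖p‖]) hc0 hc1 d1.1 d1.2 d2.1 d2.2
  have hfi : Integrable (fun z => f (x + c • z)) (stdGaussian E) :=
    Continuous.integrable_of_bounded (hf.cont.comp (by fun_prop)) (fun z => hf.abs_le hm.le _)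
  have hgi : Integrable (fun z => g (y + c • z)) (stdGaussian E) :=
    Continuous.integrable_of_bounded (hg.cont.comp (by fun_prop)) (fun z => hg.abs_le hm.le _)
  have If := integral_prod_correlated hρσ hfi
  have Ig := integral_prod_fst_eq hgi
  have Iq := integral_rpowQuad_nonpos hα0 hα1 hβ0 hβ1 hρσ hαβ (c / a) (c / b) (D x) (D' y)
  have IW := integrable_pow_norm_prod (E := E) (1 + m2) 4
  have j1 : Integrable (fun p : E × E => α * (f (x + c • (ρ • p.1 + σ • p.2)) / a - 1))
      ((stdGaussian E).prod (stdGaussian E)) :=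
    ((If.1.div_const a).sub (integrable_const _)).const_mul α
  have j2 : Integrable (fun p : E × E => β * (g (y + c • p.1) / b - 1))
      ((stdGaussian E).prod (stdGaussian E)) :=
    ((Ig.1.div_const b).sub (integrable_const _)).const_mul β
  -- The linear terms vanish exactly because `a` and `b` are the means of the displaced values; this
  -- is why the expansion is around the averages and not around `f x` and `g y`.
  have v1 : ∫ p : E × E, α * (f (x + c • (ρ • p.1 + σ • p.2)) / a - 1)
      ∂((stdGaussian E).prod (stdGaussian E)) = 0 := by
    rw [integral_const_mul, integral_sub (If.1.div_const a) (integrable_const _),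
      integral_div, If.2]
    change α * (a / a - _) = 0
    simp [ha0.ne']
  have v2 : ∫ p : E × E, β * (g (y + c • p.1) / b - 1)
      ∂((stdGaussian E).prod (stdGaussian E)) = 0 := by
    rw [integral_const_mul, integral_sub (Ig.1.div_const b) (integrable_const _),
      integral_div, Ig.2]
    change β * (b / b - _) = 0
    simp [hb0.ne']
  have j0 : Integrable (fun p : E × E => (1 : ℝ) + α * (f (x + c • (ρ • p.1 + σ • p.2)) / a - 1))
      ((stdGaussian E).prod (stdGaussian E)) := (integrable_const _).add j1
  have j01 : Integrable (fun p : E × E => (1 : ℝ) + α * (f (x + c • (ρ • p.1 + σ • p.2)) / a - 1)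
      + β * (g (y + c • p.1) / b - 1)) ((stdGaussian E).prod (stdGaussian E)) := j0.add j2
  have j012 : Integrable (fun p : E × E => (1 : ℝ) + α * (f (x + c • (ρ • p.1 + σ • p.2)) / a - 1)
      + β * (g (y + c • p.1) / b - 1)
      + rpowQuad α β (c / a * inner ℝ (D x) (ρ • p.1 + σ • p.2)) (c / b * inner ℝ (D' y) p.1))
      ((stdGaussian E).prod (stdGaussian E)) := j01.add Iq.1
  have hH : Integrable (fun p : E × E => f (x + c • (ρ • p.1 + σ • p.2)) ^ α * g (y + c • p.1) ^ β)
      ((stdGaussian E).prod (stdGaussian E)) :=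
    Continuous.integrable_of_bounded ((continuous_rpow_mul_rpow hα0.le hβ0.le hf.cont hg.cont).comp
      (by fun_prop : Continuous fun p : E × E => (x + c • (ρ • p.1 + σ • p.2), y + c • p.1)))
      (fun p => abs_rpow_mul_rpow_le hα0.le hβ0.le (hm.le.trans (hf.lower _)) (hf.upper _)
        (hm.le.trans (hg.lower _)) (hg.upper _))
  have hmono := integral_mono hH ((j012.const_mul (a ^ α * b ^ β)).add (IW.const_mul (A * c ^ 3)))
    hpt
  have hab0 : 0 ≤ a ^ α * b ^ β := by positivity
  calc pairAvg ρ σ c (fun x y => f x ^ α * g y ^ β) x y ≤ _ := hmono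
    _ = a ^ α * b ^ β * (1 + ∫ p : E × E, rpowQuad α β (c / a * inner ℝ (D x) (ρ • p.1 + σ • p.2))
          (c / b * inner ℝ (D' y) p.1) ∂((stdGaussian E).prod (stdGaussian E)))
        + A * c ^ 3 * ∫ p : E × E, ((1 + m2) + 4 * ‖p‖ ^ 2) ^ 3
          ∂((stdGaussian E).prod (stdGaussian E)) := by
      simp only [Pi.add_apply]
      rw [integral_add (j012.const_mul _) (IW.const_mul _), integral_const_mul, integral_const_mul,
        integral_add j01 Iq.1, integral_add j0 j2, integral_add (integrable_const _) j1, v1, v2]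
      simp
    _ ≤ a ^ α * b ^ β * (1 + 0) + A * c ^ 3 * ∫ p : E × E, ((1 + m2) + 4 * ‖p‖ ^ 2) ^ 3
          ∂((stdGaussian E).prod (stdGaussian E)) := by
      gcongr; exact Iq.2
    _ = _ := by ring

/-- Variances add, so the average at scale `√(n+1) c` is that at scale `√n c` of the one at scale
`c`. The step is applied inside, by monotonicity, and the induction hypothesis to `gaussAvg c f` and
`gaussAvg c g`, which stay in the class; each step costs `C`. -/
theorem pairAvg_sqrt_mul_le {α β ρ σ m M L C c : ℝ} (hα0 : 0 < α) (hβ0 : 0 < β) (hm : 0 < m)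
    (hC : 0 ≤ C)
    (step : ∀ (f g : E → ℝ) (D D' : E → E), IsC11Between m M L f D → IsC11Between m M L g D' →
      ∀ x y, pairAvg ρ σ c (fun x y => f x ^ α * g y ^ β) x y
        ≤ gaussAvg c f x ^ α * gaussAvg c g y ^ β + C) (n : ℕ) :
    ∀ (f g : E → ℝ) (D D' : E → E), IsC11Between m M L f D → IsC11Between m M L g D' →
      ∀ x y, pairAvg ρ σ (Real.sqrt n * c) (fun x y => f x ^ α * g y ^ β) x y
        ≤ gaussAvg (Real.sqrt n * c) f x ^ α * gaussAvg (Real.sqrt n * c) g y ^ β + n * C := by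
  induction n with
  | zero =>
    intro f g D D' hf hg x y
    simp [pairAvg_zero, gaussAvg_zero]
  | succ n ih =>
    intro f g D D' hf hg x y
    have hsq : (Real.sqrt n * c) ^ 2 + c ^ 2 = (Real.sqrt (n + 1 : ℕ) * c) ^ 2 := by
      rw [mul_pow, mul_pow, Real.sq_sqrt (by positivity), Real.sq_sqrt (by positivity)]
      push_cast; ring
    have hbd : ∀ {f g : E → ℝ} {D D' : E → E}, IsC11Between m M L f D → IsC11Between m M L g D' →
        ∀ x y, |f x ^ α * g y ^ β| ≤ M ^ α * M ^ β := fun hf hg x y =>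
      abs_rpow_mul_rpow_le hα0.le hβ0.le (hm.le.trans (hf.lower _)) (hf.upper _)
        (hm.le.trans (hg.lower _)) (hg.upper _)
    have hf' := hf.gaussAvg hm.le c
    have hg' := hg.gaussAvg hm.le c
    have hcont := continuous_rpow_mul_rpow hα0.le hβ0.le hf.cont hg.cont
    have hcont' := continuous_rpow_mul_rpow hα0.le hβ0.le hf'.cont hg'.cont
    have hM0 : 0 ≤ M ^ α * M ^ β := (abs_nonneg _).trans (hbd hf hg x y)
    rw [← pairAvg_pairAvg hsq hcont (hbd hf hg) x y]
    have hpa : ∀ x y, |pairAvg ρ σ c (fun x y => f x ^ α * g y ^ β) x y| ≤ M ^ α * M ^ β := by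
      intro x y
      have := norm_integral_le_of_norm_le_const (μ := (stdGaussian E).prod (stdGaussian E))
        (f := fun p : E × E => f (x + c • (ρ • p.1 + σ • p.2)) ^ α * g (y + c • p.1) ^ β)
        (C := M ^ α * M ^ β) (Eventually.of_forall fun z => hbd hf hg _ _)
      simpa [pairAvg] using this
    have hstep := pairAvg_mono (ρ := ρ) (σ := σ) (c := Real.sqrt n * c)
      (G := fun x y => gaussAvg c f x ^ α * gaussAvg c g y ^ β + C) (M := M ^ α * M ^ β + C)
      (continuous_pairAvg (ρ := ρ) (σ := σ) (c := c) hcont (hbd hf hg))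
      (fun x y => (hpa x y).trans (by linarith)) (hcont'.add continuous_const)
      (fun x y => (abs_add_le _ _).trans (by
        rw [abs_of_nonneg hC]
        have := hbd hf' hg' x y
        linarith)) (fun x y => step f g D D' hf hg x y) x y
    refine hstep.trans ?_
    have hadd : pairAvg ρ σ (Real.sqrt n * c)
        (fun x y => gaussAvg c f x ^ α * gaussAvg c g y ^ β + C) x y
        = pairAvg ρ σ (Real.sqrt n * c)
          (fun x y => gaussAvg c f x ^ α * gaussAvg c g y ^ β) x y + C := by
      unfold pairAvg
      rw [integral_add _ (integrable_const _)]
      · simp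
      · exact Continuous.integrable_of_bounded (hcont'.comp (by fun_prop : Continuous
          fun p : E × E => (x + (Real.sqrt n * c) • (ρ • p.1 + σ • p.2),
            y + (Real.sqrt n * c) • p.1))) (fun p => hbd hf' hg' _ _)
    rw [hadd]
    have := ih _ _ _ _ hf' hg' x y
    rw [gaussAvg_gaussAvg hsq hf.cont (hf.abs_le hm.le),
      gaussAvg_gaussAvg hsq hg.cont (hg.abs_le hm.le)] at this
    push_cast at this ⊢
    linarith

/-- Bilinear Gaussian hypercontractivity for smooth functions. -/
theorem IsC11Between.pairAvg_rpow_mul_rpow_le {α β ρ σ m M L : ℝ} (hα0 : 0 < α) (hα1 : α < 1)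
    (hβ0 : 0 < β) (hβ1 : β < 1) (hρσ : ρ ^ 2 + σ ^ 2 = 1)
    (hαβ : (1 - α) * (1 - β) = ρ ^ 2 * (α * β)) (hm : 0 < m) {f g : E → ℝ} {D D' : E → E}
    (hf : IsC11Between m M L f D) (hg : IsC11Between m M L g D') (x y : E) :
    pairAvg ρ σ 1 (fun x y => f x ^ α * g y ^ β) x y
        ≤ _root_.gaussAvg 1 f x ^ α * _root_.gaussAvg 1 g y ^ β := by
  obtain ⟨C, hC⟩ := exists_pairAvg_rpow_mul_rpow_le (E := E) M L hα0 hα1 hβ0 hβ1 hρσ hαβ hm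
  -- With `c = n^{-1/2}` the total scale `√n c` is `1`, and `n` errors of size `|C| n^{-3/2}` add up
  -- to `|C| n^{-1/2}`.
  have hn : ∀ n : ℕ, 0 < n → pairAvg ρ σ 1 (fun x y => f x ^ α * g y ^ β) x y
      ≤ _root_.gaussAvg 1 f x ^ α * _root_.gaussAvg 1 g y ^ β + |C| * (Real.sqrt n)⁻¹ := by
    intro n hn
    have hn1 : (1 : ℝ) ≤ n := by exact_mod_cast hn
    have hs1 : 1 ≤ Real.sqrt n := Real.one_le_sqrt.2 hn1
    have hs0 : 0 < Real.sqrt n := by linarith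
    have := pairAvg_sqrt_mul_le (E := E) (ρ := ρ) (σ := σ) (m := m) (M := M) (L := L)
      (C := |C| * (Real.sqrt n)⁻¹ ^ 3) (c := (Real.sqrt n)⁻¹) hα0 hβ0 hm (by positivity)
      (fun f g D D' hf hg x y =>
        (hC f g D D' hf hg _ (by positivity) (inv_le_one_of_one_le₀ hs1) x y).trans (by
          gcongr; exact le_abs_self _)) n f g D D' hf hg x y
    rw [mul_inv_cancel₀ hs0.ne'] at this
    refine this.trans (le_of_eq ?_)
    congr 1
    have h2 : (n : ℝ) = Real.sqrt n * Real.sqrt n := (Real.mul_self_sqrt (by positivity)).symm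
    calc (n : ℝ) * (|C| * (Real.sqrt n)⁻¹ ^ 3)
        = (Real.sqrt n * Real.sqrt n) * (|C| * (Real.sqrt n)⁻¹ ^ 3) := by rw [← h2]
      _ = _ := by field_simp
  have hlim : Tendsto (fun n : ℕ => _root_.gaussAvg 1 f x ^ α * _root_.gaussAvg 1 g y ^ β
      + |C| * (Real.sqrt n)⁻¹) atTop
      (𝓝 (_root_.gaussAvg 1 f x ^ α * _root_.gaussAvg 1 g y ^ β + |C| * 0)) := by
    refine tendsto_const_nhds.add (Tendsto.const_mul _ ?_)
    exact (Real.tendsto_sqrt_atTop.comp tendsto_natCast_atTop_atTop).inv_tendsto_atTop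
  have := ge_of_tendsto hlim (eventually_atTop.2 ⟨1, fun n h => hn n h⟩)
  simpa using this

end Telescoping

/-! ### Hypercontractivity for continuous bounded functions -/

section Approximation

open ProbabilityTheory

set_option linter.unusedSectionVars false

variable {E : Type*} [NormedAddCommGroup E] [InnerProductSpace ℝ E] [FiniteDimensional ℝ E]
  [MeasurableSpace E] [BorelSpace E]

/-- Compact support makes the derivative bounded and Lipschitz, which yields the quadratic remainder
by the mean value inequality. The shift by `e` will supply the positive lower bound. -/
theorem exists_isC11Between_of_contDiff {h : E → ℝ} (hh : ContDiff ℝ 2 h) (hc : HasCompactSupport h)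
    {M e : ℝ} (h0 : ∀ x, 0 ≤ h x) (hM : ∀ x, h x ≤ M) :
    ∃ L D, IsC11Between e (M + e) L (fun x => h x + e) D := by
  obtain ⟨C, hC⟩ := (hc.fderiv ℝ).exists_bound_of_continuous (hh.continuous_fderiv (by norm_num))
  have hf1 : ContDiff ℝ 1 (fderiv ℝ h) := hh.fderiv_right (by norm_num)
  obtain ⟨K, hK⟩ := ContDiff.lipschitzWith_of_hasCompactSupport (hc.fderiv ℝ) hf1 (by norm_num)
  have hgrad : Continuous (gradient h) := by
    unfold gradient
    exact (InnerProductSpace.toDual ℝ E).symm.continuous.comp (hh.continuous_fderiv (by norm_num))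
  refine ⟨max C K, gradient h, fun x => by linarith [h0 x], fun x => by linarith [hM x],
    hh.continuous.add continuous_const, hgrad, fun x => ?_, fun x k => ?_⟩
  · unfold gradient
    rw [LinearIsometryEquiv.norm_map]
    exact (hC x).trans (le_max_left _ _)
  · have h1 : inner ℝ (gradient h x) k = fderiv ℝ h x k := by
      unfold gradient; exact InnerProductSpace.toDual_symm_apply
    have h2 := Convex.norm_image_sub_le_of_norm_hasFDerivWithin_le' (f := h) (f' := fderiv ℝ h)
      (φ := fderiv ℝ h x) (C := K * ‖k‖) (s := Metric.closedBall x ‖k‖) (x := x) (y := x + k)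
      (fun y _ => ((hh.differentiable (by norm_num)) y).hasFDerivAt.hasFDerivWithinAt)
      (fun y hy => by
        have := hK.dist_le_mul y x
        rw [dist_eq_norm, dist_eq_norm] at this
        refine this.trans ?_
        gcongr
        simpa [dist_eq_norm] using hy) (convex_closedBall _ _) (by simp) (by simp)
    rw [h1]
    have e1 : h (x + k) + e - (h x + e) - fderiv ℝ h x k = h (x + k) - h x - fderiv ℝ h x k := by
      ring
    rw [e1]
    simp only [add_sub_cancel_left, Real.norm_eq_abs] at h2
    calc _ ≤ K * ‖k‖ * ‖k‖ := h2
      _ = K * ‖k‖ ^ 2 := by ring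
      _ ≤ _ := by gcongr; exact le_max_right _ _

/-- Cut off at radius about `n`, mollify at scale `1 / (n + 1)`, then add `1 / (n + 1)`. The
`C^{1,1}` constant may blow up with `n`: it does not appear in the limiting inequality. -/
theorem exists_isC11Between_approx {f : E → ℝ} {M : ℝ} (hf : Continuous f) (h0 : ∀ x, 0 ≤ f x)
    (hM : ∀ x, f x ≤ M) :
    ∃ F : ℕ → E → ℝ, (∀ n : ℕ, ∃ L D, IsC11Between (1 / ((n : ℝ) + 1)) (M + 1 / ((n : ℝ) + 1))
      L (F n) D) ∧ ∀ x, Tendsto (fun n => F n x) atTop (𝓝 (f x)) := by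
  have hM0 : 0 ≤ M := (h0 0).trans (hM 0)
  let φ : ℕ → ContDiffBump (0 : E) := fun n =>
    ⟨1 / ((n : ℝ) + 1) / 2, 1 / ((n : ℝ) + 1), by positivity, by
      have : 0 < 1 / ((n : ℝ) + 1) := by positivity
      linarith⟩
  let χ : ℕ → E → ℝ := fun n x => max 0 (min 1 ((n : ℝ) + 1 - ‖x‖))
  have hχc : ∀ n, Continuous (χ n) := fun n => by fun_prop
  have hχ0 : ∀ n x, 0 ≤ χ n x := fun n x => le_max_left _ _
  have hχ1 : ∀ n x, χ n x ≤ 1 := fun n x => max_le zero_le_one (min_le_left _ _)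
  have hχs : ∀ n, HasCompactSupport (χ n) := fun n => by
    refine HasCompactSupport.intro (isCompact_closedBall (0 : E) ((n : ℝ) + 1)) fun x hx => ?_
    simp only [Metric.mem_closedBall, dist_zero_right, not_le] at hx
    exact max_eq_left ((min_le_right _ _).trans (by linarith))
  let g : ℕ → E → ℝ := fun n x => χ n x * f x
  have hgc : ∀ n, Continuous (g n) := fun n => (hχc n).mul hf
  have hgs : ∀ n, HasCompactSupport (g n) := fun n => (hχs n).mul_right
  have hg0 : ∀ n x, 0 ≤ g n x := fun n x => mul_nonneg (hχ0 n x) (h0 x)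
  have hgM : ∀ n x, g n x ≤ M := fun n x =>
    (mul_le_of_le_one_left (h0 x) (hχ1 n x)).trans (hM x)
  let k : ℕ → E → ℝ := fun n =>
    convolution ((φ n).normed volume) (g n) (ContinuousLinearMap.lsmul ℝ ℝ) volume
  have hkC : ∀ n, ContDiff ℝ 2 (k n) := fun n =>
    (φ n).hasCompactSupport_normed.contDiff_convolution_left _ (φ n).contDiff_normed
      (hgc n).locallyIntegrable
  have hks : ∀ n, HasCompactSupport (k n) := fun n =>
    (φ n).hasCompactSupport_normed.convolution _ (hgs n)
  have hk0 : ∀ n x, 0 ≤ k n x := fun n x => by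
    refine integral_nonneg fun t => ?_
    simp only [ContinuousLinearMap.lsmul_apply, smul_eq_mul]
    exact mul_nonneg ((φ n).nonneg_normed t) (hg0 n _)
  have hkM : ∀ n x, k n x ≤ M := fun n x => by
    have hi : Integrable ((φ n).normed (volume : Measure E)) :=
      ((φ n).continuous_normed).integrable_of_hasCompactSupport (φ n).hasCompactSupport_normed
    have : k n x ≤ ∫ t, (φ n).normed (volume : Measure E) t * M := by
      refine integral_mono ?_ (hi.mul_const M) fun t => ?_
      · simp only [ContinuousLinearMap.lsmul_apply, smul_eq_mul]
        refine Continuous.integrable_of_hasCompactSupport ?_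
          ((φ n).hasCompactSupport_normed.mul_right)
        exact (φ n).continuous_normed.mul ((hgc n).comp (by fun_prop))
      · simp only [ContinuousLinearMap.lsmul_apply, smul_eq_mul]
        exact mul_le_mul_of_nonneg_left (hgM n _) ((φ n).nonneg_normed t)
    rw [integral_mul_const, (φ n).integral_normed, one_mul] at this
    exact this
  refine ⟨fun n x => k n x + 1 / ((n : ℝ) + 1), fun n => exists_isC11Between_of_contDiff (hkC n) (hks n)
    (hk0 n) (hkM n), fun x => ?_⟩
  have hlim : Tendsto (fun n => k n x) atTop (𝓝 (f x)) := by
    rw [Metric.tendsto_atTop]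
    intro ε hε
    obtain ⟨δ, hδ, hδf⟩ := Metric.continuous_iff.1 hf x (ε / 2) (by positivity)
    obtain ⟨N1, hN1⟩ := exists_nat_one_div_lt hδ
    -- For `n ≥ ‖x‖ + 1` the cutoff equals `1` on the whole ball seen by the mollifier at `x`.
    obtain ⟨N2, hN2⟩ := exists_nat_ge (‖x‖ + 1)
    refine ⟨max N1 N2, fun n hn => ?_⟩
    have hn1 : (N1 : ℝ) ≤ n := by exact_mod_cast (le_max_left _ _).trans hn
    have hn2 : (N2 : ℝ) ≤ n := by exact_mod_cast (le_max_right _ _).trans hn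
    have hr : 1 / ((n : ℝ) + 1) ≤ 1 / ((N1 : ℝ) + 1) := by gcongr
    have hr1 : 1 / ((n : ℝ) + 1) ≤ 1 := by
      rw [div_le_one (by positivity)]; linarith [(Nat.cast_nonneg n : (0 : ℝ) ≤ n)]
    have hone : ∀ y ∈ Metric.ball x (φ n).rOut, g n y = f y := by
      intro y hy
      have hy' : ‖y - x‖ < 1 / ((n : ℝ) + 1) := by
        rw [Metric.mem_ball, dist_eq_norm] at hy; exact hy
      have h3 : ‖y‖ ≤ ‖x‖ + ‖y - x‖ := by
        calc ‖y‖ = ‖x + (y - x)‖ := by congr 1; abel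
          _ ≤ _ := norm_add_le _ _
      have : χ n y = 1 := by
        change max 0 (min 1 ((n : ℝ) + 1 - ‖y‖)) = 1
        rw [min_eq_left (by linarith), max_eq_right zero_le_one]
      change χ n y * f y = f y
      rw [this, one_mul]
    have hx : g n x = f x := hone x (Metric.mem_ball_self (φ n).rOut_pos)
    have := (φ n).dist_normed_convolution_le (μ := volume) (g := g n) (x₀ := x) (ε := ε / 2)
      (hgc n).aestronglyMeasurable (fun y hy => by
        rw [hone y hy, hx]
        refine (hδf y ?_).le
        have : dist y x < 1 / ((n : ℝ) + 1) := hy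
        linarith)
    rw [hx] at this
    change dist (k n x) (f x) < ε
    exact this.trans_lt (by linarith)
  simpa using hlim.add tendsto_one_div_add_atTop_nhds_zero_nat

/-- **Gaussian hypercontractivity** in bilinear form. -/
theorem integral_rpow_mul_rpow_correlated_le {α β ρ σ M : ℝ} (hα0 : 0 < α) (hα1 : α < 1)
    (hβ0 : 0 < β) (hβ1 : β < 1) (hρσ : ρ ^ 2 + σ ^ 2 = 1)
    (hαβ : (1 - α) * (1 - β) = ρ ^ 2 * (α * β)) {f g : E → ℝ}
    (hf : Continuous f) (hf0 : ∀ x, 0 ≤ f x) (hfM : ∀ x, f x ≤ M)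
    (hg : Continuous g) (hg0 : ∀ x, 0 ≤ g x) (hgM : ∀ x, g x ≤ M) :
    ∫ p : E × E, f (ρ • p.1 + σ • p.2) ^ α * g p.1 ^ β ∂((stdGaussian E).prod (stdGaussian E))
      ≤ (∫ z, f z ∂(stdGaussian E)) ^ α * (∫ z, g z ∂(stdGaussian E)) ^ β := by
  obtain ⟨F, hF, hFlim⟩ := exists_isC11Between_approx hf hf0 hfM
  obtain ⟨G, hG, hGlim⟩ := exists_isC11Between_approx hg hg0 hgM
  have hn0 : ∀ n : ℕ, 0 < 1 / ((n : ℝ) + 1) := fun n => by positivity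
  have hn1 : ∀ n : ℕ, 1 / ((n : ℝ) + 1) ≤ 1 := fun n => by
    rw [div_le_one (by positivity)]; linarith [(Nat.cast_nonneg n : (0 : ℝ) ≤ n)]
  have bF : ∀ n, Continuous (F n) ∧ (∀ x, 0 ≤ F n x) ∧ ∀ x, F n x ≤ M + 1 := fun n => by
    obtain ⟨L, D, h⟩ := hF n
    exact ⟨h.cont, fun x => (hn0 n).le.trans (h.lower x), fun x => (h.upper x).trans
      (by linarith [hn1 n])⟩
  have bG : ∀ n, Continuous (G n) ∧ (∀ x, 0 ≤ G n x) ∧ ∀ x, G n x ≤ M + 1 := fun n => by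
    obtain ⟨L, D, h⟩ := hG n
    exact ⟨h.cont, fun x => (hn0 n).le.trans (h.lower x), fun x => (h.upper x).trans
      (by linarith [hn1 n])⟩
  have hineq : ∀ n, ∫ p : E × E, F n (ρ • p.1 + σ • p.2) ^ α * G n p.1 ^ β
      ∂((stdGaussian E).prod (stdGaussian E))
      ≤ (∫ z, F n z ∂(stdGaussian E)) ^ α * (∫ z, G n z ∂(stdGaussian E)) ^ β := by
    intro n
    obtain ⟨L, D, h⟩ := hF n
    obtain ⟨L', D', h'⟩ := hG n
    have := (h.mono le_rfl le_rfl (le_max_left L L')).pairAvg_rpow_mul_rpow_le hα0 hα1 hβ0 hβ1 hρσ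
      hαβ (hn0 n) (h'.mono le_rfl le_rfl (le_max_right L L')) 0 0
    simpa [pairAvg, gaussAvg] using this
  have l1 : Tendsto (fun n => ∫ p : E × E, F n (ρ • p.1 + σ • p.2) ^ α * G n p.1 ^ β
      ∂((stdGaussian E).prod (stdGaussian E))) atTop
      (𝓝 (∫ p : E × E, f (ρ • p.1 + σ • p.2) ^ α * g p.1 ^ β
        ∂((stdGaussian E).prod (stdGaussian E)))) := by
    refine tendsto_integral_of_dominated_convergence (fun _ => (M + 1) ^ α * (M + 1) ^ β)
      (fun n => ?_) (integrable_const _) (fun n => ?_) ?_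
    · exact ((continuous_rpow_mul_rpow hα0.le hβ0.le (bF n).1 (bG n).1).comp
        (by fun_prop : Continuous fun p : E × E => (ρ • p.1 + σ • p.2, p.1))).aestronglyMeasurable
    · exact Eventually.of_forall fun p => abs_rpow_mul_rpow_le hα0.le hβ0.le ((bF n).2.1 _)
        ((bF n).2.2 _) ((bG n).2.1 _) ((bG n).2.2 _)
    · exact Eventually.of_forall fun p => ((hFlim _).rpow_const (Or.inr hα0.le)).mul
        ((hGlim _).rpow_const (Or.inr hβ0.le))
  have lint : ∀ {H : ℕ → E → ℝ} {h : E → ℝ}, (∀ n, Continuous (H n) ∧ (∀ x, 0 ≤ H n x) ∧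
      ∀ x, H n x ≤ M + 1) → (∀ x, Tendsto (fun n => H n x) atTop (𝓝 (h x))) →
      Tendsto (fun n => ∫ z, H n z ∂(stdGaussian E)) atTop (𝓝 (∫ z, h z ∂(stdGaussian E))) := by
    intro H h b l
    refine tendsto_integral_of_dominated_convergence (fun _ => M + 1)
      (fun n => (b n).1.aestronglyMeasurable) (integrable_const _) (fun n => ?_)
      (Eventually.of_forall l)
    exact Eventually.of_forall fun z => by
      rw [Real.norm_eq_abs, abs_of_nonneg ((b n).2.1 z)]; exact (b n).2.2 z
  exact le_of_tendsto_of_tendsto' l1 (((lint bF hFlim).rpow_const (Or.inr hα0.le)).mul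
    ((lint bG hGlim).rpow_const (Or.inr hβ0.le))) hineq

end Approximation

/-! ### The pointwise inequality, by duality -/

section SupersolutionInequality

open ProbabilityTheory

set_option linter.unusedSectionVars false

variable {E : Type*} [NormedAddCommGroup E] [InnerProductSpace ℝ E] [FiniteDimensional ℝ E]
  [MeasurableSpace E] [BorelSpace E]

theorem gaussAvg_nonneg {c : ℝ} {f : E → ℝ} (h : ∀ x, 0 ≤ f x) (x : E) : 0 ≤ gaussAvg c f x :=
  integral_nonneg fun _ => h _

/-- The last move of the duality argument: the test function `K^{q-1}` reproduces a power of `I`,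
which can be divided out unless `I = 0`. -/
theorem le_rpow_of_le_mul_rpow {I T q : ℝ} (hq : 1 < q) (hI : 0 ≤ I) (hT : 0 ≤ T)
    (h : I ≤ T * I ^ (1 - 1 / q)) : I ≤ T ^ q := by
  rcases hI.eq_or_lt with h0 | h0
  · rw [← h0]; positivity
  · have hq0 : 0 < q := by linarith
    have h1 : I ^ (1 / q) ≤ T := by
      have h2 : I ^ (1 / q) * I ^ (1 - 1 / q) = I := by
        rw [← Real.rpow_add h0]; simp
      exact le_of_mul_le_mul_right (h2.le.trans h) (by positivity)
    calc I = (I ^ (1 / q)) ^ q := by rw [← Real.rpow_mul hI]; field_simp; simp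
      _ ≤ T ^ q := by gcongr

/-- The pointwise inequality `e^{rL}[(e^{sL} g^{1/p})^q] ≤ (e^{sL} (e^{rL} g)^{1/p})^q`, for the
Gaussian averages that make up the Ornstein-Uhlenbeck semigroup. -/
theorem integral_gaussAvg_rpow_le {p q ρ σ a b M : ℝ} (hp : 1 < p) (hq : 1 < q)
    (hρσ : ρ ^ 2 + σ ^ 2 = 1) (hpq : p - 1 = ρ ^ 2 * (q - 1)) (hab : a ^ 2 + b ^ 2 = 1)
    {g : E → ℝ} (hg : Continuous g) (hg0 : ∀ x, 0 ≤ g x) (hgM : ∀ x, g x ≤ M) (w : E) :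
    ∫ y, gaussAvg σ (fun z => g z ^ (1 / p)) (w + (ρ * b) • y) ^ q ∂(stdGaussian E)
      ≤ gaussAvg (a * σ) (fun z => gaussAvg b g z ^ (1 / p)) w ^ q := by
  have hp0 : 0 < p := by linarith
  have hq0 : 0 < q := by linarith
  have hM0 : 0 ≤ M := (hg0 0).trans (hgM 0)
  have hα0 : 0 < 1 / p := by positivity
  have hα1 : 1 / p < 1 := by rw [div_lt_one hp0]; exact hp
  have hq1 : 1 / q < 1 := by rw [div_lt_one hq0]; exact hq
  have hq10 : 0 < 1 / q := by positivity
  have hβ0 : 0 < 1 - 1 / q := by linarith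
  have hβ1 : 1 - 1 / q < 1 := by linarith
  have hαβ : (1 - 1 / p) * (1 - (1 - 1 / q)) = ρ ^ 2 * (1 / p * (1 - 1 / q)) := by
    field_simp; linarith
  set F : E → ℝ := fun z => g z ^ (1 / p) with hFdef
  have hF : Continuous F := hg.rpow_const fun _ => Or.inr hα0.le
  have hF0 : ∀ x, 0 ≤ F x := fun x => Real.rpow_nonneg (hg0 x) _
  set N := M ^ (1 / p) with hN
  have hFN : ∀ x, |F x| ≤ N := fun x => by
    rw [abs_of_nonneg (hF0 x)]; exact Real.rpow_le_rpow (hg0 x) (hgM x) hα0.le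
  have hN0 : 0 ≤ N := by positivity
  set K : E → ℝ := fun y => gaussAvg σ F (w + (ρ * b) • y) with hKdef
  have hK : Continuous K := (continuous_gaussAvg hF hFN).comp (by fun_prop)
  have hK0 : ∀ y, 0 ≤ K y := fun y => gaussAvg_nonneg hF0 _
  have hKN : ∀ y, K y ≤ N := fun y => (le_abs_self _).trans (abs_gaussAvg_le hFN _)
  -- The noise of variance `σ²` is split into independent parts of sizes `a σ` and `b σ`. The second
  -- will join `(ρ b) • y` to form `b • (ρ y + σ z'')`, which is correlated with `y`.
  have hKdec : ∀ y, K y = ∫ z', gaussAvg (b * σ) F (w + (ρ * b) • y + (a * σ) • z')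
      ∂(stdGaussian E) := fun y => by
    have hsq : (a * σ) ^ 2 + (b * σ) ^ 2 = σ ^ 2 := by
      rw [mul_pow, mul_pow, ← add_mul, hab, one_mul]
    exact (gaussAvg_gaussAvg hsq hF hFN _).symm
  have hKq : ∀ y, K y ^ q = K y * K y ^ (q - 1) := fun y => by
    rcases (hK0 y).eq_or_lt with h | h
    · rw [← h, Real.zero_rpow hq0.ne', zero_mul]
    · rw [Real.rpow_sub_one h.ne']; field_simp
  have hKβ : ∀ y, (K y ^ q) ^ (1 - 1 / q) = K y ^ (q - 1) := fun y => by
    rw [← Real.rpow_mul (hK0 y)]; congr 1; field_simp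
  have hKqc : Continuous fun y => K y ^ q := hK.rpow_const fun _ => Or.inr hq0.le
  have hKq1c : Continuous fun y => K y ^ (q - 1) := hK.rpow_const fun _ => Or.inr (by linarith)
  set I := ∫ y, K y ^ q ∂(stdGaussian E) with hI
  have hI0 : 0 ≤ I := integral_nonneg fun y => Real.rpow_nonneg (hK0 y) _
  have hGB := continuous_gaussAvg (c := b * σ) hF hFN
  have hgabs : ∀ x, |g x| ≤ M := fun x => by rw [abs_of_nonneg (hg0 x)]; exact hgM x
  have hbg := continuous_gaussAvg (c := b) hg hgabs
  -- Write `K^q = K · K^{q-1}`, expand only the first factor, and integrate over `z'` last.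
  have hswap : I = ∫ z', ∫ y, gaussAvg (b * σ) F (w + (ρ * b) • y + (a * σ) • z') * K y ^ (q - 1)
      ∂(stdGaussian E) ∂(stdGaussian E) := by
    rw [integral_integral_swap]
    · rw [hI]; congr 1; ext y
      rw [integral_mul_const, ← hKdec, hKq]
    · refine Continuous.integrable_of_bounded (M := N * N ^ (q - 1)) ?_ (fun z => ?_)
      · exact (hGB.comp (by fun_prop : Continuous fun z : E × E =>
          w + (ρ * b) • z.2 + (a * σ) • z.1)).mul (hKq1c.comp continuous_snd)
      · simp only [Function.uncurry]
        rw [abs_mul, abs_of_nonneg (Real.rpow_nonneg (hK0 z.2) (q - 1))]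
        exact mul_le_mul (abs_gaussAvg_le hFN _)
          (Real.rpow_le_rpow (hK0 _) (hKN _) (by linarith)) (Real.rpow_nonneg (hK0 _) _) hN0
  -- For frozen `z'`, bilinear hypercontractivity applies to a translate and dilate of `g` and to
  -- `K^q`, whose power `1 - 1/q` is `K^{q-1}`.
  have hinner : ∀ z', ∫ y, gaussAvg (b * σ) F (w + (ρ * b) • y + (a * σ) • z') * K y ^ (q - 1)
      ∂(stdGaussian E) ≤ gaussAvg b g (w + (a * σ) • z') ^ (1 / p) * I ^ (1 - 1 / q) := by
    intro z'
    have h := integral_rpow_mul_rpow_correlated_le (E := E) (M := max M (N ^ q)) hα0 hα1 hβ0 hβ1 hρσ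
      hαβ (f := fun v => g (w + (a * σ) • z' + b • v)) (g := fun y => K y ^ q)
      (hg.comp (by fun_prop)) (fun _ => hg0 _) (fun _ => (hgM _).trans (le_max_left _ _)) hKqc
      (fun y => Real.rpow_nonneg (hK0 y) _)
      (fun y => (Real.rpow_le_rpow (hK0 y) (hKN y) hq0.le).trans (le_max_right _ _))
    refine le_trans (le_of_eq ?_) h
    simp_rw [hKβ]
    rw [integral_prod]
    · congr 1; ext y
      dsimp only
      rw [integral_mul_const]
      congr 1
      unfold gaussAvg
      congr 1; ext z''
      simp only [hFdef]
      congr 2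
      module
    · refine Continuous.integrable_of_bounded (M := N * N ^ (q - 1)) ?_ (fun z => ?_)
      · exact (hF.comp (by fun_prop : Continuous fun z : E × E =>
          w + (a * σ) • z' + b • (ρ • z.1 + σ • z.2))).mul (hKq1c.comp continuous_fst)
      · rw [abs_mul, abs_of_nonneg (Real.rpow_nonneg (hK0 z.1) (q - 1))]
        exact mul_le_mul (hFN _)
          (Real.rpow_le_rpow (hK0 _) (hKN _) (by linarith)) (Real.rpow_nonneg (hK0 _) _) hN0
  refine le_rpow_of_le_mul_rpow hq hI0
    (gaussAvg_nonneg (fun z => Real.rpow_nonneg (gaussAvg_nonneg hg0 z) _) _) ?_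
  have hT : gaussAvg (a * σ) (fun z => gaussAvg b g z ^ (1 / p)) w * I ^ (1 - 1 / q)
      = ∫ z', gaussAvg b g (w + (a * σ) • z') ^ (1 / p) * I ^ (1 - 1 / q) ∂(stdGaussian E) := by
    rw [integral_mul_const]; rfl
  rw [hT]
  conv_lhs => rw [hswap]
  have hbgN : ∀ x, gaussAvg b g x ^ (1 / p) ≤ N := fun x =>
    Real.rpow_le_rpow (gaussAvg_nonneg hg0 x) ((le_abs_self _).trans (abs_gaussAvg_le hgabs x))
      hα0.le
  refine integral_mono ?_ ?_ hinner
  · have hint : Integrable (Function.uncurry fun z' y =>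
        gaussAvg (b * σ) F (w + (ρ * b) • y + (a * σ) • z') * K y ^ (q - 1))
        ((stdGaussian E).prod (stdGaussian E)) := by
      refine Continuous.integrable_of_bounded (M := N * N ^ (q - 1)) ?_ (fun z => ?_)
      · exact (hGB.comp (by fun_prop : Continuous fun z : E × E =>
          w + (ρ * b) • z.2 + (a * σ) • z.1)).mul (hKq1c.comp continuous_snd)
      · simp only [Function.uncurry]
        rw [abs_mul, abs_of_nonneg (Real.rpow_nonneg (hK0 z.2) (q - 1))]
        exact mul_le_mul (abs_gaussAvg_le hFN _)
          (Real.rpow_le_rpow (hK0 _) (hKN _) (by linarith)) (Real.rpow_nonneg (hK0 _) _) hN0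
    exact hint.integral_prod_left
  · refine Integrable.mul_const ?_ _
    refine Continuous.integrable_of_bounded (M := N) ?_ (fun z => ?_)
    · exact (hbg.comp (by fun_prop)).rpow_const fun _ => Or.inr hα0.le
    · rw [abs_of_nonneg (Real.rpow_nonneg (gaussAvg_nonneg hg0 _) _)]; exact hbgN _

end SupersolutionInequality

/-! ### Translation to the Ornstein–Uhlenbeck semigroup -/

section OUSemigroup

theorem ouSemigroup_eq_gaussAvg {d : ℕ} (s : ℝ) (f : EuclideanSpace ℝ (Fin d) → ℝ)
    (x : EuclideanSpace ℝ (Fin d)) :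
    ouSemigroup s f x = gaussAvg (Real.sqrt (1 - Real.exp (-2 * s))) f (Real.exp (-s) • x) := rfl

theorem exp_neg_sq_add_sqrt_sq {s : ℝ} (hs : 0 ≤ s) :
    Real.exp (-s) ^ 2 + Real.sqrt (1 - Real.exp (-2 * s)) ^ 2 = 1 := by
  rw [Real.sq_sqrt (by linarith [Real.exp_le_one_iff.2 (by linarith : -2 * s ≤ 0)]), ← Real.exp_nat_mul]
  push_cast
  ring_nf

/-- Gaussian averaging is symmetric: `γ` is invariant under the Ornstein-Uhlenbeck semigroup. -/
theorem integral_ouSemigroup {d : ℕ} {r M : ℝ} (hr : 0 ≤ r) {f : EuclideanSpace ℝ (Fin d) → ℝ}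
    (hf : Continuous f) (hM : ∀ x, |f x| ≤ M) :
    ∫ x, ouSemigroup r f x ∂(gaussMeasure d) = ∫ x, f x ∂(gaussMeasure d) := by
  have := integral_integral_smul_add_smul_stdGaussian (E := EuclideanSpace ℝ (Fin d)) (c := 1)
    (by rw [exp_neg_sq_add_sqrt_sq hr]; norm_num) (F := f) (by
      simp only [one_smul, Measure.map_id']
      exact hf.integrable_of_bounded hM)
  simp only [one_smul] at this
  exact this

theorem ouSemigroup_rpow_ouSemigroup_le {d : ℕ} {p q s r M : ℝ} (hp : 1 < p) (hpq : p < q)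
    (hs : Real.exp (2 * s) = (q - 1) / (p - 1)) (hr : 0 ≤ r)
    {g : EuclideanSpace ℝ (Fin d) → ℝ} (hg : Continuous g) (hg0 : ∀ x, 0 ≤ g x)
    (hgM : ∀ x, g x ≤ M) (x : EuclideanSpace ℝ (Fin d)) :
    ouSemigroup r (fun z => ouSemigroup s (fun z => g z ^ (1 / p)) z ^ q) x
      ≤ ouSemigroup s (fun z => ouSemigroup r g z ^ (1 / p)) x ^ q := by
  have hs0 : 0 ≤ s := by
    have : 1 < Real.exp (2 * s) := by rw [hs, lt_div_iff₀ (by linarith)]; linarith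
    rw [Real.one_lt_exp_iff] at this
    linarith
  have hpq' : p - 1 = Real.exp (-s) ^ 2 * (q - 1) := by
    have h1 : Real.exp (-s) ^ 2 * Real.exp (2 * s) = 1 := by
      rw [← Real.exp_nat_mul, ← Real.exp_add]; simp
    have h2 : q - 1 = Real.exp (2 * s) * (p - 1) := by
      rw [hs]; field_simp [(by linarith : p - 1 ≠ 0)]
    rw [h2, ← mul_assoc, h1, one_mul]
  -- Here `ρ = e^{-s}`, `a = e^{-r}`, with `σ` and `b` the complementary square roots; both orders
  -- of composition start from the common centre `e^{-s} e^{-r} x`.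
  have h := integral_gaussAvg_rpow_le hp (hp.trans hpq) (exp_neg_sq_add_sqrt_sq hs0) hpq'
    (exp_neg_sq_add_sqrt_sq hr) hg hg0 hgM ((Real.exp (-s) * Real.exp (-r)) • x)
  refine le_trans (le_of_eq ?_) (h.trans (le_of_eq ?_))
  · refine integral_congr_ae (Eventually.of_forall fun y => ?_)
    dsimp only
    rw [ouSemigroup_eq_gaussAvg, smul_add, smul_smul, smul_smul]
  · rw [ouSemigroup_eq_gaussAvg]
    congr 1
    refine integral_congr_ae (Eventually.of_forall fun y => ?_)
    dsimp only
    rw [ouSemigroup_eq_gaussAvg, smul_add, smul_smul, smul_smul, mul_comm (Real.exp (-r)) (Real.exp (-s))]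

end OUSemigroup

/-! ### Moving the Laplacian onto a radial kernel -/

section RadialIntegrationByParts

set_option linter.unusedSectionVars false

variable {E : Type*} [NormedAddCommGroup E] [InnerProductSpace ℝ E] [FiniteDimensional ℝ E]

theorem laplacian_eq_sum_fderiv (f : E → ℝ) (x : E) :
    Laplacian.laplacian f x = ∑ i, fderiv ℝ (fderiv ℝ f) x (stdOrthonormalBasis ℝ E i)
      (stdOrthonormalBasis ℝ E i) := by
  rw [InnerProductSpace.laplacian_eq_iteratedFDeriv_stdOrthonormalBasis]
  refine Finset.sum_congr rfl fun i _ => ?_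
  rw [iteratedFDeriv_two_apply]
  simp

variable [MeasurableSpace E] [BorelSpace E]

theorem hasCompactSupport_of_eq_zero_of_sq_norm {F : E → ℝ} {V : ℝ}
    (h : ∀ y, V < ‖y‖ ^ 2 → F y = 0) : HasCompactSupport F := by
  refine HasCompactSupport.intro (isCompact_closedBall (0 : E) (Real.sqrt V)) fun y hy => h y ?_
  simp only [Metric.mem_closedBall, dist_zero_right, not_le] at hy
  exact (Real.sqrt_lt' ((Real.sqrt_nonneg V).trans_lt hy)).1 hy

theorem deriv_eq_zero_of_eq_zero_of_lt {κ κ₁ : ℝ → ℝ} {V : ℝ} (h : ∀ v, HasDerivAt κ (κ₁ v) v)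
    (h0 : ∀ v, V < v → κ v = 0) (v : ℝ) (hv : V < v) : κ₁ v = 0 := by
  have h1 : κ =ᶠ[𝓝 v] fun _ => 0 := by
    filter_upwards [Ioi_mem_nhds hv] with w hw using h0 w hw
  exact (h v).unique ((hasDerivAt_const v (0 : ℝ)).congr_of_eventuallyEq h1)

theorem hasFDerivAt_comp_sq_norm {κ : ℝ → ℝ} {k : ℝ} {y : E} (h : HasDerivAt κ k (‖y‖ ^ 2)) :
    HasFDerivAt (fun y : E => κ (‖y‖ ^ 2)) ((2 * k) • innerSL ℝ y) y := by
  have h1 : HasFDerivAt (fun y : E => ‖y‖ ^ 2) (2 • innerSL ℝ y) y :=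
    (hasStrictFDerivAt_norm_sq y).hasFDerivAt
  have := h.comp_hasFDerivAt y h1
  convert! this using 1
  ext z; simp; ring

/-- Integrate by parts twice in each coordinate direction and sum, using `Δ κ(|y|²) = 4|y|² κ'' + 2n
κ'`. The kernel has compact support, so no growth condition on `h` is needed. -/
theorem integral_radial_mul_laplacian {h : E → ℝ} (hh : ContDiff ℝ 2 h) {κ κ₁ κ₂ : ℝ → ℝ} {V : ℝ}
    (hκ : ∀ v, HasDerivAt κ (κ₁ v) v) (hκ₁ : ∀ v, HasDerivAt κ₁ (κ₂ v) v) (hκ₂ : Continuous κ₂)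
    (h0 : ∀ v, V < v → κ v = 0) :
    ∫ y, κ (‖y‖ ^ 2) * Laplacian.laplacian h y
      = ∫ y, (4 * ‖y‖ ^ 2 * κ₂ (‖y‖ ^ 2) + 2 * Module.finrank ℝ E * κ₁ (‖y‖ ^ 2)) * h y := by
  set e := stdOrthonormalBasis ℝ E
  have h10 := deriv_eq_zero_of_eq_zero_of_lt hκ h0
  have h20 := deriv_eq_zero_of_eq_zero_of_lt hκ₁ h10
  have cκ : Continuous κ := continuous_iff_continuousAt.2 fun v => (hκ v).continuousAt
  have cκ₁ : Continuous κ₁ := continuous_iff_continuousAt.2 fun v => (hκ₁ v).continuousAt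
  have hd1 : ContDiff ℝ 1 (fderiv ℝ h) := hh.fderiv_right (by norm_num)
  have hc0 : Continuous h := hh.continuous
  have hc1 : Continuous (fderiv ℝ h) := hd1.continuous
  have hc2 : Continuous (fderiv ℝ (fderiv ℝ h)) := hd1.continuous_fderiv (by norm_num)
  have hint : ∀ {F : E → ℝ}, Continuous F → (∀ y, V < ‖y‖ ^ 2 → F y = 0) →
      Integrable F := fun hF h0 =>
    hF.integrable_of_hasCompactSupport (hasCompactSupport_of_eq_zero_of_sq_norm h0)
  have fk : ∀ y : E, HasFDerivAt (fun y : E => κ (‖y‖ ^ 2)) ((2 * κ₁ (‖y‖ ^ 2)) • innerSL ℝ y) y :=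
    fun y => hasFDerivAt_comp_sq_norm (hκ _)
  have fk1 : ∀ y : E, HasFDerivAt (fun y : E => κ₁ (‖y‖ ^ 2))
    ((2 * κ₂ (‖y‖ ^ 2)) • innerSL ℝ y) y := fun y => hasFDerivAt_comp_sq_norm (hκ₁ _)
  have fin : ∀ i, ∀ y : E, HasFDerivAt (fun y : E => inner ℝ y (e i)) (innerSL ℝ (e i)) y := by
    intro i y
    have := (innerSL ℝ (e i)).hasFDerivAt (x := y)
    refine this.congr_of_eventuallyEq (Eventually.of_forall fun z => ?_)
    exact real_inner_comm _ _
  have fg : ∀ i, ∀ y : E, HasFDerivAt (fun y : E => 2 * κ₁ (‖y‖ ^ 2) * inner ℝ y (e i))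
      ((2 * κ₁ (‖y‖ ^ 2)) • innerSL ℝ (e i)
        + (inner ℝ y (e i) : ℝ) • ((2 : ℝ) • ((2 * κ₂ (‖y‖ ^ 2)) • innerSL ℝ y))) y :=
    fun i y => ((fk1 y).const_mul 2).mul (fin i y)
  have fh : ∀ i, ∀ y : E, HasFDerivAt (fun y => fderiv ℝ h y (e i))
      ((fderiv ℝ (fderiv ℝ h) y).flip (e i)) y := by
    intro i y
    have := ((hd1.differentiable (by norm_num)) y).hasFDerivAt.clm_apply (hasFDerivAt_const (e i) y)
    simpa using this
  have step : ∀ i, ∫ y, κ (‖y‖ ^ 2) * fderiv ℝ (fderiv ℝ h) y (e i) (e i)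
      = ∫ y, (2 * κ₁ (‖y‖ ^ 2) + 4 * (inner ℝ y (e i)) ^ 2 * κ₂ (‖y‖ ^ 2)) * h y := by
    intro i
    have cin : Continuous fun y : E => (inner ℝ y (e i) : ℝ) := by fun_prop
    have d1 : ∀ y : E, fderiv ℝ (fun y : E => κ (‖y‖ ^ 2)) y (e i)
        = 2 * κ₁ (‖y‖ ^ 2) * inner ℝ y (e i) := fun y => by
      rw [(fk y).fderiv]; simp
    have d2 : ∀ y : E, fderiv ℝ (fun y => fderiv ℝ h y (e i)) y (e i)
        = fderiv ℝ (fderiv ℝ h) y (e i) (e i) := fun y => by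
      rw [(fh i y).fderiv]; simp
    have d3 : ∀ y : E, fderiv ℝ (fun y : E => 2 * κ₁ (‖y‖ ^ 2) * inner ℝ y (e i)) y (e i)
        = 2 * κ₁ (‖y‖ ^ 2) + 4 * (inner ℝ y (e i)) ^ 2 * κ₂ (‖y‖ ^ 2) := fun y => by
      rw [(fg i y).fderiv]; simp; ring
    have A := integral_mul_fderiv_eq_neg_fderiv_mul_of_integrable (μ := (volume : Measure E))
      (f := fun y : E => κ (‖y‖ ^ 2)) (g := fun y => fderiv ℝ h y (e i)) (v := e i)
      (by simp_rw [d1]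
          exact hint (by fun_prop) (fun y hy => by rw [h10 _ hy]; simp))
      (by simp_rw [d2]
          exact hint (by fun_prop) (fun y hy => by rw [h0 _ hy]; simp))
      (hint (by fun_prop) (fun y hy => by rw [h0 _ hy]; simp))
      (fun y _ => (fk y).differentiableAt) (fun y _ => (fh i y).differentiableAt)
    have B := integral_mul_fderiv_eq_neg_fderiv_mul_of_integrable (μ := (volume : Measure E))
      (f := fun y : E => 2 * κ₁ (‖y‖ ^ 2) * inner ℝ y (e i)) (g := h) (v := e i)
      (by simp_rw [d3]
          exact hint (by fun_prop) (fun y hy => by rw [h10 _ hy, h20 _ hy]; simp))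
      (hint (by fun_prop) (fun y hy => by rw [h10 _ hy]; simp))
      (hint (by fun_prop) (fun y hy => by rw [h10 _ hy]; simp))
      (fun y _ => (fg i y).differentiableAt)
      (fun y _ => (hh.differentiable (by norm_num)) y)
    simp_rw [d1, d2] at A
    simp_rw [d3] at B
    rw [A, B, neg_neg]
  have hsum : ∀ y : E, (4 * ‖y‖ ^ 2 * κ₂ (‖y‖ ^ 2) + 2 * Module.finrank ℝ E * κ₁ (‖y‖ ^ 2)) * h y
      = ∑ i, (2 * κ₁ (‖y‖ ^ 2) + 4 * (inner ℝ y (e i)) ^ 2 * κ₂ (‖y‖ ^ 2)) * h y := by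
    intro y
    rw [← Finset.sum_mul, Finset.sum_add_distrib, Finset.sum_const, ← Finset.sum_mul,
      ← Finset.mul_sum, e.sum_sq_inner_left]
    simp only [Finset.card_univ, Fintype.card_fin, nsmul_eq_mul]; ring
  simp_rw [laplacian_eq_sum_fderiv, Finset.mul_sum, hsum]
  rw [integral_finsetSum, integral_finsetSum]
  · exact Finset.sum_congr rfl fun i _ => step i
  · intro i _
    exact hint (by fun_prop) (fun y hy => by rw [h10 _ hy, h20 _ hy]; simp)
  · intro i _
    exact hint (by fun_prop) (fun y hy => by rw [h0 _ hy]; simp)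

end RadialIntegrationByParts

/-! ### Pairing backward heat solutions with compactly supported kernels -/

section BackwardHeat

set_option linter.unusedSectionVars false

variable {E : Type*} [NormedAddCommGroup E] [InnerProductSpace ℝ E] [FiniteDimensional ℝ E]
  [MeasurableSpace E] [BorelSpace E]

/-- Nonnegative classical solutions of `∂_ρ h = -½ Δ h` on `(a, S) × E`. -/
structure IsBackwardHeat (h : ℝ → E → ℝ) (a S : ℝ) : Prop where
  nonneg : ∀ ρ ∈ Ioo a S, ∀ y, 0 ≤ h ρ y
  contDiff : ∀ ρ ∈ Ioo a S, ContDiff ℝ 2 (h ρ)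
  cont : ContinuousOn (fun z : ℝ × E => h z.1 z.2) (Ioo a S ×ˢ univ)
  contLap : ContinuousOn (fun z : ℝ × E => Laplacian.laplacian (h z.1) z.2) (Ioo a S ×ˢ univ)
  deriv : ∀ ρ ∈ Ioo a S, ∀ y,
    HasDerivAt (fun r => h r y) (-(1 / 2) * Laplacian.laplacian (h ρ) y) ρ

/-- A smooth kernel `κ(t, |y|²)`, `t > 0`, with locally uniformly compact support; `κt`, `κ₁`, `κ₂`
are its derivatives in `t` and its first two derivatives in the second variable. -/
structure IsRadialKernel (κ κt κ₁ κ₂ : ℝ → ℝ → ℝ) : Prop where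
  derivTime : ∀ t, 0 < t → ∀ v, HasDerivAt (fun r => κ r v) (κt t v) t
  deriv₁ : ∀ t, 0 < t → ∀ v, HasDerivAt (κ t) (κ₁ t v) v
  deriv₂ : ∀ t, 0 < t → ∀ v, HasDerivAt (κ₁ t) (κ₂ t v) v
  cont : ContinuousOn (fun z : ℝ × ℝ => κ z.1 z.2) (Ioi 0 ×ˢ univ)
  contTime : ContinuousOn (fun z : ℝ × ℝ => κt z.1 z.2) (Ioi 0 ×ˢ univ)
  cont₂ : ContinuousOn (fun z : ℝ × ℝ => κ₂ z.1 z.2) (Ioi 0 ×ˢ univ)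
  supp : ∀ t₀, 0 < t₀ → ∃ V, ∀ t ∈ Ioo (t₀ / 2) (2 * t₀), ∀ v, V < v → κ t v = 0

theorem ContinuousOn.continuous_slice {X Y Z : Type*} [TopologicalSpace X] [TopologicalSpace Y]
    [TopologicalSpace Z] {f : X → Y → Z} {s : Set X}
    (h : ContinuousOn (fun z : X × Y => f z.1 z.2) (s ×ˢ univ)) {x : X} (hx : x ∈ s) :
    Continuous (f x) :=
  h.comp_continuous (f := fun y => (x, y)) (by fun_prop) (fun y => ⟨hx, mem_univ _⟩)

/-- Differentiating under the integral and moving the Laplacian across gives the pairing of `h` with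
`(∂_t - ½Δ)κ`. This factor vanishes for the heat kernel and has a sign for the convex truncation. -/
theorem IsBackwardHeat.hasDerivAt_pairing {h : ℝ → E → ℝ} {a S : ℝ} (hh : IsBackwardHeat h a S)
    {κ κt κ₁ κ₂ : ℝ → ℝ → ℝ} (hκ : IsRadialKernel κ κt κ₁ κ₂) {b ρ : ℝ} (hρ : ρ ∈ Ioo a S)
    (hb : b < ρ) :
    HasDerivAt (fun r => ∫ y, κ (r - b) (‖y‖ ^ 2) * h r y)
      (∫ y, (κt (ρ - b) (‖y‖ ^ 2) - 2 * ‖y‖ ^ 2 * κ₂ (ρ - b) (‖y‖ ^ 2)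
        - Module.finrank ℝ E * κ₁ (ρ - b) (‖y‖ ^ 2)) * h ρ y) ρ := by
  have ht0 : 0 < ρ - b := by linarith
  obtain ⟨V, hV⟩ := hκ.supp _ ht0
  have hO : Ioo a S ∩ Ioo (b + (ρ - b) / 2) (b + 2 * (ρ - b)) ∈ 𝓝 ρ :=
    inter_mem (Ioo_mem_nhds hρ.1 hρ.2) (Ioo_mem_nhds (by linarith) (by linarith))
  obtain ⟨ε, hε, hball⟩ := Metric.nhds_basis_closedBall.mem_iff.1 hO
  have hsub : ∀ r ∈ Metric.closedBall ρ ε, r ∈ Ioo a S ∧ r - b ∈ Ioo ((ρ - b) / 2) (2 * (ρ - b)) :=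
    fun r hr => ⟨(hball hr).1, by linarith [(hball hr).2.1], by linarith [(hball hr).2.2]⟩
  have hpos : ∀ r ∈ Metric.closedBall ρ ε, 0 < r - b := fun r hr => by
    linarith [(hsub r hr).2.1]
  have hV' : ∀ r ∈ Metric.closedBall ρ ε, ∀ v, V < v → κ (r - b) v = 0 := fun r hr v hv =>
    hV _ (hsub r hr).2 v hv
  have hVt : ∀ r ∈ Metric.closedBall ρ ε, ∀ v, V < v → κt (r - b) v = 0 := by
    intro r hr v hv
    have h1 : (fun t => κ t v) =ᶠ[𝓝 (r - b)] fun _ => 0 := by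
      filter_upwards [Ioo_mem_nhds (hsub r hr).2.1 (hsub r hr).2.2] with t ht using hV t ht v hv
    exact (hκ.derivTime _ (hpos r hr) v).unique
      ((hasDerivAt_const _ (0 : ℝ)).congr_of_eventuallyEq h1)
  let F' : ℝ → E → ℝ := fun r y => κt (r - b) (‖y‖ ^ 2) * h r y
    + κ (r - b) (‖y‖ ^ 2) * (-(1 / 2) * Laplacian.laplacian (h r) y)
  have hmap : ContinuousOn (fun z : ℝ × E => (z.1 - b, ‖z.2‖ ^ 2))
      (Metric.closedBall ρ ε ×ˢ univ) := by fun_prop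
  have hmaps : MapsTo (fun z : ℝ × E => (z.1 - b, ‖z.2‖ ^ 2)) (Metric.closedBall ρ ε ×ˢ univ)
      (Ioi 0 ×ˢ univ) := fun z hz => ⟨hpos _ hz.1, mem_univ _⟩
  have hsubset : Metric.closedBall ρ ε ×ˢ (univ : Set E) ⊆ Ioo a S ×ˢ univ :=
    fun z hz => ⟨(hsub _ hz.1).1, mem_univ _⟩
  have cF : ContinuousOn (fun z : ℝ × E => κ (z.1 - b) (‖z.2‖ ^ 2) * h z.1 z.2)
      (Metric.closedBall ρ ε ×ˢ univ) := (hκ.cont.comp hmap hmaps).mul (hh.cont.mono hsubset)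
  have cF' : ContinuousOn (fun z : ℝ × E => F' z.1 z.2) (Metric.closedBall ρ ε ×ˢ univ) :=
    ((hκ.contTime.comp hmap hmaps).mul (hh.cont.mono hsubset)).add
      ((hκ.cont.comp hmap hmaps).mul (continuousOn_const.mul (hh.contLap.mono hsubset)))
  have hρm : ρ ∈ Metric.closedBall ρ ε := Metric.mem_closedBall_self hε.le
  obtain ⟨C, hC⟩ := ((isCompact_closedBall ρ ε).prod (isCompact_closedBall (0 : E)
    (Real.sqrt V))).exists_bound_of_continuousOn (cF'.mono (prod_mono_right (subset_univ _)))
  have hkey := hasDerivAt_integral_of_dominated_loc_of_deriv_le (μ := (volume : Measure E))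
    (F := fun r y => κ (r - b) (‖y‖ ^ 2) * h r y) (F' := F') (x₀ := ρ)
    (bound := (Metric.closedBall (0 : E) (Real.sqrt V)).indicator fun _ => C)
    (Metric.closedBall_mem_nhds ρ hε) (by
      filter_upwards [Metric.closedBall_mem_nhds ρ hε] with r hr
      exact (ContinuousOn.continuous_slice (f := fun r y => κ (r - b) (‖y‖ ^ 2) * h r y)
        cF hr).aestronglyMeasurable)
    ((ContinuousOn.continuous_slice (f := fun r y => κ (r - b) (‖y‖ ^ 2) * h r y)
        cF hρm).integrable_of_hasCompactSupport (hasCompactSupport_of_eq_zero_of_sq_norm (V := V)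
          fun y hy => by rw [hV' ρ hρm _ hy, zero_mul]))
    (cF'.continuous_slice hρm).aestronglyMeasurable
    (Eventually.of_forall fun y r hr => by
      by_cases hy : y ∈ Metric.closedBall (0 : E) (Real.sqrt V)
      · rw [indicator_of_mem hy]; exact hC (r, y) ⟨hr, hy⟩
      · rw [indicator_of_notMem hy]
        simp only [Metric.mem_closedBall, dist_zero_right, not_le] at hy
        have hy' := (Real.sqrt_lt' ((Real.sqrt_nonneg V).trans_lt hy)).1 hy
        simp only [F', hV' r hr _ hy', hVt r hr _ hy']
        simp)
    (by
      rw [integrable_indicator_iff Metric.isClosed_closedBall.measurableSet]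
      exact integrableOn_const (isCompact_closedBall (0 : E) _).measure_lt_top.ne)
    (Eventually.of_forall fun y r hr => by
      have h1 : HasDerivAt (fun r => κ (r - b) (‖y‖ ^ 2)) (κt (r - b) (‖y‖ ^ 2)) r := by
        have := (hκ.derivTime (r - b) (hpos r hr) (‖y‖ ^ 2)).comp r ((hasDerivAt_id r).sub_const b)
        rw [mul_one] at this
        exact this
      exact h1.mul (hh.deriv r (hsub r hr).1 y))
  refine hkey.2.congr_deriv ?_
  have hcd := hh.contDiff ρ hρ
  have ch : Continuous (h ρ) := hcd.continuous
  have cL : Continuous (fun y => Laplacian.laplacian (h ρ) y) :=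
    ContinuousOn.continuous_slice (f := fun ρ y => Laplacian.laplacian (h ρ) y) hh.contLap hρ
  have cκ : Continuous (κ (ρ - b)) := hκ.cont.continuous_slice ht0
  have cκt : Continuous (κt (ρ - b)) := hκ.contTime.continuous_slice ht0
  have cκ₂ : Continuous (κ₂ (ρ - b)) := hκ.cont₂.continuous_slice ht0
  have cκ₁ : Continuous (κ₁ (ρ - b)) :=
    continuous_iff_continuousAt.2 fun v => (hκ.deriv₂ _ ht0 v).continuousAt
  have z0 := hV' ρ hρm
  have z1 := deriv_eq_zero_of_eq_zero_of_lt (hκ.deriv₁ _ ht0) z0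
  have z2 := deriv_eq_zero_of_eq_zero_of_lt (hκ.deriv₂ _ ht0) z1
  have zt := hVt ρ hρm
  have ibp := integral_radial_mul_laplacian hcd (hκ.deriv₁ _ ht0) (hκ.deriv₂ _ ht0) cκ₂ z0
  have i1 : Integrable fun y => κt (ρ - b) (‖y‖ ^ 2) * h ρ y :=
    (by fun_prop : Continuous fun y => κt (ρ - b) (‖y‖ ^ 2) * h ρ y).integrable_of_hasCompactSupport
      (hasCompactSupport_of_eq_zero_of_sq_norm (V := V) fun y hy => by rw [zt _ hy, zero_mul])
  have i2 : Integrable fun y => κ (ρ - b) (‖y‖ ^ 2) * Laplacian.laplacian (h ρ) y :=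
    (by fun_prop : Continuous fun y => κ (ρ - b) (‖y‖ ^ 2)
      * Laplacian.laplacian (h ρ) y).integrable_of_hasCompactSupport
      (hasCompactSupport_of_eq_zero_of_sq_norm (V := V) fun y hy => by rw [z0 _ hy, zero_mul])
  have i3 : Integrable fun y => (4 * ‖y‖ ^ 2 * κ₂ (ρ - b) (‖y‖ ^ 2)
      + 2 * Module.finrank ℝ E * κ₁ (ρ - b) (‖y‖ ^ 2)) * h ρ y :=
    (by fun_prop : Continuous fun y => (4 * ‖y‖ ^ 2 * κ₂ (ρ - b) (‖y‖ ^ 2)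
      + 2 * Module.finrank ℝ E * κ₁ (ρ - b) (‖y‖ ^ 2)) * h ρ y).integrable_of_hasCompactSupport
      (hasCompactSupport_of_eq_zero_of_sq_norm (V := V) fun y hy => by
        rw [z1 _ hy, z2 _ hy]; simp)
  have e1 : ∀ y, F' ρ y = κt (ρ - b) (‖y‖ ^ 2) * h ρ y
      + -(1 / 2) * (κ (ρ - b) (‖y‖ ^ 2) * Laplacian.laplacian (h ρ) y) := fun y => by
    simp only [F']; ring
  have e2 : ∀ y, (κt (ρ - b) (‖y‖ ^ 2) - 2 * ‖y‖ ^ 2 * κ₂ (ρ - b) (‖y‖ ^ 2)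
        - Module.finrank ℝ E * κ₁ (ρ - b) (‖y‖ ^ 2)) * h ρ y
      = κt (ρ - b) (‖y‖ ^ 2) * h ρ y + -(1 / 2) * ((4 * ‖y‖ ^ 2 * κ₂ (ρ - b) (‖y‖ ^ 2)
      + 2 * Module.finrank ℝ E * κ₁ (ρ - b) (‖y‖ ^ 2)) * h ρ y) := fun y => by ring
  simp_rw [e1, e2]
  rw [integral_add i1 (i2.const_mul _), integral_add i1 (i3.const_mul _), integral_const_mul,
    integral_const_mul, ibp]

end BackwardHeat

/-! ### Heat kernel calculus, convex truncation and cutoffs -/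

section HeatKernel

theorem hasDerivAt_heatKer_right (n : ℕ) (t v : ℝ) :
    HasDerivAt (heatKer n t) (-(1 / (2 * t)) * heatKer n t v) v := by
  have h1 : HasDerivAt (fun v : ℝ => -v / (2 * t)) (-1 / (2 * t)) v :=
    (hasDerivAt_neg v).div_const _
  have := (h1.exp).const_mul ((2 * Real.pi * t) ^ (-(n / 2 : ℝ)))
  refine this.congr_deriv ?_
  unfold heatKer; ring

theorem hasDerivAt_heatKer_left (n : ℕ) {t : ℝ} (ht : 0 < t) (v : ℝ) :
    HasDerivAt (fun t => heatKer n t v)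
      ((v / (2 * t ^ 2) - n / (2 * t)) * heatKer n t v) t := by
  have h1 : HasDerivAt (fun t : ℝ => -v / (2 * t)) (v / (2 * t ^ 2)) t := by
    have := (((hasDerivAt_id t).const_mul (2 : ℝ)).inv (by simpa using ht.ne')).const_mul (-v)
    refine this.congr_deriv ?_
    simp only [id, mul_one]
    field_simp
  have h2 : HasDerivAt (fun t : ℝ => (2 * Real.pi * t) ^ (-(n / 2 : ℝ)))
      (-(n / (2 * t)) * (2 * Real.pi * t) ^ (-(n / 2 : ℝ))) t := by
    have h3 : HasDerivAt (fun t : ℝ => 2 * Real.pi * t) (2 * Real.pi) t := by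
      simpa using (hasDerivAt_id t).const_mul (2 * Real.pi)
    have hpos : 0 < 2 * Real.pi * t := by positivity
    refine (h3.rpow_const (p := -(n / 2 : ℝ)) (Or.inl hpos.ne')).congr_deriv ?_
    rw [Real.rpow_sub_one hpos.ne']
    field_simp
  refine (h2.mul h1.exp).congr_deriv ?_
  unfold heatKer; ring

theorem continuousOn_heatKer (n : ℕ) :
    ContinuousOn (fun z : ℝ × ℝ => heatKer n z.1 z.2) (Ioi 0 ×ˢ univ) := by
  have h1 : ContinuousOn (fun z : ℝ × ℝ => -z.2 / (2 * z.1)) (Ioi 0 ×ˢ univ) :=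
    ContinuousOn.div (by fun_prop) (by fun_prop) fun z hz => by
      have : 0 < z.1 := hz.1
      positivity
  unfold heatKer
  refine ContinuousOn.mul (ContinuousOn.rpow_const (by fun_prop) fun z hz => Or.inl ?_) h1.rexp
  have : 0 < z.1 := hz.1
  positivity

theorem heatKer_antitone (n : ℕ) {t : ℝ} (ht : 0 < t) {v w : ℝ} (h : v ≤ w) :
    heatKer n t w ≤ heatKer n t v := by
  unfold heatKer
  gcongr

theorem hasDerivAt_comp_max_zero {f f' : ℝ → ℝ} (hf : ∀ x, HasDerivAt f (f' x) x) (h0 : f' 0 = 0)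
    (x : ℝ) : HasDerivAt (fun x => f (max x 0)) (f' (max x 0)) x := by
  rcases lt_trichotomy x 0 with h | rfl | h
  · rw [max_eq_right h.le, h0]
    refine (hasDerivAt_const x (f 0)).congr_of_eventuallyEq ?_
    filter_upwards [Iio_mem_nhds h] with y hy
    rw [max_eq_right (le_of_lt hy)]
  · rw [max_self]
    have h1 : HasDerivWithinAt (fun x => f (max x 0)) (f' 0) (Ici 0) 0 :=
      (hf 0).hasDerivWithinAt.congr (fun y hy => by rw [max_eq_left hy]) (by simp)
    have h2 : HasDerivWithinAt (fun x => f (max x 0)) (f' 0) (Iic 0) 0 := by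
      rw [h0]
      exact (hasDerivWithinAt_const (0 : ℝ) (Iic 0) (f 0)).congr
        (fun y hy => by rw [max_eq_right hy]) (by simp)
    have := h2.union h1
    rw [Iic_union_Ici] at this
    exact hasDerivWithinAt_univ.1 this
  · rw [max_eq_left h.le]
    refine (hf x).congr_of_eventuallyEq ?_
    filter_upwards [Ioi_mem_nhds h] with y hy
    rw [max_eq_left (le_of_lt hy)]

/-- A `C²` convex truncation of the identity, vanishing on `(-∞, δ]`. -/
noncomputable def convexTrunc (δ g : ℝ) : ℝ :=
  δ * (max ((g - δ) / δ) 0 - Real.arctan (max ((g - δ) / δ) 0))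

noncomputable def convexTrunc₁ (δ g : ℝ) : ℝ :=
  1 - 1 / (1 + max ((g - δ) / δ) 0 ^ 2)

noncomputable def convexTrunc₂ (δ g : ℝ) : ℝ :=
  2 * max ((g - δ) / δ) 0 / (1 + max ((g - δ) / δ) 0 ^ 2) ^ 2 / δ

/-- The function `x - arctan x` is convex on `[0, ∞)` and has zero first and second derivatives at
`0`, so composing it with the positive part keeps two continuous derivatives. -/
theorem hasDerivAt_convexTrunc {δ : ℝ} (hδ : 0 < δ) (g : ℝ) :
    HasDerivAt (convexTrunc δ) (convexTrunc₁ δ g) g := by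
  have h1 : ∀ x, HasDerivAt (fun x => x - Real.arctan x) (1 - 1 / (1 + x ^ 2)) x := fun x =>
    (hasDerivAt_id x).sub (Real.hasDerivAt_arctan x)
  have h2 := hasDerivAt_comp_max_zero h1 (by norm_num) ((g - δ) / δ)
  have h3 : HasDerivAt (fun g : ℝ => (g - δ) / δ) (1 / δ) g :=
    ((hasDerivAt_id g).sub_const δ).div_const δ
  refine ((h2.comp g h3).const_mul δ).congr_deriv ?_
  unfold convexTrunc₁
  field_simp

theorem hasDerivAt_convexTrunc₁ {δ : ℝ} (g : ℝ) :
    HasDerivAt (convexTrunc₁ δ) (convexTrunc₂ δ g) g := by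
  have h1 : ∀ x : ℝ, HasDerivAt (fun x : ℝ => 1 - 1 / (1 + x ^ 2)) (2 * x / (1 + x ^ 2) ^ 2) x := by
    intro x
    have hx : (1 : ℝ) + x ^ 2 ≠ 0 := by positivity
    have := (((hasDerivAt_pow 2 x).const_add 1).inv hx).const_sub 1
    simp only [one_div]
    refine this.congr_deriv ?_
    simp
    ring
  have h2 := hasDerivAt_comp_max_zero h1 (by norm_num) ((g - δ) / δ)
  have h3 : HasDerivAt (fun g : ℝ => (g - δ) / δ) (1 / δ) g :=
    ((hasDerivAt_id g).sub_const δ).div_const δ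
  refine (h2.comp g h3).congr_deriv ?_
  unfold convexTrunc₂
  ring

theorem continuous_convexTrunc (δ : ℝ) : Continuous (convexTrunc δ) := by
  unfold convexTrunc
  exact continuous_const.mul ((by fun_prop : Continuous fun g : ℝ => max ((g - δ) / δ) 0).sub
    (Real.continuous_arctan.comp (by fun_prop)))

theorem continuous_convexTrunc₁ (δ : ℝ) : Continuous (convexTrunc₁ δ) :=
  continuous_iff_continuousAt.2 fun g => (hasDerivAt_convexTrunc₁ g).continuousAt

theorem continuous_convexTrunc₂ (δ : ℝ) : Continuous (convexTrunc₂ δ) := by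
  unfold convexTrunc₂
  refine Continuous.div_const (Continuous.div (by fun_prop) (by fun_prop) fun g => ?_) _
  positivity

theorem convexTrunc_eq_zero {δ g : ℝ} (hδ : 0 < δ) (h : g ≤ δ) : convexTrunc δ g = 0 := by
  unfold convexTrunc
  rw [max_eq_right (div_nonpos_of_nonpos_of_nonneg (by linarith) hδ.le)]
  simp

theorem convexTrunc₂_nonneg {δ : ℝ} (hδ : 0 < δ) (g : ℝ) : 0 ≤ convexTrunc₂ δ g := by
  unfold convexTrunc₂
  have : 0 ≤ max ((g - δ) / δ) 0 := le_max_right _ _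
  positivity

theorem convexTrunc_le {δ g : ℝ} (hδ : 0 < δ) (hg : 0 ≤ g) : convexTrunc δ g ≤ g := by
  unfold convexTrunc
  have h1 : 0 ≤ Real.arctan (max ((g - δ) / δ) 0) := Real.arctan_nonneg.2 (le_max_right _ _)
  have h2 : δ * max ((g - δ) / δ) 0 ≤ g := by
    rcases le_total 0 ((g - δ) / δ) with h | h
    · rw [max_eq_left h, mul_div_cancel₀ _ hδ.ne']; linarith
    · rw [max_eq_right h]; simpa using hg
  nlinarith

theorem arctan_le_self {x : ℝ} (hx : 0 ≤ x) : Real.arctan x ≤ x := by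
  have := Real.le_tan (Real.arctan_nonneg.2 hx) (Real.arctan_lt_pi_div_two x)
  rwa [Real.tan_arctan] at this

theorem convexTrunc_nonneg {δ g : ℝ} (hδ : 0 < δ) : 0 ≤ convexTrunc δ g :=
  mul_nonneg hδ.le (sub_nonneg.2 (arctan_le_self (le_max_right _ _)))

/-- The loss is `δ` from the shift and at most `2δ` from the arctangent, since `π / 2 < 2`. -/
theorem sub_le_convexTrunc {δ g : ℝ} (hδ : 0 < δ) : g - 3 * δ ≤ convexTrunc δ g := by
  unfold convexTrunc
  have h1 : Real.arctan (max ((g - δ) / δ) 0) ≤ 2 := by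
    have := Real.arctan_lt_pi_div_two (max ((g - δ) / δ) 0)
    linarith [Real.pi_lt_four]
  have h2 : g - δ ≤ δ * max ((g - δ) / δ) 0 := by
    calc g - δ = δ * ((g - δ) / δ) := by field_simp
      _ ≤ _ := by gcongr; exact le_max_left _ _
  nlinarith

theorem heatKer_le_of_mem {n : ℕ} {t₀ t v : ℝ} (ht₀ : 0 < t₀) (ht : t ∈ Ioo (t₀ / 2) (2 * t₀))
    (hv : 0 ≤ v) :
    heatKer n t v ≤ (Real.pi * t₀) ^ (-(n / 2 : ℝ)) * Real.exp (-v / (4 * t₀)) := by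
  have ht' : 0 < t := by linarith [ht.1]
  unfold heatKer
  have h1 : (2 * Real.pi * t) ^ (-(n / 2 : ℝ)) ≤ (Real.pi * t₀) ^ (-(n / 2 : ℝ)) := by
    refine Real.rpow_le_rpow_of_nonpos (by positivity) ?_ ?_
    · nlinarith [Real.pi_pos, ht.1]
    · have : (0 : ℝ) ≤ n / 2 := by positivity
      linarith
  have h2 : -v / (2 * t) ≤ -v / (4 * t₀) := by
    rw [neg_div, neg_div, neg_le_neg_iff]
    exact div_le_div_of_nonneg_left hv (by positivity) (by linarith [ht.2])
  gcongr

theorem isRadialKernel_convexTrunc_heatKer (n : ℕ) {δ : ℝ} (hδ : 0 < δ) :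
    IsRadialKernel (fun t v => convexTrunc δ (heatKer n t v))
      (fun t v => convexTrunc₁ δ (heatKer n t v) * ((v / (2 * t ^ 2) - n / (2 * t)) * heatKer n t v))
      (fun t v => convexTrunc₁ δ (heatKer n t v) * (-(1 / (2 * t)) * heatKer n t v))
      (fun t v => convexTrunc₂ δ (heatKer n t v) * (-(1 / (2 * t)) * heatKer n t v) ^ 2
        + convexTrunc₁ δ (heatKer n t v) * ((1 / (2 * t)) ^ 2 * heatKer n t v)) where
  derivTime t ht v := (hasDerivAt_convexTrunc hδ _).comp t (hasDerivAt_heatKer_left n ht v)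
  deriv₁ t _ v := (hasDerivAt_convexTrunc hδ _).comp v (hasDerivAt_heatKer_right n t v)
  deriv₂ t _ v := by
    have h1 := (hasDerivAt_convexTrunc₁ (δ := δ) (heatKer n t v)).comp v
      (hasDerivAt_heatKer_right n t v)
    have h2 := (hasDerivAt_heatKer_right n t v).const_mul (-(1 / (2 * t)))
    refine (h1.mul h2).congr_deriv ?_
    simp only [Function.comp]
    ring
  cont := (continuous_convexTrunc δ).comp_continuousOn (continuousOn_heatKer n)
  contTime := by
    refine ((continuous_convexTrunc₁ δ).comp_continuousOn (continuousOn_heatKer n)).mul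
      (ContinuousOn.mul (ContinuousOn.sub ?_ ?_) (continuousOn_heatKer n))
    · refine ContinuousOn.div (by fun_prop) (by fun_prop) fun z hz => ?_
      have : 0 < z.1 := hz.1
      positivity
    · refine ContinuousOn.div (by fun_prop) (by fun_prop) fun z hz => ?_
      have : 0 < z.1 := hz.1
      positivity
  cont₂ := by
    have h1 : ContinuousOn (fun z : ℝ × ℝ => 1 / (2 * z.1)) (Ioi 0 ×ˢ univ) := by
      refine ContinuousOn.div (by fun_prop) (by fun_prop) fun z hz => ?_
      have : 0 < z.1 := hz.1
      positivity
    have h2 := continuousOn_heatKer n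
    exact (((continuous_convexTrunc₂ δ).comp_continuousOn h2).mul ((h1.neg.mul h2).pow 2)).add
      (((continuous_convexTrunc₁ δ).comp_continuousOn h2).mul ((h1.pow 2).mul h2))
  supp t₀ ht₀ := by
    have hlim : Tendsto (fun v : ℝ => (Real.pi * t₀) ^ (-(n / 2 : ℝ)) * Real.exp (-v / (4 * t₀)))
        atTop (𝓝 ((Real.pi * t₀) ^ (-(n / 2 : ℝ)) * 0)) := by
      refine Tendsto.const_mul _ (Real.tendsto_exp_atBot.comp ?_)
      simp_rw [neg_div]
      exact tendsto_neg_atTop_atBot.comp (tendsto_id.atTop_div_const (by positivity))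
    rw [mul_zero] at hlim
    obtain ⟨V, hV⟩ := eventually_atTop.1 ((hlim.eventually (Iio_mem_nhds hδ)).and
      (eventually_ge_atTop 0))
    refine ⟨V, fun t ht v hv => convexTrunc_eq_zero hδ ?_⟩
    exact (heatKer_le_of_mem ht₀ ht (hV v hv.le).2).trans (hV v hv.le).1.le

/-- A smooth cutoff on the line, equal to `1` on `(-∞, 1]` and to `0` on `[2, ∞)`. -/
theorem exists_smooth_cutoff : ∃ (θ θ₁ θ₂ : ℝ → ℝ) (C : ℝ), (∀ x, HasDerivAt θ (θ₁ x) x) ∧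
    (∀ x, HasDerivAt θ₁ (θ₂ x) x) ∧ Continuous θ₂ ∧ (∀ x, 0 ≤ θ x) ∧ (∀ x, θ x ≤ 1) ∧
    (∀ x ≤ 1, θ x = 1) ∧ (∀ x, 2 ≤ x → θ x = 0) ∧ (∀ x, |θ₁ x| ≤ C) ∧ (∀ x, |θ₂ x| ≤ C) ∧
    (∀ x < 1, θ₁ x = 0) ∧ (∀ x < 1, θ₂ x = 0) ∧ (∀ x, 2 < x → θ₁ x = 0) ∧
    (∀ x, 2 < x → θ₂ x = 0) := by
  let θ : ℝ → ℝ := fun x => Real.smoothTransition (2 - x)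
  have hθ : ContDiff ℝ 2 θ := Real.smoothTransition.contDiff.comp (by fun_prop)
  have hθ1 : ContDiff ℝ 1 (deriv θ) := hθ.deriv' 
  have hd1 : ∀ x, HasDerivAt θ (deriv θ x) x := fun x =>
    ((hθ.differentiable (by norm_num)) x).hasDerivAt
  have hd2 : ∀ x, HasDerivAt (deriv θ) (deriv (deriv θ) x) x := fun x =>
    ((hθ1.differentiable (by norm_num)) x).hasDerivAt
  have hc2 : Continuous (deriv (deriv θ)) := hθ1.continuous_deriv (by norm_num)
  have h1 : ∀ x ≤ 1, θ x = 1 := fun x hx => Real.smoothTransition.one_of_one_le (by linarith)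
  have h2 : ∀ x, 2 ≤ x → θ x = 0 := fun x hx => Real.smoothTransition.zero_of_nonpos (by linarith)
  have l1 : ∀ x < 1, deriv θ x = 0 := fun x hx => by
    have : θ =ᶠ[𝓝 x] fun _ => 1 := by
      filter_upwards [Iio_mem_nhds hx] with y hy using h1 y (le_of_lt hy)
    rw [this.deriv_eq]; simp
  have l2 : ∀ x < 1, deriv (deriv θ) x = 0 := fun x hx => by
    have : deriv θ =ᶠ[𝓝 x] fun _ => 0 := by
      filter_upwards [Iio_mem_nhds hx] with y hy using l1 y hy
    rw [this.deriv_eq]; simp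
  have r1 : ∀ x, 2 < x → deriv θ x = 0 :=
    deriv_eq_zero_of_eq_zero_of_lt hd1 fun x hx => h2 x hx.le
  have r2 : ∀ x, 2 < x → deriv (deriv θ) x = 0 := deriv_eq_zero_of_eq_zero_of_lt hd2 r1
  have s : ∀ {f : ℝ → ℝ}, (∀ x < 1, f x = 0) → (∀ x, 2 < x → f x = 0) → HasCompactSupport f :=
    fun {f} hl hr => HasCompactSupport.intro (isCompact_Icc (a := (1 : ℝ)) (b := 2)) fun x hx => by
      rcases lt_or_ge x 1 with h | h
      · exact hl x h
      · exact hr x (by by_contra hcon; exact hx ⟨h, not_lt.1 hcon⟩)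
  obtain ⟨C1, hC1⟩ := (s l1 r1).exists_bound_of_continuous hθ1.continuous
  obtain ⟨C2, hC2⟩ := (s l2 r2).exists_bound_of_continuous hc2
  exact ⟨θ, deriv θ, deriv (deriv θ), max C1 C2, hd1, hd2, hc2,
    fun x => Real.smoothTransition.nonneg _, fun x => Real.smoothTransition.le_one _, h1, h2,
    fun x => (hC1 x).trans (le_max_left _ _), fun x => (hC2 x).trans (le_max_right _ _),
    l1, l2, r1, r2⟩

theorem isRadialKernel_heatKer_mul_cutoff (n : ℕ) {θ θ₁ θ₂ : ℝ → ℝ} {A : ℝ} (hA : 0 < A)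
    (h1 : ∀ x, HasDerivAt θ (θ₁ x) x) (h2 : ∀ x, HasDerivAt θ₁ (θ₂ x) x) (hc : Continuous θ₂)
    (h0 : ∀ x, 2 ≤ x → θ x = 0) :
    IsRadialKernel (fun t v => heatKer n t v * θ (v / A))
      (fun t v => (v / (2 * t ^ 2) - n / (2 * t)) * heatKer n t v * θ (v / A))
      (fun t v => heatKer n t v * (-(1 / (2 * t)) * θ (v / A) + θ₁ (v / A) / A))
      (fun t v => heatKer n t v * ((1 / (2 * t)) ^ 2 * θ (v / A)
        - 2 * (1 / (2 * t)) * (θ₁ (v / A) / A) + θ₂ (v / A) / A ^ 2)) := by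
  have d1 : ∀ v, HasDerivAt (fun v => θ (v / A)) (θ₁ (v / A) / A) v := fun v => by
    refine ((h1 (v / A)).comp v ((hasDerivAt_id v).div_const A)).congr_deriv ?_
    ring
  have d2 : ∀ v, HasDerivAt (fun v => θ₁ (v / A)) (θ₂ (v / A) / A) v := fun v => by
    refine ((h2 (v / A)).comp v ((hasDerivAt_id v).div_const A)).congr_deriv ?_
    ring
  have c0 : Continuous θ := continuous_iff_continuousAt.2 fun v => (h1 v).continuousAt
  have c1 : Continuous θ₁ := continuous_iff_continuousAt.2 fun v => (h2 v).continuousAt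
  have hk := continuousOn_heatKer n
  have hi : ContinuousOn (fun z : ℝ × ℝ => 1 / (2 * z.1)) (Ioi 0 ×ˢ univ) := by
    refine ContinuousOn.div (by fun_prop) (by fun_prop) fun z hz => ?_
    have : 0 < z.1 := hz.1
    positivity
  refine ⟨fun t ht v => (hasDerivAt_heatKer_left n ht v).mul_const _, fun t _ v => ?_,
    fun t _ v => ?_, hk.mul (by fun_prop), ?_, ?_, fun t₀ _ => ⟨2 * A, fun t _ v hv => ?_⟩⟩
  · refine ((hasDerivAt_heatKer_right n t v).mul (d1 v)).congr_deriv ?_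
    ring
  · refine ((hasDerivAt_heatKer_right n t v).mul (((d1 v).const_mul (-(1 / (2 * t)))).add
      ((d2 v).div_const A))).congr_deriv ?_
    simp only [Pi.add_apply]
    ring
  · refine (ContinuousOn.mul (ContinuousOn.sub ?_ ?_) hk).mul (by fun_prop)
    · refine ContinuousOn.div (by fun_prop) (by fun_prop) fun z hz => ?_
      have : 0 < z.1 := hz.1
      positivity
    · refine ContinuousOn.div (by fun_prop) (by fun_prop) fun z hz => ?_
      have : 0 < z.1 := hz.1
      positivity
  · exact hk.mul ((((hi.pow 2).mul (by fun_prop)).sub ((continuousOn_const.mul hi).mul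
      (by fun_prop))).add (by fun_prop))
  · rw [h0 _ (by rw [le_div_iff₀ hA]; exact hv.le), mul_zero]

end HeatKernel

/-! ### Mean value bounds for nonnegative solutions -/

section MeanValueBounds

set_option linter.unusedSectionVars false

variable {E : Type*} [NormedAddCommGroup E] [InnerProductSpace ℝ E] [FiniteDimensional ℝ E]
  [MeasurableSpace E] [BorelSpace E]

theorem exp_neg_le_factorial_div_pow (k : ℕ) {x : ℝ} (hx : 0 < x) :
    Real.exp (-x) ≤ k.factorial / x ^ k := by
  have h := Real.pow_div_factorial_le_exp x hx.le k
  rw [Real.exp_neg, inv_le_comm₀ (Real.exp_pos x) (by positivity), inv_div]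
  exact h

/-- Away from the origin, the heat kernel at small times is dominated by a later heat kernel. -/
theorem exists_heatKer_mul_le (n : ℕ) {S : ℝ} (hS : 0 < S) :
    ∃ K, 0 ≤ K ∧ ∀ A, 1 ≤ A → ∀ t ∈ Ioo 0 S, ∀ v, A ≤ v →
      heatKer n t v * (4 / t + 4 + n) ≤ K / A * heatKer n (t + 1 / 2) v := by
  set B : ℝ := (S + 1) ^ n * (4 + (4 + n) * S)
  set D : ℝ := 2 * (2 * S + 1)
  refine ⟨B * (n + 1).factorial * D ^ (n + 1), by positivity, fun A hA t ht v hv => ?_⟩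
  have ht0 : 0 < t := ht.1
  have hA0 : 0 < A := by linarith
  have hD0 : 0 < D := by positivity
  have hv0 : 0 < v := by linarith
  have e1 : heatKer n t v = heatKer n (t + 1 / 2) v * (((t + 1 / 2) / t) ^ (n / 2 : ℝ)
      * Real.exp (-(v / (2 * t * (2 * t + 1))))) := by
    unfold heatKer
    have h1 : (2 * Real.pi * t) ^ (-(n / 2 : ℝ))
        = (2 * Real.pi * (t + 1 / 2)) ^ (-(n / 2 : ℝ)) * ((t + 1 / 2) / t) ^ (n / 2 : ℝ) := by
      have h2 : 2 * Real.pi * (t + 1 / 2) = (2 * Real.pi * t) * ((t + 1 / 2) / t) := by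
        field_simp
      have h4 : ((t + 1 / 2) / t) ^ (-(n / 2 : ℝ)) * ((t + 1 / 2) / t) ^ (n / 2 : ℝ) = 1 := by
        rw [← Real.rpow_add (by positivity), neg_add_cancel, Real.rpow_zero]
      rw [h2, Real.mul_rpow (x := 2 * Real.pi * t) (y := (t + 1 / 2) / t) (by positivity)
        (by positivity), mul_assoc ((2 * Real.pi * t) ^ _), h4, mul_one]
    have h3 : Real.exp (-v / (2 * t)) = Real.exp (-v / (2 * (t + 1 / 2)))
        * Real.exp (-(v / (2 * t * (2 * t + 1)))) := by
      rw [← Real.exp_add]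
      congr 1
      field_simp
      ring
    rw [h1, h3]; ring
  have e2 : ((t + 1 / 2) / t) ^ (n / 2 : ℝ) ≤ ((S + 1) / t) ^ n := by
    have h1 : 1 ≤ (t + 1 / 2) / t := by rw [le_div_iff₀ ht0]; linarith
    calc ((t + 1 / 2) / t) ^ (n / 2 : ℝ) ≤ ((t + 1 / 2) / t) ^ (n : ℝ) :=
          Real.rpow_le_rpow_of_exponent_le h1 (by
            have : (0 : ℝ) ≤ n := by positivity
            linarith)
      _ = ((t + 1 / 2) / t) ^ n := Real.rpow_natCast _ _
      _ ≤ _ := by gcongr <;> linarith [ht.2]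
  have e3 : 4 / t + 4 + n ≤ (4 + (4 + n) * S) / t := by
    rw [le_div_iff₀ ht0]
    have h1 : (4 / t + 4 + n) * t = 4 + (4 + n) * t := by field_simp; ring
    rw [h1]
    gcongr
    exact ht.2.le
  -- The power `n + 1` is chosen so that `t^{n+1}` cancels the singularities `t^{-n}` of `e2` and
  -- `t^{-1}` of `e3`; a single factor `1 / A` is retained.
  have e4 : Real.exp (-(v / (2 * t * (2 * t + 1)))) ≤ (n + 1).factorial * (D * t) ^ (n + 1) / A := by
    have hx : A / (D * t) ≤ v / (2 * t * (2 * t + 1)) := by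
      apply div_le_div₀ hv0.le hv (by positivity)
      have : 2 * t * (2 * t + 1) = 2 * (2 * t + 1) * t := by ring
      rw [this]
      simp only [D]
      gcongr
      exact ht.2.le
    calc Real.exp (-(v / (2 * t * (2 * t + 1)))) ≤ Real.exp (-(A / (D * t))) := by gcongr
      _ ≤ (n + 1).factorial / (A / (D * t)) ^ (n + 1) :=
          exp_neg_le_factorial_div_pow _ (by positivity)
      _ = (n + 1).factorial * (D * t) ^ (n + 1) / A ^ (n + 1) := by
          rw [div_pow]; field_simp
      _ ≤ _ := by
          gcongr
          exact le_self_pow₀ hA (by omega)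
  have hG := heatKer_pos (n := n) (by linarith : 0 < t + 1 / 2) v
  calc heatKer n t v * (4 / t + 4 + n)
      = heatKer n (t + 1 / 2) v * (((t + 1 / 2) / t) ^ (n / 2 : ℝ)
        * Real.exp (-(v / (2 * t * (2 * t + 1)))) * (4 / t + 4 + n)) := by rw [e1]; ring
    _ ≤ heatKer n (t + 1 / 2) v * (((S + 1) / t) ^ n
        * ((n + 1).factorial * (D * t) ^ (n + 1) / A) * ((4 + (4 + n) * S) / t)) := by
        gcongr
    _ = _ := by
        simp only [B]
        rw [div_pow, mul_pow]
        field_simp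
        ring

theorem tendsto_heatKer_nhdsGT_zero (n : ℕ) {v : ℝ} (hv : 0 < v) :
    Tendsto (fun t => heatKer n t v) (𝓝[>] 0) (𝓝 0) := by
  set c : ℝ := (n + 1).factorial * (2 / v) ^ (n + 1)
  have hlim : Tendsto (fun t : ℝ => c * t) (𝓝[>] 0) (𝓝 0) := by
    have : Tendsto (fun t : ℝ => c * t) (𝓝 0) (𝓝 (c * 0)) := tendsto_id.const_mul c
    rw [mul_zero] at this
    exact this.mono_left nhdsWithin_le_nhds
  refine squeeze_zero' ?_ ?_ hlim
  · filter_upwards [self_mem_nhdsWithin] with t ht using (heatKer_pos ht v).le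
  · filter_upwards [Ioo_mem_nhdsGT (zero_lt_one : (0 : ℝ) < 1)] with t ht
    have ht0 : 0 < t := ht.1
    have h1 : (2 * Real.pi * t) ^ (-(n / 2 : ℝ)) ≤ (1 / t) ^ n := by
      have h2 : (1 : ℝ) ≤ 1 / t := by rw [le_div_iff₀ ht0]; linarith [ht.2]
      calc (2 * Real.pi * t) ^ (-(n / 2 : ℝ)) ≤ t ^ (-(n / 2 : ℝ)) := by
            refine Real.rpow_le_rpow_of_nonpos ht0 ?_ ?_
            · nlinarith [Real.pi_gt_three]
            · have : (0 : ℝ) ≤ n / 2 := by positivity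
              linarith
        _ = (1 / t) ^ (n / 2 : ℝ) := by
            rw [one_div, Real.inv_rpow ht0.le, Real.rpow_neg ht0.le]
        _ ≤ (1 / t) ^ (n : ℝ) := Real.rpow_le_rpow_of_exponent_le h2 (by
            have : (0 : ℝ) ≤ n := by positivity
            linarith)
        _ = _ := Real.rpow_natCast _ _
    have h3 : Real.exp (-v / (2 * t)) ≤ (n + 1).factorial / (v / (2 * t)) ^ (n + 1) := by
      rw [neg_div]
      exact exp_neg_le_factorial_div_pow _ (by positivity)
    calc heatKer n t v ≤ (1 / t) ^ n * ((n + 1).factorial / (v / (2 * t)) ^ (n + 1)) := by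
          unfold heatKer; gcongr
      _ = c * t := by
          simp only [c]
          rw [div_pow, div_pow, div_pow, mul_pow]
          field_simp
          ring

/-- After rescaling, this is a standard Gaussian average of values at `√t • w`, and dominated
convergence applies. The cutoff `η` supplies the domination, since `h` may grow at infinity. -/
theorem tendsto_integral_heatKer_mul_cutoff {h : ℝ → E → ℝ} {a S b V : ℝ}
    (hc : ContinuousOn (fun z : ℝ × E => h z.1 z.2) (Ioo a S ×ˢ univ)) (hb : b ∈ Ioo a S)
    {η : ℝ → ℝ} (hη : Continuous η) (hη1 : η 0 = 1) (hηV : ∀ v, V < v → η v = 0) :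
    Tendsto (fun t => ∫ y, heatKer (Module.finrank ℝ E) t (‖y‖ ^ 2) * η (‖y‖ ^ 2) * h (b + t) y)
      (𝓝[>] 0) (𝓝 (h b 0)) := by
  obtain ⟨c, hbc, hcS⟩ := exists_between hb.2
  have hK : Icc b c ×ˢ (univ : Set E) ⊆ Ioo a S ×ˢ univ :=
    fun z hz => ⟨⟨hb.1.trans_le hz.1.1, hz.1.2.trans_lt hcS⟩, mem_univ _⟩
  have hcont : ContinuousOn (fun z : ℝ × E => η (‖z.2‖ ^ 2) * h z.1 z.2) (Ioo a S ×ˢ univ) :=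
    ContinuousOn.mul (by fun_prop) hc
  obtain ⟨C, hC⟩ := ((isCompact_Icc (a := b) (b := c)).prod (isCompact_closedBall (0 : E)
    (Real.sqrt V))).exists_bound_of_continuousOn
      ((hcont.mono hK).mono (prod_mono_right (subset_univ _)))
  have hbound : ∀ r ∈ Icc b c, ∀ y : E, |η (‖y‖ ^ 2) * h r y| ≤ max C 0 := by
    intro r hr y
    by_cases hy : y ∈ Metric.closedBall (0 : E) (Real.sqrt V)
    · exact (hC (r, y) ⟨hr, hy⟩).trans (le_max_left _ _)
    · simp only [Metric.mem_closedBall, dist_zero_right, not_le] at hy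
      have hy' := (Real.sqrt_lt' ((Real.sqrt_nonneg V).trans_lt hy)).1 hy
      rw [hηV _ hy']; simp
  have hmem : ∀ t ∈ Ioo 0 (c - b), b + t ∈ Icc b c := fun t ht =>
    ⟨by linarith [ht.1], by linarith [ht.2]⟩
  have hev : Ioo 0 (c - b) ∈ 𝓝[>] (0 : ℝ) := Ioo_mem_nhdsGT (by linarith)
  have hlim : Tendsto (fun t => ∫ w, η (‖Real.sqrt t • w‖ ^ 2) * h (b + t) (Real.sqrt t • w)
      ∂(ProbabilityTheory.stdGaussian E)) (𝓝[>] 0)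
      (𝓝 (∫ _, h b 0 ∂(ProbabilityTheory.stdGaussian E))) := by
    refine tendsto_integral_filter_of_dominated_convergence (fun _ => max C 0) ?_ ?_
      (integrable_const _) ?_
    · filter_upwards [hev] with t ht
      have h1 : Continuous fun y => η (‖y‖ ^ 2) * h (b + t) y :=
        ContinuousOn.continuous_slice (f := fun r y => η (‖y‖ ^ 2) * h r y) hcont
          (⟨hb.1.trans_le (hmem t ht).1, (hmem t ht).2.trans_lt hcS⟩ : b + t ∈ Ioo a S)
      exact (h1.comp (by fun_prop : Continuous fun w : E => Real.sqrt t • w)).aestronglyMeasurable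
    · filter_upwards [hev] with t ht
      exact Eventually.of_forall fun w => hbound _ (hmem t ht) _
    · refine Eventually.of_forall fun w => ?_
      have h1 : ContinuousAt (fun z : ℝ × E => η (‖z.2‖ ^ 2) * h z.1 z.2) (b, 0) :=
        hcont.continuousAt ((isOpen_Ioo.prod isOpen_univ).mem_nhds ⟨hb, mem_univ _⟩)
      have h2 : Tendsto (fun t : ℝ => (b + t, Real.sqrt t • w)) (𝓝[>] 0) (𝓝 (b, 0)) := by
        have : Continuous fun t : ℝ => (b + t, Real.sqrt t • w) := by fun_prop
        have h3 := this.tendsto 0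
        simp only [add_zero, Real.sqrt_zero, zero_smul] at h3
        exact h3.mono_left nhdsWithin_le_nhds
      have h4 := h1.tendsto.comp h2
      simpa [hη1, Function.comp_def] using h4
  rw [integral_const, probReal_univ, one_smul] at hlim
  refine hlim.congr' ?_
  filter_upwards [hev] with t ht
  rw [integral_stdGaussian_sqrt_smul ht.1 (fun y => η (‖y‖ ^ 2) * h (b + t) y)]
  simp_rw [mul_assoc]

variable {h : ℝ → E → ℝ} {a S : ℝ}

/-- A convex function of a caloric function is subcaloric: `(∂_t - ½Δ) j(G) = -½ j''(G) |∇G|² ≤ 0`.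
Since `h ≥ 0`, the pairing decreases in `ρ`, and it starts from at most `h b 0`. The bound does not
depend on `δ`, so positivity alone controls Gaussian integrals of `h`. -/
theorem IsBackwardHeat.integral_convexTrunc_le (hh : IsBackwardHeat h a S) {b ρ δ : ℝ}
    (hb : b ∈ Ioo a S) (hρ : ρ ∈ Ioo b S) (hδ : 0 < δ) :
    ∫ y, convexTrunc δ (heatKer (Module.finrank ℝ E) (ρ - b) (‖y‖ ^ 2)) * h ρ y ≤ h b 0 := by
  set n := Module.finrank ℝ E
  have hκ := isRadialKernel_convexTrunc_heatKer n hδ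
  have hmem : ∀ r ∈ Ioo b S, r ∈ Ioo a S := fun r hr => ⟨hb.1.trans hr.1, hr.2⟩
  have hd := fun r (hr : r ∈ Ioo b S) => hh.hasDerivAt_pairing hκ (hmem r hr) hr.1
  have hanti : AntitoneOn (fun r => ∫ y, convexTrunc δ (heatKer n (r - b) (‖y‖ ^ 2)) * h r y)
      (Ioo b S) := by
    refine antitoneOn_of_deriv_nonpos (convex_Ioo b S)
      (fun r hr => (hd r hr).continuousAt.continuousWithinAt)
      (fun r hr => (hd r (interior_subset hr)).differentiableAt.differentiableWithinAt) ?_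
    intro r hr
    have hr' := interior_subset hr
    have hr0 : 0 < r - b := by linarith [hr'.1]
    rw [(hd r hr').deriv]
    refine integral_nonpos fun y => ?_
    refine mul_nonpos_of_nonpos_of_nonneg ?_ (hh.nonneg r (hmem r hr') y)
    set g := heatKer n (r - b) (‖y‖ ^ 2)
    have e : convexTrunc₁ δ g * ((‖y‖ ^ 2 / (2 * (r - b) ^ 2) - n / (2 * (r - b))) * g)
        - 2 * ‖y‖ ^ 2 * (convexTrunc₂ δ g * (-(1 / (2 * (r - b))) * g) ^ 2
          + convexTrunc₁ δ g * ((1 / (2 * (r - b))) ^ 2 * g))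
        - n * (convexTrunc₁ δ g * (-(1 / (2 * (r - b))) * g))
        = -(2 * ‖y‖ ^ 2 * (convexTrunc₂ δ g * (-(1 / (2 * (r - b))) * g) ^ 2)) := by
      field_simp
      ring
    rw [e, neg_nonpos]
    have := convexTrunc₂_nonneg hδ g
    positivity
  obtain ⟨θ, θ₁, θ₂, C, h1, -, -, hθ0, -, hθl, hθr, -⟩ := exists_smooth_cutoff
  have hθc : Continuous θ := continuous_iff_continuousAt.2 fun v => (h1 v).continuousAt
  refine ge_of_tendsto (tendsto_integral_heatKer_mul_cutoff (V := 2) hh.cont hb hθc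
    (hθl 0 zero_le_one) fun v hv => hθr v hv.le) ?_
  -- Close to `b` the kernel is below `δ` where `|y|² ≥ 1`, so its truncation vanishes there and
  -- lies under the kernel times a fixed cutoff.
  filter_upwards [Ioo_mem_nhdsGT (by linarith [hρ.1] : 0 < ρ - b),
    (tendsto_heatKer_nhdsGT_zero n zero_lt_one).eventually (Iio_mem_nhds hδ)] with t ht hsmall
  have ht0 : 0 < t := ht.1
  have hbt : b + t ∈ Ioo b S := ⟨by linarith, by linarith [ht.2, hρ.2]⟩
  have h2 := hanti hbt hρ (by linarith [ht.2])
  refine h2.trans ?_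
  have e : b + t - b = t := by ring
  simp only [e]
  have ch : Continuous (h (b + t)) := (hh.contDiff _ (hmem _ hbt)).continuous
  have ck : Continuous (heatKer n t) := (continuousOn_heatKer n).continuous_slice ht0
  have ckt : Continuous (fun y : E => convexTrunc δ (heatKer n t (‖y‖ ^ 2))) :=
    (continuous_convexTrunc δ).comp (by fun_prop)
  have hle : ∀ y : E, convexTrunc δ (heatKer n t (‖y‖ ^ 2))
      ≤ heatKer n t (‖y‖ ^ 2) * θ (‖y‖ ^ 2) := by
    intro y
    rcases le_total (‖y‖ ^ 2) 1 with hy | hy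
    · rw [hθl _ hy, mul_one]
      exact convexTrunc_le hδ (heatKer_pos ht0 _).le
    · rw [convexTrunc_eq_zero hδ ((heatKer_antitone n ht0 hy).trans (le_of_lt hsmall))]
      exact mul_nonneg (heatKer_pos ht0 _).le (hθ0 _)
  have hz : ∀ y : E, 2 < ‖y‖ ^ 2 → heatKer n t (‖y‖ ^ 2) * θ (‖y‖ ^ 2) = 0 := fun y hy => by
    rw [hθr _ hy.le, mul_zero]
  refine integral_mono ?_ ?_ fun y =>
    mul_le_mul_of_nonneg_right (hle y) (hh.nonneg _ (hmem _ hbt) y)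
  · refine (ckt.mul ch).integrable_of_hasCompactSupport
      (hasCompactSupport_of_eq_zero_of_sq_norm (V := 2) fun y hy => ?_)
    have := (hle y).trans (hz y hy).le
    rw [Pi.mul_apply, le_antisymm this (convexTrunc_nonneg hδ), zero_mul]
  · exact (by fun_prop : Continuous fun y : E => heatKer n t (‖y‖ ^ 2) * θ (‖y‖ ^ 2)
      * h (b + t) y).integrable_of_hasCompactSupport
      (hasCompactSupport_of_eq_zero_of_sq_norm (V := 2) fun y hy => by rw [hz y hy, zero_mul])

/-- A nonnegative solution pairs with the truncated heat kernel to almost a constant, with an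
error that vanishes as the truncation is removed. -/
theorem IsBackwardHeat.exists_abs_pairing_sub_le (hh : IsBackwardHeat h (-1) S) (hS : 0 < S)
    {θ θ₁ θ₂ : ℝ → ℝ} {C : ℝ} (h1 : ∀ x, HasDerivAt θ (θ₁ x) x)
    (h2 : ∀ x, HasDerivAt θ₁ (θ₂ x) x) (hc : Continuous θ₂) (hθl : ∀ x ≤ 1, θ x = 1)
    (hθr : ∀ x, 2 ≤ x → θ x = 0) (hC₁ : ∀ x, |θ₁ x| ≤ C) (hC₂ : ∀ x, |θ₂ x| ≤ C)
    (l1 : ∀ x < 1, θ₁ x = 0) (l2 : ∀ x < 1, θ₂ x = 0)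
    (r1 : ∀ x, 2 < x → θ₁ x = 0) (r2 : ∀ x, 2 < x → θ₂ x = 0) :
    ∃ K, ∀ A, 1 ≤ A → ∀ ρ ∈ Ioo 0 S,
      |(∫ y, heatKer (Module.finrank ℝ E) ρ (‖y‖ ^ 2) * θ (‖y‖ ^ 2 / A) * h ρ y) - h 0 0|
        ≤ K / A := by
  set n := Module.finrank ℝ E
  obtain ⟨K, hK0, hK⟩ := exists_heatKer_mul_le n hS
  have hC0 : 0 ≤ C := (abs_nonneg _).trans (hC₁ 0)
  -- The base point precedes `0` so that the kernel at time `r + 1/2` dominates the one at time `r`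
  -- far from the origin; its pairing with `h r` is controlled by `h (-1/2) 0`, the solution at a
  -- time later than `T`.
  have hhalf : (-(1 / 2) : ℝ) ∈ Ioo (-1) S := ⟨by norm_num, by linarith⟩
  have hh0 : 0 ≤ h (-(1 / 2)) 0 := hh.nonneg _ hhalf 0
  refine ⟨C * K * 2 * h (-(1 / 2)) 0 * S, fun A hA => ?_⟩
  have hA0 : 0 < A := by linarith
  have hκ := isRadialKernel_heatKer_mul_cutoff n hA0 h1 h2 hc hθr
  have hmem : ∀ r ∈ Ioo 0 S, r ∈ Ioo (-1) S := fun r hr => ⟨by linarith [hr.1], hr.2⟩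
  set I : ℝ → ℝ := fun r => ∫ y, heatKer n r (‖y‖ ^ 2) * θ (‖y‖ ^ 2 / A) * h r y with hI
  set I' : ℝ → ℝ := fun r => ∫ y, heatKer n r (‖y‖ ^ 2) * (2 * ‖y‖ ^ 2 / r * (θ₁ (‖y‖ ^ 2 / A) / A)
      - 2 * ‖y‖ ^ 2 * (θ₂ (‖y‖ ^ 2 / A) / A ^ 2) - n * (θ₁ (‖y‖ ^ 2 / A) / A)) * h r y
  have hd : ∀ r ∈ Ioo 0 S, HasDerivAt I (I' r) r := by
    intro r hr
    have hr0 : r ≠ 0 := hr.1.ne'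
    have := hh.hasDerivAt_pairing hκ (b := 0) (hmem r hr) hr.1
    simp only [sub_zero] at this
    refine this.congr_deriv ?_
    refine integral_congr_ae (Eventually.of_forall fun y => ?_)
    dsimp only
    congr 1
    field_simp
    ring
  have hI' : ∀ r ∈ Ioo 0 S, ‖I' r‖ ≤ C * K / A * 2 * h (-(1 / 2)) 0 := by
    intro r hr
    have hr0 : 0 < r := hr.1
    have hr2 : 0 < r + 1 / 2 := by linarith
    -- On `|y|² ≤ 2A` the later kernel is at least `6δ`, so losing `3δ` in the truncation costs at
    -- most a factor `2`.
    set δ := heatKer n (r + 1 / 2) (2 * A) / 6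
    have hδ : 0 < δ := by
      have := heatKer_pos (n := n) hr2 (2 * A)
      positivity
    have htr := hh.integral_convexTrunc_le hhalf (ρ := r) ⟨by linarith, hr.2⟩ hδ
    have er : r - -(1 / 2) = r + 1 / 2 := by ring
    rw [er] at htr
    have hint : Integrable fun y : E =>
        convexTrunc δ (heatKer n (r + 1 / 2) (‖y‖ ^ 2)) * h r y := by
      obtain ⟨V, hV⟩ := (isRadialKernel_convexTrunc_heatKer n hδ).supp _ hr2
      have ck : Continuous (heatKer n (r + 1 / 2)) := (continuousOn_heatKer n).continuous_slice hr2
      have ckt : Continuous (fun y : E => convexTrunc δ (heatKer n (r + 1 / 2) (‖y‖ ^ 2))) :=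
        (continuous_convexTrunc δ).comp (by fun_prop)
      refine (ckt.mul (hh.contDiff _ (hmem r hr)).continuous).integrable_of_hasCompactSupport
        (hasCompactSupport_of_eq_zero_of_sq_norm (V := V) fun y hy => ?_)
      rw [Pi.mul_apply, hV (r + 1 / 2) ⟨by linarith, by linarith⟩ _ hy, zero_mul]
    have hpt : ∀ y : E, ‖heatKer n r (‖y‖ ^ 2) * (2 * ‖y‖ ^ 2 / r * (θ₁ (‖y‖ ^ 2 / A) / A)
        - 2 * ‖y‖ ^ 2 * (θ₂ (‖y‖ ^ 2 / A) / A ^ 2) - n * (θ₁ (‖y‖ ^ 2 / A) / A)) * h r y‖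
        ≤ C * K / A * 2 * (convexTrunc δ (heatKer n (r + 1 / 2) (‖y‖ ^ 2)) * h r y) := by
      intro y
      have hhy := hh.nonneg _ (hmem r hr) y
      have hct : 0 ≤ convexTrunc δ (heatKer n (r + 1 / 2) (‖y‖ ^ 2)) := convexTrunc_nonneg hδ
      set v := ‖y‖ ^ 2
      have hrhs : 0 ≤ C * K / A * 2 * (convexTrunc δ (heatKer n (r + 1 / 2) v) * h r y) := by
        positivity
      rcases lt_or_ge (v / A) 1 with hv | hv
      · rw [l1 _ hv, l2 _ hv]; simpa using hrhs
      rcases lt_or_ge 2 (v / A) with hv' | hv'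
      · rw [r1 _ hv', r2 _ hv']; simpa using hrhs
      have hvA : A ≤ v := by rwa [le_div_iff₀ hA0, one_mul] at hv
      have hv2A : v ≤ 2 * A := by rwa [div_le_iff₀ hA0] at hv'
      have hv0 : 0 < v := by linarith
      have b1 : |2 * v / r * (θ₁ (v / A) / A)| ≤ 4 / r * C := by
        rw [abs_mul, abs_div (θ₁ _), abs_of_pos hA0, abs_of_pos (by positivity)]
        calc 2 * v / r * (|θ₁ (v / A)| / A) ≤ 2 * (2 * A) / r * (C / A) := by
              gcongr; exact hC₁ _
          _ = 4 / r * C := by field_simp; ring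
      have b2 : |2 * v * (θ₂ (v / A) / A ^ 2)| ≤ 4 * C := by
        rw [abs_mul, abs_div, abs_of_pos (by positivity : 0 < A ^ 2), abs_of_pos (by positivity)]
        calc 2 * v * (|θ₂ (v / A)| / A ^ 2) ≤ 2 * (2 * A) * (C / A ^ 2) := by
              gcongr; exact hC₂ _
          _ = 4 * C / A := by field_simp; ring
          _ ≤ 4 * C := div_le_self (by positivity) hA
      have b3 : |(n : ℝ) * (θ₁ (v / A) / A)| ≤ n * C := by
        rw [abs_mul, abs_div, abs_of_pos hA0, abs_of_nonneg (Nat.cast_nonneg n)]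
        gcongr
        exact (div_le_self (abs_nonneg _) hA).trans (hC₁ _)
      have hsum : |2 * v / r * (θ₁ (v / A) / A) - 2 * v * (θ₂ (v / A) / A ^ 2)
          - n * (θ₁ (v / A) / A)| ≤ C * (4 / r + 4 + n) := by
        refine (abs_sub _ _).trans ((add_le_add ((abs_sub _ _).trans (add_le_add b1 b2)) b3).trans
          (le_of_eq ?_))
        ring
      have hG0 := heatKer_pos (n := n) hr0 v
      have hdom := hK A hA r hr v hvA
      have h6 : heatKer n (r + 1 / 2) v ≤ 2 * convexTrunc δ (heatKer n (r + 1 / 2) v) := by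
        have k1 := sub_le_convexTrunc (g := heatKer n (r + 1 / 2) v) hδ
        have k2 := heatKer_antitone n hr2 hv2A
        have k3 : heatKer n (r + 1 / 2) (2 * A) = 6 * δ := by simp only [δ]; ring
        linarith
      rw [norm_mul, norm_mul, Real.norm_eq_abs, Real.norm_eq_abs, Real.norm_eq_abs,
        abs_of_pos hG0, abs_of_nonneg hhy]
      calc heatKer n r v * |2 * v / r * (θ₁ (v / A) / A) - 2 * v * (θ₂ (v / A) / A ^ 2)
          - n * (θ₁ (v / A) / A)| * h r y
          ≤ heatKer n r v * (C * (4 / r + 4 + n)) * h r y := by gcongr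
        _ = C * (heatKer n r v * (4 / r + 4 + n)) * h r y := by ring
        _ ≤ C * (K / A * heatKer n (r + 1 / 2) v) * h r y := by gcongr
        _ ≤ C * (K / A * (2 * convexTrunc δ (heatKer n (r + 1 / 2) v))) * h r y := by gcongr
        _ = _ := by ring
    refine (norm_integral_le_of_norm_le (hint.const_mul _) (Eventually.of_forall hpt)).trans ?_
    rw [integral_const_mul]
    gcongr
  -- The derivative bound is uniform in `r`, so the pairing varies by at most a multiple of `S / A`
  -- over the interval.
  have hdiff : ∀ ρ ∈ Ioo 0 S, ∀ r ∈ Ioo 0 S, ‖I ρ - I r‖ ≤ C * K / A * 2 * h (-(1 / 2)) 0 * S := by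
    intro ρ hρ r hr
    have := Convex.norm_image_sub_le_of_norm_hasDerivWithin_le (f := I) (f' := I') (s := Ioo 0 S)
      (fun x hx => (hd x hx).hasDerivWithinAt) hI' (convex_Ioo 0 S) hr hρ
    refine this.trans ?_
    gcongr
    rw [Real.norm_eq_abs, abs_le]
    constructor <;> linarith [hρ.1, hρ.2, hr.1, hr.2]
  intro ρ hρ
  have hθc : Continuous θ := continuous_iff_continuousAt.2 fun v => (h1 v).continuousAt
  have hlim : Tendsto I (𝓝[>] 0) (𝓝 (h 0 0)) := by
    have := tendsto_integral_heatKer_mul_cutoff (V := 2 * A) hh.cont (b := 0)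
      ⟨by norm_num, hS⟩ (η := fun v => θ (v / A)) (by fun_prop)
      (by rw [zero_div]; exact hθl 0 zero_le_one)
      (fun v hv => hθr _ (by rw [le_div_iff₀ hA0]; exact hv.le))
    simp only [zero_add] at this
    exact this
  have hfin := le_of_tendsto (hlim.const_sub (I ρ)).norm (by
    filter_upwards [Ioo_mem_nhdsGT hS] with r hr using hdiff ρ hρ r hr)
  rw [Real.norm_eq_abs] at hfin
  refine hfin.trans (le_of_eq ?_)
  ring

end MeanValueBounds

/-! ### Self-similar change of variables -/

section Rescaling

theorem fderiv_comp_smul_add {E F : Type*} [NormedAddCommGroup E] [NormedSpace ℝ E]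
    [NormedAddCommGroup F] [NormedSpace ℝ F] {g : E → F} (hg : Differentiable ℝ g) (c : ℝ)
    (x y : E) : fderiv ℝ (fun y => g (c • (x + y))) y = c • fderiv ℝ g (c • (x + y)) := by
  have h1 : HasFDerivAt (fun y : E => c • (x + y)) (c • ContinuousLinearMap.id ℝ E) y :=
    ((hasFDerivAt_id y).const_add x).const_smul c
  refine ((hg _).hasFDerivAt.comp y h1).fderiv.trans ?_
  ext v
  simp

theorem laplacian_comp_smul_add {E : Type*} [NormedAddCommGroup E] [InnerProductSpace ℝ E]
    [FiniteDimensional ℝ E] {g : E → ℝ} (hg : ContDiff ℝ 2 g) (c : ℝ) (x y : E) :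
    Laplacian.laplacian (fun y => g (c • (x + y))) y
      = c ^ 2 * Laplacian.laplacian g (c • (x + y)) := by
  have h1 : Differentiable ℝ g := hg.differentiable (by norm_num)
  have h2 : Differentiable ℝ (fderiv ℝ g) :=
    (hg.fderiv_right (m := 1) (by norm_num)).differentiable (by norm_num)
  have h3 : fderiv ℝ (fun y => g (c • (x + y))) = fun y => c • fderiv ℝ g (c • (x + y)) :=
    funext fun y => fderiv_comp_smul_add h1 c x y
  have h4 : fderiv ℝ (fun y => c • fderiv ℝ g (c • (x + y))) y
      = c • c • fderiv ℝ (fderiv ℝ g) (c • (x + y)) := by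
    rw [← fderiv_comp_smul_add h2]
    exact fderiv_const_smul ((h2 _).comp y (by fun_prop : DifferentiableAt ℝ
      (fun y => c • (x + y)) y)) c
  rw [laplacian_eq_sum_fderiv, laplacian_eq_sum_fderiv, h3, h4, Finset.mul_sum]
  refine Finset.sum_congr rfl fun i _ => ?_
  simp
  ring

theorem integral_comp_inv_smul_add {E : Type*} [NormedAddCommGroup E] [InnerProductSpace ℝ E]
    [FiniteDimensional ℝ E] [MeasurableSpace E] [BorelSpace E] (F : E → ℝ) {m : ℝ} (hm : 0 < m)
    (x : E) : ∫ y, F (m⁻¹ • (x + y)) = m ^ Module.finrank ℝ E * ∫ z, F z := by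
  rw [integral_add_left_eq_self (fun y => F (m⁻¹ • y)) x,
    Measure.integral_comp_inv_smul_of_nonneg _ _ hm.le, smul_eq_mul]

variable {d : ℕ} {u : ℝ → EuclideanSpace ℝ (Fin d) → ℝ} {f : EuclideanSpace ℝ (Fin d) → ℝ}

theorem ouGenerator_eq (g : EuclideanSpace ℝ (Fin d) → ℝ) (x : EuclideanSpace ℝ (Fin d)) :
    ouGenerator g x = Laplacian.laplacian g x - fderiv ℝ g x x := by
  unfold ouGenerator gradient
  rw [real_inner_comm, InnerProductSpace.toDual_symm_apply]

namespace IsOUSolution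

theorem continuous (hu : IsOUSolution u f) {t : ℝ} (ht : 0 < t) : Continuous (u t) :=
  (hu.contDiff t ht).continuous

theorem continuousOn_laplacian (hu : IsOUSolution u f) : ContinuousOn
    (fun z : ℝ × EuclideanSpace ℝ (Fin d) => Laplacian.laplacian (u z.1) z.2)
    (Ioi 0 ×ˢ univ) := by
  simp_rw [laplacian_eq_sum_fderiv]
  exact continuousOn_finsetSum _ fun i _ =>
    (hu.continuousOn_fderiv_fderiv.clm_apply continuousOn_const).clm_apply continuousOn_const

/-- Continuous partial derivatives give joint differentiability, which the chain rule needs along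
curves moving in time and space at once. -/
theorem hasFDerivAt_uncurry (hu : IsOUSolution u f) {t : ℝ} (ht : 0 < t)
    (x : EuclideanSpace ℝ (Fin d)) :
    HasFDerivAt (fun z : ℝ × EuclideanSpace ℝ (Fin d) => u z.1 z.2)
      ((ContinuousLinearMap.toSpanSingleton ℝ (ouGenerator (u t) x)).coprod (fderiv ℝ (u t) x))
      (t, x) := by
  have hO : Ioi (0 : ℝ) ×ˢ (univ : Set (EuclideanSpace ℝ (Fin d))) ∈ 𝓝 (t, x) :=
    (isOpen_Ioi.prod isOpen_univ).mem_nhds ⟨ht, mem_univ _⟩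
  have hgen : ContinuousOn (fun z : ℝ × EuclideanSpace ℝ (Fin d) => ouGenerator (u z.1) z.2)
      (Ioi 0 ×ˢ univ) := by
    simp_rw [ouGenerator_eq]
    exact hu.continuousOn_laplacian.sub (hu.continuousOn_fderiv.clm_apply continuousOn_snd)
  refine (hasStrictFDerivAt_uncurry_coprod (u := (t, x)) (f := u)
    (f₁ := fun t x => ContinuousLinearMap.toSpanSingleton ℝ (ouGenerator (u t) x))
    (f₂ := fun t x => fderiv ℝ (u t) x) ?_ ?_ ?_ ?_).hasFDerivAt
  · filter_upwards [hO] with z hz using (hu.equation z.1 hz.1 z.2).hasFDerivAt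
  · filter_upwards [hO] with z hz using
      ((hu.contDiff z.1 hz.1).differentiable (by norm_num) z.2).hasFDerivAt
  · have := (hgen.continuousAt hO)
    exact (ContinuousLinearMap.toSpanSingletonCLE (𝕜 := ℝ) (E := ℝ)).continuous.continuousAt.comp
      this
  · exact hu.continuousOn_fderiv.continuousAt hO

/-- In the self-similar variables an Ornstein-Uhlenbeck solution solves a backward heat
equation. -/
theorem isBackwardHeat (hu : IsOUSolution u f) (T : ℝ) (x : EuclideanSpace ℝ (Fin d)) :
    IsBackwardHeat (fun ρ y => u (T - 1 / 2 * Real.log (1 + ρ)) ((Real.sqrt (1 + ρ))⁻¹ • (x + y)))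
      (-1) (Real.exp (2 * T) - 1) := by
  have hpos : ∀ ρ ∈ Ioo (-1) (Real.exp (2 * T) - 1), 0 < 1 + ρ := fun ρ hρ => by linarith [hρ.1]
  have htime : ∀ ρ ∈ Ioo (-1) (Real.exp (2 * T) - 1), 0 < T - 1 / 2 * Real.log (1 + ρ) := by
    intro ρ hρ
    have := (Real.log_lt_iff_lt_exp (hpos ρ hρ)).2 (by linarith [hρ.2] : 1 + ρ < Real.exp (2 * T))
    linarith
  have hlap : ∀ ρ ∈ Ioo (-1) (Real.exp (2 * T) - 1), ∀ y, Laplacian.laplacian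
      (fun y => u (T - 1 / 2 * Real.log (1 + ρ)) ((Real.sqrt (1 + ρ))⁻¹ • (x + y))) y
      = (1 + ρ)⁻¹ * Laplacian.laplacian (u (T - 1 / 2 * Real.log (1 + ρ)))
        ((Real.sqrt (1 + ρ))⁻¹ • (x + y)) := by
    intro ρ hρ y
    rw [laplacian_comp_smul_add (hu.contDiff _ (htime ρ hρ)), inv_pow,
      Real.sq_sqrt (hpos ρ hρ).le]
  have hmap : ContinuousOn (fun z : ℝ × EuclideanSpace ℝ (Fin d) =>
      (T - 1 / 2 * Real.log (1 + z.1), (Real.sqrt (1 + z.1))⁻¹ • (x + z.2)))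
      (Ioo (-1) (Real.exp (2 * T) - 1) ×ˢ univ) := by
    refine ContinuousOn.prodMk ?_ ?_
    · refine continuousOn_const.sub (continuousOn_const.mul (ContinuousOn.log (by fun_prop) ?_))
      exact fun z hz => (hpos _ hz.1).ne'
    · refine ContinuousOn.smul (ContinuousOn.inv₀ (f := fun z : ℝ × EuclideanSpace ℝ (Fin d) =>
        Real.sqrt (1 + z.1)) (by fun_prop) ?_) (by fun_prop)
      exact fun z hz => (Real.sqrt_pos.2 (hpos _ hz.1)).ne'
  have hmaps : MapsTo (fun z : ℝ × EuclideanSpace ℝ (Fin d) =>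
      (T - 1 / 2 * Real.log (1 + z.1), (Real.sqrt (1 + z.1))⁻¹ • (x + z.2)))
      (Ioo (-1) (Real.exp (2 * T) - 1) ×ˢ univ) (Ioi 0 ×ˢ univ) :=
    fun z hz => ⟨htime _ hz.1, mem_univ _⟩
  refine ⟨fun ρ hρ y => hu.nonneg _ (htime ρ hρ) _, fun ρ hρ => ?_, ?_, ?_, fun ρ hρ y => ?_⟩
  · exact (hu.contDiff _ (htime ρ hρ)).comp (by fun_prop)
  · exact hu.continuousOn.comp hmap hmaps
  · refine ContinuousOn.congr (f := fun z : ℝ × EuclideanSpace ℝ (Fin d) => (1 + z.1)⁻¹ *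
      Laplacian.laplacian (u (T - 1 / 2 * Real.log (1 + z.1)))
        ((Real.sqrt (1 + z.1))⁻¹ • (x + z.2))) ?_ (fun z hz => hlap _ hz.1 _)
    have c1 : ContinuousOn (fun z : ℝ × EuclideanSpace ℝ (Fin d) => (1 + z.1)⁻¹)
        (Ioo (-1) (Real.exp (2 * T) - 1) ×ˢ univ) :=
      ContinuousOn.inv₀ (by fun_prop) fun z hz => (hpos _ hz.1).ne'
    have c2 := hu.continuousOn_laplacian.comp hmap hmaps
    exact c1.mul c2
  · have h0 := hpos ρ hρ
    have hs0 : Real.sqrt (1 + ρ) ≠ 0 := (Real.sqrt_pos.2 h0).ne'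
    rw [hlap ρ hρ]
    have d0 : HasDerivAt (fun r : ℝ => 1 + r) 1 ρ := (hasDerivAt_id ρ).const_add 1
    have d1 : HasDerivAt (fun r => T - 1 / 2 * Real.log (1 + r)) (-(1 / 2) * (1 + ρ)⁻¹) ρ := by
      refine (((d0.log h0.ne').const_mul (1 / 2)).const_sub T).congr_deriv ?_
      rw [one_div]; ring
    have d2 : HasDerivAt (fun r => (Real.sqrt (1 + r))⁻¹ • (x + y))
        ((-(1 / 2) * (1 + ρ)⁻¹) • ((Real.sqrt (1 + ρ))⁻¹ • (x + y))) ρ := by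
      have := ((d0.sqrt h0.ne').inv hs0).smul_const (x + y)
      refine this.congr_deriv ?_
      rw [smul_smul]
      congr 1
      rw [Real.sq_sqrt h0.le]
      field_simp
    -- The contraction of the spatial point contributes `-½(1+ρ)⁻¹ z · ∇u`, which cancels the drift
    -- of `L`; only the Laplacian survives.
    have d3 := (hu.hasFDerivAt_uncurry (htime ρ hρ) ((Real.sqrt (1 + ρ))⁻¹ • (x + y))).comp_hasDerivAt
      ρ (d1.prodMk d2)
    refine d3.congr_deriv ?_
    rw [ContinuousLinearMap.coprod_apply, map_smul, ouGenerator_eq]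
    simp
    ring

end IsOUSolution

end Rescaling

/-! ### Uniqueness of nonnegative solutions -/

section Representation

variable {d : ℕ} {u : ℝ → EuclideanSpace ℝ (Fin d) → ℝ} {f : EuclideanSpace ℝ (Fin d) → ℝ}

namespace IsOUSolution

/-- The initial data are also attained against test functions depending continuously on time. -/
theorem tendsto_integral_mul (hu : IsOUSolution u f) {ψ : ℝ → EuclideanSpace ℝ (Fin d) → ℝ}
    {c R : ℝ} (hc : 0 < c)
    (hψ : ContinuousOn (fun z : ℝ × EuclideanSpace ℝ (Fin d) => ψ z.1 z.2) (Icc 0 c ×ˢ univ))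
    (hR : ∀ t ∈ Icc 0 c, ∀ z, R < ‖z‖ → ψ t z = 0) :
    Tendsto (fun t => ∫ z, u t z * ψ t z) (𝓝[>] 0) (𝓝 (∫ z, f z * ψ 0 z)) := by
  have h0 : (0 : ℝ) ∈ Icc 0 c := ⟨le_rfl, hc.le⟩
  have hcs : ∀ t ∈ Icc 0 c, HasCompactSupport (ψ t) := fun t ht =>
    HasCompactSupport.intro (isCompact_closedBall (0 : EuclideanSpace ℝ (Fin d)) R) fun z hz =>
      hR t ht z (by simpa using hz)
  have hcψ : ∀ t ∈ Icc 0 c, Continuous (ψ t) := fun t ht => hψ.continuous_slice ht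
  have hlim := hu.initial (ψ 0) (hcψ 0 h0) (hcs 0 h0)
  -- Since `χ ≥ 1` on the ball of radius `R` and its pairing with `u t` converges, the mass of `u t`
  -- there stays bounded as `t ↓ 0`; uniform closeness of `ψ t` to `ψ 0` then suffices.
  set χ : EuclideanSpace ℝ (Fin d) → ℝ := fun z => max 0 (R + 1 - ‖z‖) with hχ
  have cχ : Continuous χ := by fun_prop
  have sχ : HasCompactSupport χ :=
    HasCompactSupport.intro (isCompact_closedBall (0 : EuclideanSpace ℝ (Fin d)) (R + 1))
      fun z hz => by
        simp only [Metric.mem_closedBall, dist_zero_right, not_le] at hz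
        exact max_eq_left (by linarith)
  have χ0 : ∀ z, 0 ≤ χ z := fun z => le_max_left _ _
  have χ1 : ∀ z, ‖z‖ ≤ R → 1 ≤ χ z := fun z hz => le_max_of_le_right (by linarith)
  have hχlim := hu.initial χ cχ sχ
  have huc := ((isCompact_Icc (a := 0) (b := c)).prod (isCompact_closedBall
    (0 : EuclideanSpace ℝ (Fin d)) R)).uniformContinuousOn_of_continuous
      (hψ.mono (prod_mono_right (subset_univ _)))
  have hdiff : Tendsto (fun t => (∫ z, u t z * ψ t z) - ∫ z, u t z * ψ 0 z) (𝓝[>] 0) (𝓝 0) := by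
    rw [Metric.tendsto_nhds]
    intro ε hε
    set L := |∫ z, f z * χ z| + 1
    have hL : 0 < L := by positivity
    obtain ⟨δ, hδ, hδ'⟩ := Metric.uniformContinuousOn_iff.1 huc (ε / (2 * L)) (by positivity)
    filter_upwards [Ioo_mem_nhdsGT hδ, Ioo_mem_nhdsGT hc, hχlim.eventually (gt_mem_nhds
      (lt_of_le_of_lt (le_abs_self _) (lt_add_one _)))] with t ht1 ht2 ht3
    have htc : t ∈ Icc 0 c := ⟨ht2.1.le, ht2.2.le⟩
    have cu := hu.continuous ht1.1
    have hi : ∀ s ∈ Icc 0 c, Integrable (fun z => u t z * ψ s z) := fun s hs =>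
      (cu.mul (hcψ s hs)).integrable_of_hasCompactSupport (hcs s hs).mul_left
    have hiχ : Integrable (fun z => u t z * χ z) :=
      (cu.mul cχ).integrable_of_hasCompactSupport sχ.mul_left
    rw [dist_zero_right, ← integral_sub (hi t htc) (hi 0 h0)]
    have hpt : ∀ z, ‖u t z * ψ t z - u t z * ψ 0 z‖ ≤ ε / (2 * L) * (u t z * χ z) := by
      intro z
      have hu0 := hu.nonneg t ht1.1 z
      rw [← mul_sub, norm_mul, Real.norm_eq_abs (u t z), abs_of_nonneg hu0]
      have h1 : ‖ψ t z - ψ 0 z‖ ≤ ε / (2 * L) * χ z := by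
        rcases le_or_gt ‖z‖ R with hz | hz
        · have h2 := hδ' (t, z) ⟨htc, by simpa using hz⟩ (0, z) ⟨h0, by simpa using hz⟩ (by
            rw [Prod.dist_eq, dist_self, max_eq_left dist_nonneg, Real.dist_eq, sub_zero,
              abs_of_pos ht1.1]
            exact ht1.2)
          rw [dist_eq_norm] at h2
          refine h2.le.trans (le_mul_of_one_le_right (by positivity) (χ1 z hz))
        · rw [hR t htc z hz, hR 0 h0 z hz, sub_zero, norm_zero]
          exact mul_nonneg (by positivity) (χ0 z)
      calc u t z * ‖ψ t z - ψ 0 z‖ ≤ u t z * (ε / (2 * L) * χ z) := by gcongr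
        _ = _ := by ring
    refine (norm_integral_le_of_norm_le (hiχ.const_mul _) (Eventually.of_forall hpt)).trans_lt ?_
    rw [integral_const_mul]
    calc ε / (2 * L) * ∫ z, u t z * χ z ≤ ε / (2 * L) * L := by gcongr
      _ = ε / 2 := by field_simp
      _ < ε := half_lt_self hε
  simpa using hdiff.add hlim

/-- Nonnegative solutions are unique: Widder's theorem for the Ornstein-Uhlenbeck equation. -/
theorem eq_ouSemigroup (hu : IsOUSolution u f) (hf : HasCompactSupport f) {T : ℝ} (hT : 0 < T)
    (x : EuclideanSpace ℝ (Fin d)) : u T x = ouSemigroup T f x := by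
  set n := Module.finrank ℝ (EuclideanSpace ℝ (Fin d))
  set S := Real.exp (2 * T) - 1
  have hS : 0 < S := by
    have := Real.one_lt_exp_iff.2 (by linarith : 0 < 2 * T)
    simp only [S]; linarith
  obtain ⟨θ, θ₁, θ₂, C, h1, h2, hc, hθ0, hθ1, hθl, hθr, hC₁, hC₂, l1, l2, r1, r2⟩ :=
    exists_smooth_cutoff
  have hθc : Continuous θ := continuous_iff_continuousAt.2 fun v => (h1 v).continuousAt
  obtain ⟨K, hK⟩ := (hu.isBackwardHeat T x).exists_abs_pairing_sub_le hS h1 h2 hc hθl hθr hC₁ hC₂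
    l1 l2 r1 r2
  have hvalue : u (T - 1 / 2 * Real.log (1 + 0)) ((Real.sqrt (1 + 0))⁻¹ • (x + 0)) = u T x := by
    simp
  simp only [hvalue] at hK
  set G : EuclideanSpace ℝ (Fin d) → ℝ := fun z => heatKer n S (‖Real.exp T • z - x‖ ^ 2)
  -- For fixed `A` let `t ↓ 0`, that is `ρ ↑ S`, in the bound `K / A`. In the original variables the
  -- kernel becomes a time-dependent compactly supported test function, and the Jacobian is
  -- `e^{(T-t)n}`.
  have hlim : ∀ A, 1 ≤ A → |Real.exp T ^ n * (∫ z, f z * (G z *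
      θ (‖Real.exp T • z - x‖ ^ 2 / A))) - u T x| ≤ K / A := by
    intro A hA
    have hA0 : 0 < A := by linarith
    set ρ : ℝ → ℝ := fun t => Real.exp (T - t) ^ 2 - 1
    set ψ : ℝ → EuclideanSpace ℝ (Fin d) → ℝ := fun t z =>
      heatKer n (ρ t) (‖Real.exp (T - t) • z - x‖ ^ 2) * θ (‖Real.exp (T - t) • z - x‖ ^ 2 / A)
    have hρ0 : ∀ t < T, 0 < ρ t := fun t ht => by
      have := Real.one_lt_exp_iff.2 (by linarith : 0 < T - t)
      simp only [ρ]; nlinarith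
    have hρS : ∀ t, 0 < t → ρ t < S := fun t ht => by
      have h3 : Real.exp (2 * T) = Real.exp T ^ 2 := by rw [← Real.exp_nat_mul]; norm_num
      have h4 : Real.exp (T - t) < Real.exp T := Real.exp_lt_exp.2 (by linarith)
      have h5 := Real.exp_pos (T - t)
      simp only [ρ, S, h3]; nlinarith
    have hlimψ := hu.tendsto_integral_mul (ψ := ψ) (c := T / 2) (R := ‖x‖ + Real.sqrt (2 * A))
      (by linarith) (by
        refine ContinuousOn.mul ?_ (by fun_prop)
        refine (continuousOn_heatKer n).comp (f := fun z : ℝ × EuclideanSpace ℝ (Fin d) =>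
          (ρ z.1, ‖Real.exp (T - z.1) • z.2 - x‖ ^ 2)) (by fun_prop) ?_
        exact fun z hz => ⟨hρ0 _ (by linarith [hz.1.2]), mem_univ _⟩) (by
        intro t ht z hz
        have h3 : 1 ≤ Real.exp (T - t) := Real.one_le_exp (by linarith [ht.2])
        have h4 : Real.sqrt (2 * A) < ‖Real.exp (T - t) • z - x‖ := by
          have h5 := norm_sub_norm_le (Real.exp (T - t) • z) x
          rw [norm_smul, Real.norm_eq_abs, abs_of_pos (Real.exp_pos _)] at h5
          have h6 := le_mul_of_one_le_left (norm_nonneg z) h3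
          linarith
        have h5 := (Real.sqrt_lt' ((Real.sqrt_nonneg _).trans_lt h4)).1 h4
        simp only [ψ]
        rw [hθr _ (by rw [le_div_iff₀ hA0]; exact h5.le), mul_zero])
    have hpow : Tendsto (fun t => Real.exp (T - t) ^ n) (𝓝[>] 0) (𝓝 (Real.exp T ^ n)) := by
      have : Continuous fun t => Real.exp (T - t) ^ n := by fun_prop
      have h3 := this.tendsto 0
      rw [sub_zero] at h3
      exact h3.mono_left nhdsWithin_le_nhds
    have hψ0 : ψ 0 = fun z => G z * θ (‖Real.exp T • z - x‖ ^ 2 / A) := by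
      have h3 : Real.exp T ^ 2 = Real.exp (2 * T) := by rw [← Real.exp_nat_mul]; norm_num
      simp only [ψ, G, ρ, S, sub_zero, h3]
    rw [hψ0] at hlimψ
    have hfin := ((hpow.mul hlimψ).sub_const (u T x)).abs
    refine le_of_tendsto hfin ?_
    filter_upwards [Ioo_mem_nhdsGT hT] with t ht
    refine le_trans (le_of_eq ?_) (hK A hA (ρ t) ⟨hρ0 t ht.2, hρS t ht.1⟩)
    congr 2
    have h3 : 1 + ρ t = Real.exp (T - t) ^ 2 := by simp only [ρ]; ring
    have h4 : Real.sqrt (1 + ρ t) = Real.exp (T - t) := by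
      rw [h3, Real.sqrt_sq (Real.exp_pos _).le]
    have h5 : T - 1 / 2 * Real.log (1 + ρ t) = t := by
      rw [h3, Real.log_pow, Real.log_exp]; push_cast; ring
    rw [h4, h5, ← integral_comp_inv_smul_add _ (Real.exp_pos _) x]
    refine integral_congr_ae (Eventually.of_forall fun y => ?_)
    simp only [ψ]
    rw [smul_inv_smul₀ (Real.exp_pos _).ne', add_sub_cancel_left]
    ring
  obtain ⟨V, hV⟩ : ∃ V, ∀ z, f z ≠ 0 → ‖Real.exp T • z - x‖ ^ 2 ≤ V := by
    obtain ⟨V, hV⟩ := hf.isCompact.exists_bound_of_continuousOn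
      (f := fun z => ‖Real.exp T • z - x‖ ^ 2) (by fun_prop)
    exact ⟨V, fun z hz => (le_abs_self _).trans (hV z (subset_tsupport f hz))⟩
  -- Since `f` has compact support, the cutoff is invisible for large `A`: the left side no longer
  -- depends on `A`, while `K / A → 0`.
  have hJ : ∀ A, max 1 V ≤ A → |Real.exp T ^ n * (∫ z, f z * G z) - u T x| ≤ K / A := by
    intro A hA
    have hA0 : 0 < A := by linarith [(le_max_left 1 V).trans hA]
    refine le_trans (le_of_eq ?_) (hlim A ((le_max_left 1 V).trans hA))
    congr 4
    ext z
    by_cases hz : f z = 0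
    · simp [hz]
    · rw [hθl, mul_one]
      rw [div_le_one hA0]
      exact (hV z hz).trans ((le_max_right 1 V).trans hA)
  have hzero : |Real.exp T ^ n * (∫ z, f z * G z) - u T x| ≤ 0 := by
    refine ge_of_tendsto (tendsto_const_nhds.div_atTop tendsto_id : Tendsto (fun A : ℝ => K / A)
      atTop (𝓝 0)) ?_
    filter_upwards [eventually_ge_atTop (max 1 V)] with A hA using hJ A hA
  have heq := sub_eq_zero.1 (abs_nonpos_iff.1 hzero)
  rw [← heq, ← integral_comp_inv_smul_add _ (Real.exp_pos _) x]
  have hsqrt : Real.exp (-T) * Real.sqrt S = Real.sqrt (1 - Real.exp (-2 * T)) := by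
    rw [← Real.sqrt_sq (Real.exp_pos (-T)).le, ← Real.sqrt_mul (sq_nonneg _)]
    congr 1
    simp only [S]
    rw [mul_sub, ← Real.exp_nat_mul, ← Real.exp_add]
    norm_num
  have := integral_stdGaussian_sqrt_smul hS (E := EuclideanSpace ℝ (Fin d))
    (fun y => f ((Real.exp T)⁻¹ • (x + y)))
  unfold ouSemigroup
  calc _ = ∫ y, heatKer n S (‖y‖ ^ 2) * f ((Real.exp T)⁻¹ • (x + y)) := by
        refine integral_congr_ae (Eventually.of_forall fun y => ?_)
        simp only [G]
        rw [smul_inv_smul₀ (Real.exp_pos _).ne', add_sub_cancel_left, mul_comm]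
    _ = _ := this.symm
    _ = _ := by
        refine integral_congr_ae (Eventually.of_forall fun y => ?_)
        simp only
        rw [← hsqrt, ← Real.exp_neg, smul_add, smul_smul]

end IsOUSolution

end Representation

/-! ### Semigroup law, strict positivity and the conclusion -/

section Monotonicity

variable {d : ℕ} {u : ℝ → EuclideanSpace ℝ (Fin d) → ℝ} {f : EuclideanSpace ℝ (Fin d) → ℝ}

theorem map_smul_gaussMeasure_absolutelyContinuous {c : ℝ} (hc : 0 < c) :
    (gaussMeasure d).map (c • ·) ≪ volume := by
  refine (stdGaussian_absolutelyContinuous_volume.map (by fun_prop)).trans ?_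
  rw [Measure.map_addHaar_smul _ hc.ne']
  exact Measure.smul_absolutelyContinuous

/-- As `f` is only almost everywhere strongly measurable for Lebesgue measure, a positive dilation
is needed to keep the Gaussian law absolutely continuous and transfer measurability. -/
theorem integrable_map_smul_gaussMeasure {c M : ℝ} (hc : 0 < c)
    (hf : AEStronglyMeasurable f volume) (hM : ∀ x, |f x| ≤ M) (x : EuclideanSpace ℝ (Fin d)) :
    Integrable (fun y => f (x + y)) ((gaussMeasure d).map (c • ·)) := by
  have : IsFiniteMeasure ((gaussMeasure d).map (c • ·)) := by infer_instance
  refine Integrable.of_bound ?_ M (Eventually.of_forall fun y => hM _)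
  exact (hf.comp_quasiMeasurePreserving (quasiMeasurePreserving_add_left volume x)).mono_ac
    (map_smul_gaussMeasure_absolutelyContinuous hc)

theorem sqrt_one_sub_exp_pos {t : ℝ} (ht : 0 < t) : 0 < Real.sqrt (1 - Real.exp (-2 * t)) := by
  have := (Real.exp_lt_exp.2 (by linarith : -2 * t < 0)).trans_eq Real.exp_zero
  exact Real.sqrt_pos.2 (by linarith)

theorem ouSemigroup_ouSemigroup {t r M : ℝ} (ht : 0 < t) (hr : 0 < r)
    (hf : AEStronglyMeasurable f volume) (hM : ∀ x, |f x| ≤ M) (x : EuclideanSpace ℝ (Fin d)) :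
    ouSemigroup r (ouSemigroup t f) x = ouSemigroup (r + t) f x := by
  have habc : (Real.exp (-t) * Real.sqrt (1 - Real.exp (-2 * r))) ^ 2
      + Real.sqrt (1 - Real.exp (-2 * t)) ^ 2 = Real.sqrt (1 - Real.exp (-2 * (r + t))) ^ 2 := by
    have h1 := exp_neg_sq_add_sqrt_sq ht.le
    have h2 := exp_neg_sq_add_sqrt_sq hr.le
    have h3 := exp_neg_sq_add_sqrt_sq (by linarith : 0 ≤ r + t)
    have h4 : Real.exp (-(r + t)) = Real.exp (-r) * Real.exp (-t) := by
      rw [← Real.exp_add]; ring_nf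
    rw [h4] at h3
    rw [mul_pow]
    linear_combination h1 - h3 + Real.exp (-t) ^ 2 * h2
  have := integral_integral_smul_add_smul_stdGaussian habc
    (integrable_map_smul_gaussMeasure (sqrt_one_sub_exp_pos (by linarith : 0 < r + t)) hf hM
      (Real.exp (-(r + t)) • x))
  unfold ouSemigroup
  rw [← this]
  refine integral_congr_ae (Eventually.of_forall fun y => integral_congr_ae
    (Eventually.of_forall fun z => ?_))
  simp only
  congr 1
  rw [smul_add, smul_smul, smul_smul, ← Real.exp_add, add_assoc]
  ring_nf

/-- A zero average of a nonnegative function forces it to vanish Gaussian-almost everywhere, hence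
Lebesgue-almost everywhere along an invertible affine map, so `f` would be null. -/
theorem ouSemigroup_pos {t M : ℝ} (ht : 0 < t) (hf : AEStronglyMeasurable f volume)
    (hf0 : ∀ x, 0 ≤ f x) (hM : ∀ x, f x ≤ M) (hne : ¬ f =ᵐ[volume] 0)
    (x : EuclideanSpace ℝ (Fin d)) : 0 < ouSemigroup t f x := by
  have hb := sqrt_one_sub_exp_pos ht
  set b := Real.sqrt (1 - Real.exp (-2 * t))
  refine lt_of_le_of_ne (integral_nonneg fun _ => hf0 _) fun h0 => hne ?_
  have hi := (integrable_map_measure (integrable_map_smul_gaussMeasure hb hf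
    (fun x => abs_le.2 ⟨by linarith [hf0 x, hM x], hM x⟩) (Real.exp (-t) • x)).1
      (by fun_prop)).1 (integrable_map_smul_gaussMeasure hb hf
    (fun x => abs_le.2 ⟨by linarith [hf0 x, hM x], hM x⟩) (Real.exp (-t) • x))
  have h1 := (integral_eq_zero_iff_of_nonneg (fun _ => hf0 _) hi).1 h0.symm
  have h2 := volume_absolutelyContinuous_stdGaussian.ae_le h1
  have hq : Measure.QuasiMeasurePreserving
      (fun z : EuclideanSpace ℝ (Fin d) => b⁻¹ • (-(Real.exp (-t) • x) + z)) volume volume := by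
    refine Measure.QuasiMeasurePreserving.comp (g := fun z => b⁻¹ • z)
      ⟨by fun_prop, ?_⟩ (quasiMeasurePreserving_add_left volume _)
    rw [Measure.map_addHaar_smul _ (inv_ne_zero hb.ne')]
    exact Measure.smul_absolutelyContinuous
  filter_upwards [hq.ae h2] with z hz
  simpa [smul_inv_smul₀ hb.ne'] using hz

theorem integral_gaussMeasure_pos {g : EuclideanSpace ℝ (Fin d) → ℝ}
    (hg : Integrable g (gaussMeasure d)) (h0 : ∀ x, 0 < g x) : 0 < ∫ x, g x ∂(gaussMeasure d) := by
  rw [integral_pos_iff_support_of_nonneg (fun x => (h0 x).le) hg]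
  have : Function.support g = univ := Set.eq_univ_of_forall fun x => (h0 x).ne'
  rw [this]
  simp

end Monotonicity

theorem corollary2 (d : ℕ) (hd : 1 ≤ d) (p q s : ℝ) (hp : 1 < p) (hpq : p < q)
    (hs : Real.exp (2 * s) = (q - 1) / (p - 1))
    (f : EuclideanSpace ℝ (Fin d) → ℝ) (hf_meas : AEStronglyMeasurable f volume)
    (hf_nonneg : ∀ x, 0 ≤ f x) (hf_bdd : ∃ M : ℝ, ∀ x, f x ≤ M) (hf_supp : HasCompactSupport f)
    (u : ℝ → EuclideanSpace ℝ (Fin d) → ℝ) (hu : IsOUSolution u f) :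
    (∀ t, 0 < t → ∀ x, Integrable
      (fun y => u t (Real.exp (-s) • x + Real.sqrt (1 - Real.exp (-2 * s)) • y) ^ (1 / p))
      (gaussMeasure d)) ∧
    (∀ t, 0 < t → Integrable
      (fun x => (ouSemigroup s (fun z => u t z ^ (1 / p)) x) ^ q) (gaussMeasure d)) ∧
    (¬ f =ᵐ[volume] 0 → ∀ t, 0 < t → 0 < ouQ p q s u t) ∧
    MonotoneOn (ouQ p q s u) (Ioi 0) := by
  obtain ⟨M, hM⟩ := hf_bdd
  have hM0 : 0 ≤ M := (hf_nonneg 0).trans (hM 0)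
  have hp0 : 0 < p := by linarith
  have hq0 : 0 < q := by linarith
  have habs : ∀ x, |f x| ≤ M := fun x => by rw [abs_of_nonneg (hf_nonneg x)]; exact hM x
  have hrep : ∀ t, 0 < t → u t = ouSemigroup t f := fun t ht =>
    funext fun x => hu.eq_ouSemigroup hf_supp ht x
  have hu0 := hu.nonneg
  have huM : ∀ t, 0 < t → ∀ x, u t x ≤ M := fun t ht x => by
    rw [hrep t ht, ouSemigroup_eq_gaussAvg]
    exact (le_abs_self _).trans (abs_gaussAvg_le habs _)
  have hcont : ∀ t, 0 < t → Continuous fun z => u t z ^ (1 / p) := fun t ht =>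
    (hu.continuous ht).rpow_const fun _ => Or.inr (by positivity)
  have hbd : ∀ t, 0 < t → ∀ z, |u t z ^ (1 / p)| ≤ M ^ (1 / p) := fun t ht z => by
    have := hu0 t ht z
    rw [abs_of_nonneg (by positivity)]
    exact Real.rpow_le_rpow this (huM t ht z) (by positivity)
  have hPcont : ∀ t, 0 < t → Continuous (ouSemigroup s fun z => u t z ^ (1 / p)) := fun t ht =>
    (continuous_gaussAvg (hcont t ht) (hbd t ht)).comp
      (by fun_prop : Continuous fun x : EuclideanSpace ℝ (Fin d) => Real.exp (-s) • x)
  have hP0 : ∀ t, 0 < t → ∀ x, 0 ≤ ouSemigroup s (fun z => u t z ^ (1 / p)) x := fun t ht x =>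
    integral_nonneg fun _ => Real.rpow_nonneg (hu0 t ht _) _
  have hPqcont : ∀ t, 0 < t →
      Continuous fun x => ouSemigroup s (fun z => u t z ^ (1 / p)) x ^ q := fun t ht =>
    (hPcont t ht).rpow_const fun _ => Or.inr hq0.le
  have hPqbd : ∀ t, 0 < t → ∀ x,
      |ouSemigroup s (fun z => u t z ^ (1 / p)) x ^ q| ≤ (M ^ (1 / p)) ^ q := fun t ht x => by
    rw [abs_of_nonneg (Real.rpow_nonneg (hP0 t ht x) _)]
    exact Real.rpow_le_rpow (hP0 t ht x)
      ((le_abs_self _).trans (abs_gaussAvg_le (hbd t ht) _)) hq0.le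
  have hint : ∀ t, 0 < t → ∀ x, Integrable
      (fun y => u t (Real.exp (-s) • x + Real.sqrt (1 - Real.exp (-2 * s)) • y) ^ (1 / p))
      (gaussMeasure d) := fun t ht x =>
    Continuous.integrable_of_bounded ((hcont t ht).comp (by fun_prop :
      Continuous fun y : EuclideanSpace ℝ (Fin d) =>
        Real.exp (-s) • x + Real.sqrt (1 - Real.exp (-2 * s)) • y)) fun y => hbd t ht _
  have hintq : ∀ t, 0 < t → Integrable
      (fun x => (ouSemigroup s (fun z => u t z ^ (1 / p)) x) ^ q) (gaussMeasure d) := fun t ht =>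
    (hPqcont t ht).integrable_of_bounded (hPqbd t ht)
  refine ⟨hint, hintq, fun hne t ht => ?_, ?_⟩
  · refine integral_gaussMeasure_pos (hintq t ht) fun x => Real.rpow_pos_of_pos ?_ _
    refine integral_gaussMeasure_pos (hint t ht x) fun y => Real.rpow_pos_of_pos ?_ _
    rw [hrep t ht]
    exact ouSemigroup_pos ht hf_meas hf_nonneg hM hne _
  · intro t₁ (ht₁ : 0 < t₁) t₂ (ht₂ : 0 < t₂) hle
    rcases hle.eq_or_lt with rfl | hlt
    · exact le_rfl
    have hr : 0 < t₂ - t₁ := by linarith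
    have hstep : u t₂ = ouSemigroup (t₂ - t₁) (u t₁) := by
      funext x
      rw [hrep t₂ ht₂, hrep t₁ ht₁, ouSemigroup_ouSemigroup ht₁ hr hf_meas habs, sub_add_cancel]
    unfold ouQ
    -- Invariance of the Gaussian measure inserts `e^{rL}`, `r = t₂ - t₁`, under the integral of
    -- `Q(t₁)`; the two integrands then compare pointwise.
    rw [← integral_ouSemigroup hr.le (hPqcont t₁ ht₁) (hPqbd t₁ ht₁)]
    refine integral_mono ?_ (hintq t₂ ht₂) fun x => ?_
    · exact Continuous.integrable_of_bounded ((continuous_gaussAvg (hPqcont t₁ ht₁)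
        (hPqbd t₁ ht₁)).comp (by fun_prop :
          Continuous fun x : EuclideanSpace ℝ (Fin d) => Real.exp (-(t₂ - t₁)) • x))
        fun x => abs_gaussAvg_le (hPqbd t₁ ht₁) _
    · have := ouSemigroup_rpow_ouSemigroup_le hp hpq hs hr.le (hu.continuous ht₁) (hu0 t₁ ht₁)
        (huM t₁ ht₁) x
      rw [← hstep] at this
      exact this
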